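/- Let $M$ be a smooth finite-dimensional manifold with a good open cover $\{U_i\}_{i\in J}$ (every non-empty finite intersection of members is contractible), and write $U_{ij}=U_i\cap U_j$, $U_{ijk}=U_i\cap U_j\cap U_k$. A *$U(1)$-bundle with connection* is a family $(g_{ij},A_j)_{i,j\in J}$ of smooth functions $g_{ij}:U_{ij}\to U(1)$ and smooth real $1$-forms $A_j$ on $U_j$ with $g_{ij}g_{jk}=g_{ik}$ on $U_{ijk}$ and $i(A_k-A_j)=d\log g_{jk}$ on $U_{jk}$. An *object* $(p,T)$ consists of a smooth path $p:[a,b]\to M$, $a<b$, constant near $a$ and near $b$, and a labelled partition $T$: points $a=x_0<x_1<\dots<x_N=b$ and labels $i_1,\dots,i_N\in J$ with $p([x_{\alpha-1},x_\alpha])\subset U_{i_\alpha}$. If $(p,T)$, $(p',T')$ are objects on $[a,b]$, $[b,c]$ with $p(b)=p'(b)$, then $(p\circ p',T\circ T')$ is the object on $[a,c]$ obtained by gluing them. A *rank-$1$, embedded, $1$-dimensional TQFT with target $M$* is a pair $(Z',Z)$ which assigns $Z'(y^{\pm},i,j)\in U(1)$ to every $i,j\in J$, $y\in U_{ij}$ and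 sign $\pm$, and $Z(p,T)\in U(1)$ to every object $(p,T)$, such that 1. $Z'(y^\pm,i,j)\,Z'(y^\pm,j,k)=Z'(y^\pm,i,k)$ for $y\in U_{ijk}$; 2. $Z(p',T')=Z'(p(a)^-,i_1,i'_1)\,Z(p,T)\,Z'(p(b)^+,i_N,i'_{N'})$ whenever $p=p'\circ f$ for an orientation-preserving diffeomorphism $f:[a,b]\to[a',b']$ (with $T$, $T'$ arbitrary); 3. $Z(p\circ p',T\circ T')=Z(p,T)\,Z'(p(b)^+,i_N,i'_1)\,Z(p',T')$ whenever $(p,T)$ and $(p',T')$ can be glued. It is *thin invariant* if $Z(p,T)=Z(p',T')$ whenever $p,p'$ are paths on the same interval $[a,b]$, $i_1=i'_1$, $i_N=i'_{N'}$, and there is a smooth homotopy $H:[a,b]\times[0,1]\to M$ from $p$ to $p'$, fixing the end points, with $\operatorname{rank} DH\le 1$ everywhere. It is *smooth* if $u\mapsto Z(p_u,T_u)$ is smooth for every smooth family of objects $(p_u,T_u)$, $u\in W\subset\mathbb{R}^k$ open (that is, $N$ and the labels are fixed, and $x_\alpha(u)$ and $p_u(s)$ are smooth in $u$ and in $(u,s)$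 respectively). **Theorem.** There is a bijection between $U(1)$-bundles with connection $(g_{ij},A_j)$ on $M$ and smooth, thin invariant, rank-$1$, embedded, $1$-dimensional TQFTs $(Z',Z)$ with target $M$ (no passage to equivalence classes on either side). It sends $(g_{ij},A_j)$ to the TQFT $$Z'(y^+,i,j)=g_{ij}(y),\qquad Z'(y^-,i,j)=\overline{g_{ij}(y)},$$ $$Z(p,T)=\prod_{\alpha=1}^{N}\exp\Big(i\int_{x_{\alpha-1}}^{x_\alpha}p^*(A_{i_\alpha})\Big)\cdot\prod_{\alpha=1}^{N-1}g_{i_\alpha i_{\alpha+1}}(p(x_\alpha)),$$ and its inverse sends $(Z',Z)$ to the bundle with connection $$g_{ij}(y)=Z(t_y,ij),\qquad i(A_j)_y(v)=\frac{d}{dt}\log Z(q_t,j)\Big|_{t=0}.$$ Here $t_y$ is the constant path $[0,1]\to\{y\}$, and $ij$ labels $[0,1/2]$ by $i$ and $[1/2,1]$ by $j$; $q:(-\delta,\delta)\to U_j$ is any smooth path with $q(0)=y$ and $\dot q(0)=v$, and $q_t=q\circ\tau_t:[0,1]\to U_j$, where $\tau_t:[0,1]\to(-\delta,\delta)$ is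 any smooth function equal to $0$ near $0$ and to $t$ near $1$, with the label $j$ on the whole interval $[0,1]$. -/

import Mathlib

open scoped Manifold ContDiff
open Set TopologicalSpace

noncomputable section

variable {E : Type*} [NormedAddCommGroup E] [NormedSpace ℝ E]
  {M : Type*} [TopologicalSpace M] [ChartedSpace E M] {J : Type*}

/-- A good open cover of `M`: every non-empty intersection of finitely many
(and at least one) of its members is contractible. -/
structure IsGoodCover (U : J → Opens M) : Prop where
  covers : ∀ y : M, ∃ i, y ∈ U i
  contractible : ∀ s : Finset J, s.Nonempty → (⋂ i ∈ s, (U i : Set M)).Nonempty →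
    ContractibleSpace (⋂ i ∈ s, (U i : Set M) : Set M)

/-! ### Bundles with connection, in terms of local data -/

/-- The derivative of the inclusion of an open subset `V` of `M`. -/
def dIncl {V : Opens M} (y : V) : TangentSpace 𝓘(ℝ, E) y →L[ℝ] TangentSpace 𝓘(ℝ, E) (y : M) :=
  mfderiv 𝓘(ℝ, E) 𝓘(ℝ, E) (fun z : V => (z : M)) y

/-- `d log g = g⁻¹ dg` for a `U(1)`-valued function `g` on an open subset `V` of `M`. -/
def dLog {V : Opens M} (g : V → Circle) (y : V) (v : TangentSpace 𝓘(ℝ, E) y) : ℂ :=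
  let dg : TangentSpace 𝓘(ℝ, E) y →L[ℝ] ℂ := mfderiv 𝓘(ℝ, E) 𝓘(ℝ, ℂ) (fun z => (g z : ℂ)) y
  (g y : ℂ)⁻¹ * dg v

/-- A `U(1)`-bundle with connection relative to the cover `U`: smooth transition functions
`g i j` on `U i ∩ U j` and smooth real `1`-forms `A j` on `U j`. -/
structure BundleWithConnection (U : J → Opens M) [IsManifold 𝓘(ℝ, E) ∞ M] where
  g : ∀ i j : J, (U i ⊓ U j : Opens M) → Circle
  A : ∀ (j : J) (y : U j), TangentSpace 𝓘(ℝ, E) (y : M) →L[ℝ] ℝ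
  smooth_g : ∀ i j, ContMDiff 𝓘(ℝ, E) (𝓡 1) ∞ (g i j)
  /-- `A j`, as a map from `U j` to the total space of the cotangent bundle, is smooth. -/
  smooth_A : ∀ j, ContMDiff 𝓘(ℝ, E) (𝓘(ℝ, E).prod 𝓘(ℝ, E →L[ℝ] ℝ)) ∞
    (fun y : U j => Bundle.TotalSpace.mk' (E →L[ℝ] ℝ)
      (E := fun b : M => TangentSpace 𝓘(ℝ, E) b →L[ℝ] ℝ) (y : M) (A j y))
  cocycle : ∀ (i j k : J) (y : M) (hi : y ∈ U i) (hj : y ∈ U j) (hk : y ∈ U k),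
    g i j ⟨y, hi, hj⟩ * g j k ⟨y, hj, hk⟩ = g i k ⟨y, hi, hk⟩
  /-- `i (A k - A j) = d log (g j k)` on `U j ∩ U k`; the forms `A j` and `A k` are pulled back to
  `U j ∩ U k` along the inclusion. -/
  connection : ∀ (j k : J) (y : (U j ⊓ U k : Opens M)) (v : TangentSpace 𝓘(ℝ, E) y),
    Complex.I * ((A k ⟨y, y.2.2⟩ (dIncl y v) - A j ⟨y, y.2.1⟩ (dIncl y v) : ℝ) : ℂ)
      = dLog (g j k) y v

/-! ### The zero- and one-dimensional objects -/

/-- Orientation of a point. -/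
inductive PointSign
  | pos
  | neg

/-- An isomorphism `(y^±, i, j) : (y^±, i) → (y^±, j)` between irreducible subobjects. -/
structure SubobjectIso (U : J → Opens M) where
  sign : PointSign
  y : M
  i : J
  j : J
  mem_i : y ∈ U i
  mem_j : y ∈ U j

/-- `(p, T)` is an irreducible one-dimensional object. The partition has `n + 1` intervals,
the points `x 0 < ⋯ < x (n + 1)` (so that the path has domain `[a, b] = [x 0, x (n + 1)]`) and
the label `i α` on the interval `[x α, x (α + 1)]`. The path, being constant near `a` and near `b`,
is extended to a smooth map on the line by its constant values `p a` to the left of `a` and `p b`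
to the right of `b`; thus `p` is determined by its restriction to `[a, b]`. -/
structure IsPathObject (U : J → Opens M) (n : ℕ) (x : Fin (n + 2) → ℝ) (i : Fin (n + 1) → J)
    (p : ℝ → M) : Prop where
  strictMono : StrictMono x
  smooth : ContMDiff 𝓘(ℝ, ℝ) 𝓘(ℝ, E) ∞ p
  const_left : ∃ ε > 0, ∀ s < x 0 + ε, p s = p (x 0)
  const_right : ∃ ε > 0, ∀ s > x (Fin.last (n + 1)) - ε, p s = p (x (Fin.last (n + 1)))
  mem : ∀ α : Fin (n + 1), ∀ s ∈ Icc (x α.castSucc) (x α.succ), p s ∈ U (i α)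

/-- Irreducible one-dimensional objects `(p, T)` with target `M`. -/
structure PathObject (U : J → Opens M) where
  n : ℕ
  x : Fin (n + 2) → ℝ
  i : Fin (n + 1) → J
  p : ℝ → M
  isPathObject : IsPathObject (E := E) U n x i p

namespace PathObject

variable {U : J → Opens M} (P P' : PathObject (E := E) U)

/-- Left end point of the domain. -/
def a : ℝ := P.x 0

/-- Right end point of the domain. -/
def b : ℝ := P.x (Fin.last (P.n + 1))

/-- First label. -/
def iFirst : J := P.i 0

/-- Last label. -/
def iLast : J := P.i (Fin.last P.n)

theorem mem_first : P.p P.a ∈ U P.iFirst :=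
  P.isPathObject.mem 0 _
    ⟨le_rfl, (P.isPathObject.strictMono (Fin.castSucc_lt_succ (i := (0 : Fin (P.n + 1))))).le⟩

theorem mem_last : P.p P.b ∈ U P.iLast :=
  P.isPathObject.mem (Fin.last P.n) _
    ⟨(P.isPathObject.strictMono (Fin.castSucc_lt_succ)).le, le_rfl⟩

theorem x_le_b (k : Fin (P.n + 2)) : P.x k ≤ P.b :=
  P.isPathObject.strictMono.monotone (Fin.le_last k)

theorem a_le_x (k : Fin (P.n + 2)) : P.a ≤ P.x k :=
  P.isPathObject.strictMono.monotone (Fin.zero_le k)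

/-- The partition points of `T ∘ T'`. -/
def glueX : Fin (P.n + P'.n + 1 + 2) → ℝ := fun k =>
  if h : k.val < P.n + 2 then P.x ⟨k.val, h⟩
  else P'.x ⟨k.val - (P.n + 1), by have := k.isLt; omega⟩

/-- The labels of `T ∘ T'`. -/
def glueI : Fin (P.n + P'.n + 1 + 1) → J := fun k =>
  if h : k.val < P.n + 1 then P.i ⟨k.val, h⟩
  else P'.i ⟨k.val - (P.n + 1), by have := k.isLt; omega⟩

/-- The glued path `p ∘ p'`. -/
def glueP : ℝ → M := fun s => if s ≤ P.b then P.p s else P'.p s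

variable {P P'}

theorem glueX_of_ge (hb : P.b = P'.a) (k : Fin (P.n + P'.n + 1 + 2)) (hk : P.n + 1 ≤ k.val) :
    glueX P P' k = P'.x ⟨k.val - (P.n + 1), by have := k.isLt; omega⟩ := by
  unfold glueX
  split_ifs with h
  · have hk' : k.val = P.n + 1 := by omega
    have h1 : (⟨k.val, h⟩ : Fin (P.n + 2)) = Fin.last (P.n + 1) := Fin.ext hk'
    have h2 : (⟨k.val - (P.n + 1), by have := k.isLt; omega⟩ : Fin (P'.n + 2)) = 0 :=
      Fin.ext (by simp [hk'])
    rw [h1, h2]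
    exact hb
  · rfl

theorem glue_isPathObject (hb : P.b = P'.a) (hp : P.p P.b = P'.p P'.a) :
    IsPathObject (E := E) U (P.n + P'.n + 1) (glueX P P') (glueI P P') (glueP P P') := by
  obtain ⟨ε, hε, hPr⟩ := P.isPathObject.const_right
  obtain ⟨ε', hε', hPl'⟩ := P'.isPathObject.const_left
  change ∀ s > P.b - ε, P.p s = P.p P.b at hPr
  change ∀ s < P'.a + ε', P'.p s = P'.p P'.a at hPl'
  have hx0 : glueX P P' 0 = P.a := by simp [glueX, a]
  have hxl : glueX P P' (Fin.last _) = P'.b := by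
    rw [glueX_of_ge hb _ (by simp; omega)]
    congr 1
    ext
    simp
    omega
  have hab : P.a < P.b := P.isPathObject.strictMono (Fin.last_pos)
  have hab' : P'.a < P'.b := P'.isPathObject.strictMono (Fin.last_pos)
  refine ⟨?_, ?_, ?_, ?_, ?_⟩
  · rw [Fin.strictMono_iff_lt_succ]
    intro k
    by_cases h : k.val < P.n + 1
    · have h1 : k.val < P.n + 2 := by omega
      have h2 : k.val + 1 < P.n + 2 := by omega
      simp only [glueX, Fin.val_castSucc, Fin.val_succ, h1, h2, dif_pos]
      exact P.isPathObject.strictMono (by simp [Fin.lt_def])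
    · rw [glueX_of_ge hb _ (by simp; omega), glueX_of_ge hb _ (by simp; omega)]
      exact P'.isPathObject.strictMono (by simp [Fin.lt_def]; omega)
  · intro s
    rcases lt_trichotomy s P.b with h | h | h
    · refine (P.isPathObject.smooth s).congr_of_eventuallyEq ?_
      filter_upwards [eventually_lt_nhds h] with r hr
      simp [glueP, hr.le]
    · refine (contMDiffAt_const (c := P.p P.b)).congr_of_eventuallyEq ?_
      subst h
      filter_upwards [eventually_gt_nhds (sub_lt_self P.b hε),
        eventually_lt_nhds (lt_add_of_pos_right P.b hε')] with r hr hr'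
      unfold glueP
      split_ifs
      · exact hPr r hr
      · rw [hPl' r (by rwa [← hb]), hp]
    · refine (P'.isPathObject.smooth s).congr_of_eventuallyEq ?_
      filter_upwards [eventually_gt_nhds h] with r hr
      simp [glueP, not_le.2 hr]
  · obtain ⟨δ, hδ, h⟩ := P.isPathObject.const_left
    refine ⟨min δ (P.b - P.a), lt_min hδ (sub_pos.2 hab), fun s hs => ?_⟩
    rw [hx0] at hs ⊢
    have h1 : s ≤ P.b := by have := min_le_right δ (P.b - P.a); linarith
    have h2 : s < P.a + δ := by have := min_le_left δ (P.b - P.a); linarith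
    simp only [glueP, h1, hab.le, if_true]
    exact h s h2
  · obtain ⟨δ, hδ, h⟩ := P'.isPathObject.const_right
    refine ⟨min δ (P'.b - P'.a), lt_min hδ (sub_pos.2 hab'), fun s hs => ?_⟩
    rw [hxl] at hs ⊢
    have h1 : ¬ s ≤ P.b := by have := min_le_right δ (P'.b - P'.a); linarith
    have h2 : s > P'.b - δ := by have := min_le_left δ (P'.b - P'.a); linarith
    have h3 : ¬ P'.b ≤ P.b := by linarith
    simp only [glueP, h1, h3, if_false]
    exact h s h2
  · intro k s hs
    by_cases h : k.val < P.n + 1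
    · have h1 : k.val < P.n + 2 := by omega
      have h2 : k.val + 1 < P.n + 2 := by omega
      simp only [glueX, Fin.val_castSucc, Fin.val_succ, h1, h2, dif_pos] at hs
      have hsb : s ≤ P.b := hs.2.trans (P.x_le_b _)
      simp only [glueP, glueI, hsb, h, if_true, dif_pos]
      exact P.isPathObject.mem ⟨k.val, h⟩ s hs
    · rw [glueX_of_ge hb _ (by simp; omega), glueX_of_ge hb _ (by simp; omega)] at hs
      have hk := k.isLt
      have hlt : k.val - (P.n + 1) < P'.n + 1 := by omega
      have hs2 : s ≤ P'.x (Fin.succ ⟨k.val - (P.n + 1), hlt⟩) := by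
        refine hs.2.trans_eq (congrArg P'.x (Fin.ext ?_))
        simp only [Fin.val_succ]
        omega
      have hm := P'.isPathObject.mem ⟨k.val - (P.n + 1), hlt⟩ s ⟨hs.1, hs2⟩
      have has : P'.a ≤ s := (P'.a_le_x _).trans hs.1
      simp only [glueI, h, dif_neg, not_false_iff]
      unfold glueP
      split_ifs with h'
      · have : s = P'.a := le_antisymm (h'.trans hb.le) has
        subst this
        rw [← hb, hp]
        exact hm
      · exact hm

variable (P P')

/-- The object `(p ∘ p', T ∘ T')` which results from gluing `(p, T)`, on `[a, b]`, and `(p', T')`,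
on `[b, c]`, where `p b = p' b`. -/
def glue (hb : P.b = P'.a) (hp : P.p P.b = P'.p P'.a) : PathObject (E := E) U where
  n := P.n + P'.n + 1
  x := glueX P P'
  i := glueI P P'
  p := glueP P P'
  isPathObject := glue_isPathObject hb hp

end PathObject

/-- The object `(t_y, ij)`: the constant path from `[0, 1]` to `y`, with `[0, 1/2]` labelled by `i`
and `[1/2, 1]` labelled by `j`. -/
def constPath (U : J → Opens M) (i j : J) (y : M) (hi : y ∈ U i) (hj : y ∈ U j) :
    PathObject (E := E) U where
  n := 1
  x := ![0, 1 / 2, 1]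
  i := ![i, j]
  p := fun _ => y
  isPathObject :=
    { strictMono := by
        rw [Fin.strictMono_iff_lt_succ]
        intro k
        fin_cases k
        · simp
        · simp; norm_num
      smooth := contMDiff_const
      const_left := ⟨1, one_pos, fun _ _ => rfl⟩
      const_right := ⟨1, one_pos, fun _ _ => rfl⟩
      mem := by
        intro α s _
        fin_cases α
        · exact hi
        · exact hj }

/-- `f` restricts to an orientation-preserving diffeomorphism `[a, b] → [a', b']`. -/
structure IsOrientedDiffeo (f : ℝ → ℝ) (a b a' b' : ℝ) : Prop where
  mapsTo : MapsTo f (Icc a b) (Icc a' b')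
  smooth : ContDiffOn ℝ ∞ f (Icc a b)
  strictMono : StrictMonoOn f (Icc a b)
  exists_inverse : ∃ h : ℝ → ℝ, MapsTo h (Icc a' b') (Icc a b) ∧
    InvOn h f (Icc a b) (Icc a' b') ∧ ContDiffOn ℝ ∞ h (Icc a' b')

/-! ### Embedded TQFTs -/

/-- A rank-1, embedded, 1-dimensional TQFT with target `M`, relative to the cover `U`. -/
structure EmbeddedTQFT (U : J → Opens M) where
  Z' : SubobjectIso U → Circle
  Z : PathObject (E := E) U → Circle
  /-- isomorphisms between subobjects -/
  map_comp : ∀ (σ : PointSign) (y : M) (i j k : J) (hi : y ∈ U i) (hj : y ∈ U j) (hk : y ∈ U k),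
    Z' ⟨σ, y, i, j, hi, hj⟩ * Z' ⟨σ, y, j, k, hj, hk⟩ = Z' ⟨σ, y, i, k, hi, hk⟩
  /-- basic isomorphisms `f : (p, T) → (p', T')`, with no requirement on the partitions -/
  map_iso : ∀ (P P' : PathObject (E := E) U) (f : ℝ → ℝ),
    IsOrientedDiffeo f P.a P.b P'.a P'.b → (∀ s ∈ Icc P.a P.b, P.p s = P'.p (f s)) →
    ∀ (ha : P.p P.a ∈ U P'.iFirst) (hb : P.p P.b ∈ U P'.iLast),
      Z P' = Z' ⟨.neg, P.p P.a, P.iFirst, P'.iFirst, P.mem_first, ha⟩ * Z P *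
        Z' ⟨.pos, P.p P.b, P.iLast, P'.iLast, P.mem_last, hb⟩
  /-- basic gluing morphisms `(p, T) ⊔ (p', T') → (p ∘ p', T ∘ T')` -/
  map_glue : ∀ (P P' : PathObject (E := E) U) (hb : P.b = P'.a) (hp : P.p P.b = P'.p P'.a),
    Z (P.glue P' hb hp) =
      Z P * Z' ⟨.pos, P.p P.b, P.iLast, P'.iFirst, P.mem_last, hp ▸ P'.mem_first⟩ * Z P'

/-- `p` and `p'`, paths on `[a, b]`, are thin homotopic: there is a smooth homotopy between them,
relative to the end points, whose derivative has rank at most `1` everywhere. -/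
def ThinHomotopic (a b : ℝ) (p p' : ℝ → M) : Prop :=
  ∃ H : ℝ × ℝ → M,
    ContMDiffOn 𝓘(ℝ, ℝ × ℝ) 𝓘(ℝ, E) ∞ H (Icc a b ×ˢ Icc 0 1) ∧
    (∀ s ∈ Icc a b, H (s, 0) = p s ∧ H (s, 1) = p' s) ∧
    (∀ t ∈ Icc (0 : ℝ) 1, H (a, t) = p a ∧ H (b, t) = p b) ∧
    ∀ z ∈ Icc a b ×ˢ Icc (0 : ℝ) 1, Module.finrank ℝ
      (mfderivWithin 𝓘(ℝ, ℝ × ℝ) 𝓘(ℝ, E) H (Icc a b ×ˢ Icc 0 1) z).range ≤ 1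

namespace EmbeddedTQFT

variable {U : J → Opens M}

/-- `Z` takes the same value on `(p, T)` and `(p', T')` with the same first and the same last label
if `p` and `p'` are thin homotopic. (A labelled partition of the homotopy that extends
`T` and `T'` and is constant on the two sides always exists.) -/
def IsThinInvariant (F : EmbeddedTQFT (E := E) U) : Prop :=
  ∀ P P' : PathObject (E := E) U, P.a = P'.a → P.b = P'.b →
    P.iFirst = P'.iFirst → P.iLast = P'.iLast →
    ThinHomotopic (E := E) P.a P.b P.p P'.p → F.Z P = F.Z P'

/-- `Z (p u, T u)` depends smoothly on `u` for any smooth family `(p u, T u)` of objects, with `u` in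
an open subset `W` of `ℝᵏ`: the labels are fixed, the partition points `x u α` (including the end
points of the domain) are smooth in `u`, and `p u s` is smooth in `(u, s)`. -/
def IsSmooth (F : EmbeddedTQFT (E := E) U) : Prop :=
  ∀ (k : ℕ) (W : Opens (EuclideanSpace ℝ (Fin k))) (n : ℕ) (i : Fin (n + 1) → J)
    (x : W → Fin (n + 2) → ℝ) (p : W → ℝ → M)
    (h : ∀ u, IsPathObject (E := E) U n (x u) i (p u)),
    (∀ α, ContMDiff 𝓘(ℝ, EuclideanSpace ℝ (Fin k)) 𝓘(ℝ, ℝ) ∞ (fun u => x u α)) →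
    ContMDiff (𝓘(ℝ, EuclideanSpace ℝ (Fin k)).prod 𝓘(ℝ, ℝ)) 𝓘(ℝ, E) ∞
      (fun z : W × ℝ => p z.1 z.2) →
    ContMDiff 𝓘(ℝ, EuclideanSpace ℝ (Fin k)) (𝓡 1) ∞ (fun u => F.Z ⟨n, x u, i, p u, h u⟩)

end EmbeddedTQFT

/-! ### The two directions of the correspondence -/

open Classical in
/-- The integral of `p^* (A j)` over `[c, d]`, for a path `p` which maps `[c, d]` to `U j`. -/
def BundleWithConnection.lineIntegral [IsManifold 𝓘(ℝ, E) ∞ M] {U : J → Opens M}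
    (B : BundleWithConnection (E := E) U) (j : J) (p : ℝ → M) (c d : ℝ) : ℝ :=
  ∫ s in c..d, if h : p s ∈ U j then
    B.A j ⟨p s, h⟩ (mfderiv 𝓘(ℝ, ℝ) 𝓘(ℝ, E) p s (1 : ℝ)) else 0

/-- The value on `(p, T)` of the parallel transport of a bundle with connection:
`exp (i ∫_{[x₀, x₁]} p^* A_{i₁}) ⬝ g_{i₁ i₂} (p x₁) ⬝ exp (i ∫_{[x₁, x₂]} p^* A_{i₂}) ⬝ ⋯`. -/
def BundleWithConnection.transport [IsManifold 𝓘(ℝ, E) ∞ M] {U : J → Opens M}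
    (B : BundleWithConnection (E := E) U) (P : PathObject (E := E) U) : Circle :=
  (∏ α : Fin (P.n + 1),
      Circle.exp (B.lineIntegral (P.i α) P.p (P.x α.castSucc) (P.x α.succ))) *
    ∏ α : Fin P.n, B.g (P.i α.castSucc) (P.i α.succ) ⟨P.p (P.x α.succ.castSucc),
      P.isPathObject.mem α.castSucc _
        ⟨(P.isPathObject.strictMono Fin.castSucc_lt_succ).le, le_rfl⟩,
      P.isPathObject.mem α.succ _
        ⟨le_rfl, (P.isPathObject.strictMono Fin.castSucc_lt_succ).le⟩⟩

/-- `Q` is a path `q_t` on `[0, 1]` from `q 0` to `q t` along `q : (-δ, δ) → U j`, reparametrized to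
be constant near the end points, with the whole interval labelled by `j`. -/
def IsShortPath {U : J → Opens M} (q : ℝ → M) (δ : ℝ) (j : J) (t : ℝ)
    (Q : PathObject (E := E) U) : Prop :=
  Q.n = 0 ∧ Q.a = 0 ∧ Q.b = 1 ∧ Q.iFirst = j ∧
    ∃ τ : ℝ → ℝ, ContDiff ℝ ∞ τ ∧ (∀ s, τ s ∈ Ioo (-δ) δ) ∧
      (∃ ε > 0, (∀ s < ε, τ s = 0) ∧ ∀ s > 1 - ε, τ s = t) ∧
      ∀ s, Q.p s = q (τ s)

end

/-! ### Parameter integrals, Hadamard's lemma and gluing of intervals -/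

noncomputable section

/-! From bundles to TQFTs. A parallel section along a map `H` is a family of functions `σ j`, one
for each frame `j`, with `σ k = σ j * g j k` and `d (σ j) = i (σ j) H^*(A j)`; the connection
identity is what makes these two conditions compatible. If a path runs through such a section, the
product defining the transport telescopes to the inverse of the section at the start, in the first
frame, times the section at the end, in the last frame (`transport_eq`). The inner partition has
disappeared, so invariance under diffeomorphisms and the gluing law can be read off. Where `dH` has
rank at most one, `H^*(A j)` is closed (`fderiv_pull_symm`). The Poincaré lemma then gives parallel
sections locally, and they can be glued over a rectangle (`exists_isParallel`). A thin homotopy thus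
carries a single parallel section, which is constant along the two sides where the end points are
fixed; comparing the other two sides gives thin invariance.

From TQFTs to bundles. Thin invariance makes `Z`, on paths inside one `U j`, independent of the
parametrization, multiplicative under concatenation (`seg_mul_seg`) and trivial on constant paths.
It follows that `Z'` at positive points is `Z` on the constant path with two labels, and that the
two signs give inverse values. Smoothness enters through Hadamard's lemma: the derivative of `Z` on
shrinking paths depends only on the initial velocity, and linearly (`hasDerivAt_seg_chart`). This
derivative is `i` times the connection form, and the connection identity is the derivative of the
rule for changing labels (`seg_change_label`).

The constructions are mutually inverse because `Z` on a path with one label, as a function of the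
end point, solves a linear differential equation whose coefficient is the connection form. Cutting
at the partition points then shows that `Z` is determined by `Z'` and the forms (`Z_eq_of_dform`).
-/

open Filter Topology in
-- The tube lemma, applied to the open condition of being `C^n` at a point. The order is finite
-- because at order `∞` the neighbourhood may shrink with the order.
theorem eventually_forall_contDiffAt {X F : Type*} [NormedAddCommGroup X] [NormedSpace ℝ X]
    [NormedAddCommGroup F] [NormedSpace ℝ F] {f : X → ℝ → F} {K : Set ℝ} (hK : IsCompact K) {u₀ : X}
    (n : ℕ) (hf : ∀ s ∈ K, ContDiffAt ℝ n (fun z : X × ℝ => f z.1 z.2) (u₀, s)) :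
    ∀ᶠ u in 𝓝 u₀, ∀ s ∈ K, ContDiffAt ℝ n (fun z : X × ℝ => f z.1 z.2) (u, s) :=
  hK.eventually_forall_of_forall_eventually
    (P := fun u s => ContDiffAt ℝ n (fun z : X × ℝ => f z.1 z.2) (u, s))
    fun s hs => (hf s hs).eventually (by simp)

open Filter Topology MeasureTheory in
/-- Differentiation under the integral sign for an integrand which is `C¹` near a segment. -/
theorem hasFDerivAt_intervalIntegral_of_contDiffAt {X F : Type*} [NormedAddCommGroup X]
    [NormedSpace ℝ X] [NormedAddCommGroup F] [NormedSpace ℝ F] {f : X → ℝ → F} {a b : ℝ} {u₀ : X}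
    (hf : ∀ s ∈ uIcc a b, ContDiffAt ℝ 1 (fun z : X × ℝ => f z.1 z.2) (u₀, s)) :
    HasFDerivAt (fun u => ∫ s in a..b, f u s)
      (∫ s in a..b, (fderiv ℝ (fun z : X × ℝ => f z.1 z.2) (u₀, s)).comp
        (ContinuousLinearMap.inl ℝ X ℝ)) u₀ := by
  set g : X → ℝ → X →L[ℝ] F := fun u s => (fderiv ℝ (fun z : X × ℝ => f z.1 z.2) (u, s)).comp
        (ContinuousLinearMap.inl ℝ X ℝ) with hg
  have hev := eventually_forall_contDiffAt (f := f) isCompact_uIcc 1 (by exact_mod_cast hf)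
  have hcont : ∀ u, (∀ s ∈ uIcc a b, ContDiffAt ℝ 1 (fun z : X × ℝ => f z.1 z.2) (u, s)) →
      ContinuousOn (f u) (uIcc a b) := by
    intro u hu s hs
    have h1 : ContinuousAt (fun z : X × ℝ => f z.1 z.2) (u, s) := (hu s hs).continuousAt
    exact (ContinuousAt.comp (f := fun s => (u, s)) (x := s) h1 (by fun_prop)).continuousWithinAt
  have hgc : ∀ s ∈ uIcc a b, ContinuousAt (fun z : X × ℝ => g z.1 z.2) (u₀, s) := by
    intro s hs
    have h1 : ContinuousAt (fderiv ℝ (fun z : X × ℝ => f z.1 z.2)) (u₀, s) :=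
      ((hf s hs).fderiv_right (m := 0) (by simp)).continuousAt
    exact h1.clm_comp continuousAt_const
  have hgc' : ContinuousOn (g u₀) (uIcc a b) := by
    intro s hs
    exact (ContinuousAt.comp (f := fun s => (u₀, s)) (x := s) (hgc s hs)
      (by fun_prop)).continuousWithinAt
  obtain ⟨C, hC⟩ := isCompact_uIcc.exists_bound_of_continuousOn hgc'
  -- `C` bounds the partial derivative over the segment at `u₀`; the slack of `1` lets the bound
  -- survive for nearby parameters, uniformly in `s`.
  have hbd : ∀ᶠ u in 𝓝 u₀, ∀ s ∈ uIcc a b, ‖g u s‖ < C + 1 :=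
    isCompact_uIcc.eventually_forall_of_forall_eventually (P := fun u s => ‖g u s‖ < C + 1)
      fun s hs => ((hgc s hs).norm.eventually_lt_const (by
        have := hC s hs
        simp only
        linarith))
  have hS := hev.and hbd
  refine intervalIntegral.hasFDerivAt_integral_of_dominated_of_fderiv_le
    (bound := fun _ => C + 1) (F' := g) hS ?_ ?_ ?_ ?_ ?_ ?_
  · filter_upwards [hev] with u hu
    exact (hcont u (by exact_mod_cast hu)).intervalIntegrable.def'.aestronglyMeasurable
  · exact (hcont u₀ hf).intervalIntegrable
  · exact hgc'.intervalIntegrable.def'.aestronglyMeasurable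
  · exact Eventually.of_forall fun s hs u hu => (hu.2 s (uIoc_subset_uIcc hs)).le
  · exact intervalIntegrable_const
  · refine Eventually.of_forall fun s hs u hu => ?_
    have h1 := (((hu.1 s (uIoc_subset_uIcc hs)).differentiableAt (by simp)).hasFDerivAt)
    exact HasFDerivAt.comp (f := fun e => (e, s)) u h1
      (hasFDerivAt_prodMk_left u s)

open Filter Topology MeasureTheory in
-- The derivative of the integral is an integral with values in `X →L[ℝ] F`, so the induction must
-- range over all `F`; with `X : Type` this space stays in the universe of `F`. One order is lost,
-- since even continuity is obtained from differentiability; this is harmless in the smooth case.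
theorem contDiffAt_intervalIntegral_nat {X : Type} [NormedAddCommGroup X]
    [NormedSpace ℝ X] {a b : ℝ} {u₀ : X} (n : ℕ) :
    ∀ {F : Type*} [NormedAddCommGroup F] [NormedSpace ℝ F] {f : X → ℝ → F},
    (∀ s ∈ uIcc a b, ContDiffAt ℝ (n + 1 : ℕ) (fun z : X × ℝ => f z.1 z.2) (u₀, s)) →
    ContDiffAt ℝ n (fun u => ∫ s in a..b, f u s) u₀ := by
  induction n with
  | zero =>
    intro F _ _ f hf
    have hev := eventually_forall_contDiffAt isCompact_uIcc 1 hf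
    refine contDiffAt_zero.2 ⟨_, hev, fun u hu => ?_⟩
    exact (hasFDerivAt_intervalIntegral_of_contDiffAt
      (by exact_mod_cast hu)).continuousAt.continuousWithinAt
  | succ n ih =>
    intro F _ _ f hf
    have hev := eventually_forall_contDiffAt isCompact_uIcc _ hf
    have := contDiffAt_succ_iff_hasFDerivAt (𝕜 := ℝ) (n := n) (x := u₀)
      (f := fun u => ∫ s in a..b, f u s)
    push_cast
    refine this.2 ⟨fun u => ∫ s in a..b,
      (fderiv ℝ (fun z : X × ℝ => f z.1 z.2) (u, s)).comp
        (ContinuousLinearMap.inl ℝ X ℝ), ⟨_, hev, fun u hu => ?_⟩, ?_⟩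
    · exact hasFDerivAt_intervalIntegral_of_contDiffAt fun s hs =>
        (hu s hs).of_le (by exact_mod_cast Nat.le_add_left 1 (n + 1))
    · refine ih fun s hs => ?_
      have h1 := (hf s hs).fderiv_right (m := (n + 1 : ℕ)) (by exact_mod_cast le_rfl)
      exact h1.clm_comp contDiffAt_const

/-- An integral of a smooth function over a segment depends smoothly on parameters. -/
theorem contDiffAt_intervalIntegral {X : Type} [NormedAddCommGroup X]
    [NormedSpace ℝ X] {F : Type*} [NormedAddCommGroup F] [NormedSpace ℝ F] {f : X → ℝ → F}
    {a b : ℝ} {u₀ : X}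
    (hf : ∀ s ∈ uIcc a b, ContDiffAt ℝ ∞ (fun z : X × ℝ => f z.1 z.2) (u₀, s)) :
    ContDiffAt ℝ ∞ (fun u => ∫ s in a..b, f u s) u₀ :=
  contDiffAt_infty.2 fun n => contDiffAt_intervalIntegral_nat n fun s hs =>
    contDiffAt_infty.1 (hf s hs) _

/-- Hadamard's lemma in one variable. -/
theorem exists_contDiffAt_eq_add_smul {F : Type*} [NormedAddCommGroup F] [NormedSpace ℝ F]
    [CompleteSpace F] {k : ℝ → F} {δ : ℝ} (hk : ∀ t ∈ Ioo (-δ) δ, ContDiffAt ℝ ∞ k t) :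
    ∃ w : ℝ → F, w 0 = deriv k 0 ∧
      ∀ t ∈ Ioo (-δ) δ, ContDiffAt ℝ ∞ w t ∧ k t = k 0 + t • w t := by
  have hmem : ∀ t ∈ Ioo (-δ) δ, ∀ r ∈ uIcc (0 : ℝ) 1, r * t ∈ Ioo (-δ) δ := by
    intro t ht r hr
    rw [uIcc_of_le zero_le_one] at hr
    rw [mem_Ioo, ← abs_lt] at ht ⊢
    rw [abs_mul, abs_of_nonneg hr.1]
    nlinarith [abs_nonneg t, hr.2]
  -- The fundamental theorem of calculus along `r ↦ r * t`, with the factor `t` pulled out of the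
  -- integral.
  refine ⟨fun t => ∫ r in (0 : ℝ)..1, deriv k (r * t), by simp, fun t ht => ⟨?_, ?_⟩⟩
  · refine contDiffAt_intervalIntegral (f := fun t r => deriv k (r * t)) fun r hr => ?_
    have h1 : ContDiffAt ℝ ∞ (deriv k) (r * t) := by
      have := (hk _ (hmem t ht r hr)).fderiv_right (m := ∞) (by simp)
      exact this.clm_apply contDiffAt_const
    exact ContDiffAt.comp (f := fun z : ℝ × ℝ => z.2 * z.1) (t, r) h1 (by fun_prop)
  · have hd : ∀ r ∈ uIcc (0 : ℝ) 1, HasDerivAt (fun r => k (r * t)) (t • deriv k (r * t)) r := by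
      intro r hr
      have h1 := ((hk _ (hmem t ht r hr)).differentiableAt (by simp)).hasDerivAt
      have h2 := h1.scomp r (hasDerivAt_mul_const (x := r) t)
      exact h2
    have hc : ContinuousOn (fun r => t • deriv k (r * t)) (uIcc 0 1) := by
      intro r hr
      have h1 : ContinuousAt (deriv k) (r * t) := by
        have := (hk _ (hmem t ht r hr)).fderiv_right (m := ∞) (by simp)
        exact (this.clm_apply (contDiffAt_const (c := (1 : ℝ)))).continuousAt
      exact (continuousAt_const.smul (ContinuousAt.comp (f := fun r => r * t) h1
        (by fun_prop))).continuousWithinAt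
    have := intervalIntegral.integral_eq_sub_of_hasDerivAt hd hc.intervalIntegrable
    rw [intervalIntegral.integral_smul] at this
    simp only [this]
    simp

/-- A property of open intervals which can be glued and holds locally holds near every compact
interval. -/
theorem exists_interval_of_glue {Q : ℝ → ℝ → Prop}
    (hmono : ∀ c d c' d', c ≤ c' → d' ≤ d → Q c d → Q c' d')
    (hglue : ∀ c c' d d', c < c' → c' < d → d < d' → Q c d → Q c' d' → Q c d')
    {a b : ℝ} (hab : a ≤ b) (hloc : ∀ x ∈ Icc a b, ∃ ε > 0, Q (x - ε) (x + ε)) :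
    ∃ ε > 0, Q (a - ε) (b + ε) := by
  set S : Set ℝ := {x | ∃ ε > 0, Q (a - ε) (x + ε)} with hS
  -- A point of `S` within reach of a local interval about `x` pushes `S` to `x + ε / 2`; the other
  -- half of `ε` pays for the margin required of a member of `S`. This gives both closedness and
  -- progress to the right.
  have key : ∀ x ∈ Icc a b, ∀ ε > 0, Q (x - ε) (x + ε) → ∀ z ∈ S, x - ε < z → z ≤ x + ε →
      a ≤ z → x + ε / 2 ∈ S := by
    rintro x hx ε hε hQ z ⟨η, hη, hz⟩ h1 h2 haz
    by_cases hlt : z + η < x + ε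
    · refine ⟨min η (ε / 2), by positivity, ?_⟩
      by_cases ha : x - ε ≤ a - min η (ε / 2)
      · exact hmono _ _ _ _ ha (by linarith [min_le_right η (ε / 2)]) hQ
      · refine hglue _ (x - ε) (z + η) _ (not_le.1 ha) (by linarith) ?_
          (hmono _ _ _ _ (by linarith [min_le_left η (ε / 2)]) le_rfl hz) (hmono _ _ _ _ le_rfl ?_ hQ) |>
          hmono _ (x + ε) _ _ le_rfl (by linarith [min_le_right η (ε / 2)])
        · exact hlt
        · exact le_rfl
    · exact ⟨min η (ε / 2), by positivity, hmono _ _ _ _ (by linarith [min_le_left η (ε / 2)])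
        (by linarith [min_le_right η (ε / 2)]) hz⟩
  have ha : a ∈ S := hloc a ⟨le_rfl, hab⟩
  have hdown : ∀ z ∈ S, ∀ y ≤ z, y ∈ S := fun z ⟨η, hη, hz⟩ y hy =>
    ⟨η, hη, hmono _ _ _ _ le_rfl (by linarith) hz⟩
  refine IsClosed.Icc_subset_of_forall_exists_gt (s := S) ?_ ha ?_ ⟨hab, le_rfl⟩
  · rw [← closure_subset_iff_isClosed]
    intro x hx
    have hxI : x ∈ Icc a b := closure_minimal inter_subset_right isClosed_Icc hx
    obtain ⟨ε, hε, hQ⟩ := hloc x hxI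
    obtain ⟨z, hz, hzS⟩ := Metric.mem_closure_iff.1 hx ε hε
    rw [Real.dist_eq, abs_lt] at hzS
    exact ⟨hdown _ (key x hxI ε hε hQ z hz.1 (by linarith) (by linarith) hz.2.1) _
      (by linarith), hxI⟩
  · rintro x ⟨hxS, hxI⟩ y hy
    obtain ⟨ε, hε, hQ⟩ := hloc x ⟨hxI.1, hxI.2.le⟩
    have h1 := key x ⟨hxI.1, hxI.2.le⟩ ε hε hQ x hxS (by linarith) (by linarith) hxI.1
    exact ⟨min y (x + ε / 2), hdown _ h1 _ (min_le_right _ _), lt_min hy (by linarith),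
      min_le_left _ _⟩

/-! ### Circle-valued maps, charts and inclusions of open subsets -/

theorem contMDiff_circle_iff {E' H' M' : Type*} [NormedAddCommGroup E'] [NormedSpace ℝ E']
    [TopologicalSpace H'] {I : ModelWithCorners ℝ E' H'} [TopologicalSpace M'] [ChartedSpace H' M']
    [IsManifold I ∞ M'] {f : M' → Circle} :
    ContMDiff I (𝓡 1) ∞ f ↔ ContMDiff I 𝓘(ℝ, ℂ) ∞ (fun y => (f y : ℂ)) := by
  have := finrank_real_complex_fact'
  constructor
  · intro h
    exact (contMDiff_coe_sphere (E := ℂ) (n := 1)).comp h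
  · intro h
    exact h.codRestrict_sphere fun y => (f y).2

theorem contDiffAt_extChartAt_comp {E : Type*} [NormedAddCommGroup E] [NormedSpace ℝ E]
    {M : Type*} [TopologicalSpace M] [ChartedSpace E M]
    {N : Type*} [NormedAddCommGroup N] [NormedSpace ℝ N] {H : N → M} {z₀ : N}
    (hH : ContMDiffAt 𝓘(ℝ, N) 𝓘(ℝ, E) ∞ H z₀) :
    ContDiffAt ℝ ∞ (extChartAt 𝓘(ℝ, E) (H z₀) ∘ H) z₀ :=
  contMDiffAt_iff_contDiffAt.1
    (ContMDiffAt.comp (I' := 𝓘(ℝ, E)) z₀ (contMDiffAt_extChartAt (x := H z₀)) hH)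

section Retract

variable {E : Type*} [NormedAddCommGroup E] [NormedSpace ℝ E]
  {M : Type*} [TopologicalSpace M] [ChartedSpace E M]

open Classical in
/-- A map to an open subset `V` which is a left inverse of the inclusion. -/
def TopologicalSpace.Opens.retract (V : Opens M) (y : V) (z : M) : V :=
  if h : z ∈ V then ⟨z, h⟩ else y

theorem TopologicalSpace.Opens.retract_of_mem {V : Opens M} (y : V) {z : M} (h : z ∈ V) :
    V.retract y z = ⟨z, h⟩ := dif_pos h

theorem TopologicalSpace.Opens.contMDiffAt_retract {V : Opens M} (y : V) {z : M} (h : z ∈ V) :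
    ContMDiffAt 𝓘(ℝ, E) 𝓘(ℝ, E) ∞ (V.retract y) z := by
  rw [← contMDiffAt_subtype_iff (x := ⟨z, h⟩)]
  exact contMDiffAt_id.congr_of_eventuallyEq
    (Filter.Eventually.of_forall fun w => V.retract_of_mem y w.2)

-- The retraction is a local right inverse of the inclusion, so the chain rule provides preimages.
-- It allows the connection identity, stated for vectors of the open subset, to be used for all
-- tangent vectors of `M`.
open Filter Topology in
theorem dIncl_surjective {V : Opens M} (y : V) :
    Function.Surjective (dIncl (E := E) y) := by
  set r := V.retract y
  have hry : r (y : M) = y := V.retract_of_mem y y.2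
  have h1 : ContMDiffAt 𝓘(ℝ, E) 𝓘(ℝ, E) ∞ r (y : M) := V.contMDiffAt_retract y y.2
  have h2 : ContMDiffAt 𝓘(ℝ, E) 𝓘(ℝ, E) ∞ (fun z : V => (z : M)) (r (y : M)) :=
    contMDiff_subtype_val.contMDiffAt
  have h3 : (fun z : V => (z : M)) ∘ r =ᶠ[𝓝 (y : M)] id := by
    filter_upwards [V.isOpen.mem_nhds y.2] with z hz
    exact congrArg Subtype.val (V.retract_of_mem y hz)
  have h4 := mfderiv_comp (I' := 𝓘(ℝ, E)) (y : M) (h2.mdifferentiableAt (by simp))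
    (h1.mdifferentiableAt (by simp))
  rw [h3.mfderiv_eq, mfderiv_id] at h4
  intro v
  have h5 := DFunLike.congr_fun h4 v
  -- The tangent spaces at `r y` and at `y` are different types; generalizing the base point allows
  -- it to be substituted.
  have h6 : ∀ (x : V) (_ : x = y) (w : E), ∃ u : TangentSpace 𝓘(ℝ, E) y,
      dIncl (E := E) y u = (mfderiv 𝓘(ℝ, E) 𝓘(ℝ, E) (fun z : V => (z : M)) x : E →L[ℝ] E) w := by
    rintro _ rfl w
    exact ⟨w, rfl⟩
  obtain ⟨u, hu⟩ := h6 _ hry (mfderiv 𝓘(ℝ, E) 𝓘(ℝ, E) r (y : M) v)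
  exact ⟨u, hu.trans h5.symm⟩

end Retract

/-! ### Pullbacks of the connection forms and of the transition functions -/

section Pull

open Filter Topology

variable {E : Type*} [NormedAddCommGroup E] [NormedSpace ℝ E]
  {M : Type*} [TopologicalSpace M] [ChartedSpace E M] [IsManifold 𝓘(ℝ, E) ∞ M]
  {J : Type*} {U : J → Opens M}
  {N : Type*} [NormedAddCommGroup N] [NormedSpace ℝ N]

namespace BundleWithConnection

open Classical in
/-- The form `A j`, extended by zero to `M`. -/
def form (B : BundleWithConnection (E := E) U) (j : J) (y : M) :
    TangentSpace 𝓘(ℝ, E) y →L[ℝ] ℝ :=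
  if h : y ∈ U j then B.A j ⟨y, h⟩ else 0

/-- The pullback of `A j` along a map from a normed space to `M`. -/
def pull (B : BundleWithConnection (E := E) U) (j : J) (H : N → M) (z : N) : N →L[ℝ] ℝ :=
  (B.form j (H z)).comp (mfderiv 𝓘(ℝ, N) 𝓘(ℝ, E) H z : TangentSpace 𝓘(ℝ, N) z →L[ℝ] _)

theorem form_of_mem (B : BundleWithConnection (E := E) U) {j : J} {y : M} (h : y ∈ U j) :
    B.form j y = B.A j ⟨y, h⟩ := dif_pos h

theorem pull_congr (B : BundleWithConnection (E := E) U) (j : J) {H H' : N → M} {z : N}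
    (h : H =ᶠ[𝓝 z] H') : B.pull j H z = B.pull j H' z := by
  have h1 : ∀ (y y' : M) (_ : y = y') (v : E), B.form j y v = B.form j y' v := by
    rintro y _ rfl v
    rfl
  ext v
  simp only [pull, h.mfderiv_eq]
  exact h1 _ _ h.self_of_nhds _

theorem pull_comp (B : BundleWithConnection (E := E) U) (j : J) {N' : Type*}
    [NormedAddCommGroup N'] [NormedSpace ℝ N'] {H : N → M} {k : N' → N} {z : N'}
    (hH : MDifferentiableAt 𝓘(ℝ, N) 𝓘(ℝ, E) H (k z)) (hk : DifferentiableAt ℝ k z) :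
    B.pull j (H ∘ k) z = (B.pull j H (k z)).comp (fderiv ℝ k z) := by
  ext v
  simp only [pull, ContinuousLinearMap.comp_apply]
  rw [mfderiv_comp z hH hk.mdifferentiableAt, mfderiv_eq_fderiv]
  rfl

/-- Smoothness of a section of the cotangent bundle means smoothness in the trivialization at `y₀`,
and there the section reads as its pullback along the inverse chart. -/
theorem contDiffAt_pull_extChartAt_symm (B : BundleWithConnection (E := E) U) (j : J) {y₀ : M}
    (h : y₀ ∈ U j) :
    ContDiffAt ℝ ∞ (B.pull j (extChartAt 𝓘(ℝ, E) y₀).symm) (extChartAt 𝓘(ℝ, E) y₀ y₀) := by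
  have h2 := ((contMDiffAt_hom_bundle _).1 (B.smooth_A j ⟨y₀, h⟩)).2
  set φ := extChartAt 𝓘(ℝ, E) y₀ with hφ
  set a : M → (E →L[ℝ] ℝ) := fun y => (B.form j y).comp
    (mfderiv 𝓘(ℝ, E) 𝓘(ℝ, E) φ.symm (φ y) : E →L[ℝ] E) with ha
  have h3 : ContMDiffAt 𝓘(ℝ, E) 𝓘(ℝ, E →L[ℝ] ℝ) ∞ a y₀ := by
    rw [← contMDiffAt_subtype_iff (U := U j) (x := ⟨y₀, h⟩)]
    refine h2.congr_of_eventuallyEq ?_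
    have h4 : ∀ᶠ y : U j in 𝓝 ⟨y₀, h⟩, (y : M) ∈ (chartAt E y₀).source :=
      continuous_subtype_val.continuousAt.eventually
        ((chartAt E y₀).open_source.mem_nhds (mem_chart_source E y₀))
    filter_upwards [h4] with y hy
    ext v
    simp only [ha, ContinuousLinearMap.inCoordinates, ContinuousLinearMap.comp_apply]
    rw [TangentBundle.symmL_trivializationAt hy]
    refine Eq.trans ?_ (DFunLike.congr_fun
      (Bundle.Trivial.continuousLinearMapAt_trivialization ℝ M ℝ (y : M)) _).symm
    rw [form_of_mem B y.2, modelWithCornersSelf_coe, range_id, mfderivWithin_univ]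
    rfl
  have h5 : ContMDiffAt 𝓘(ℝ, E) 𝓘(ℝ, E →L[ℝ] ℝ) ∞ (a ∘ φ.symm) (φ y₀) := by
    refine ContMDiffAt.comp (I' := 𝓘(ℝ, E)) (φ y₀)
      (?_ : ContMDiffAt 𝓘(ℝ, E) 𝓘(ℝ, E →L[ℝ] ℝ) ∞ a _) ?_
    · have : φ.symm (φ y₀) = y₀ := extChartAt_to_inv (I := 𝓘(ℝ, E)) y₀
      rwa [this]
    · exact (contMDiffOn_extChartAt_symm y₀).contMDiffAt (extChartAt_target_mem_nhds y₀)
  refine (contMDiffAt_iff_contDiffAt.1 h5).congr_of_eventuallyEq ?_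
  filter_upwards [extChartAt_target_mem_nhds (I := 𝓘(ℝ, E)) y₀] with x hx
  simp only [ha, pull, Function.comp_apply]
  rw [φ.right_inv hx]

/-- Factoring `H` through a chart reduces pullbacks to maps between vector spaces, where ordinary
derivatives can be taken. -/
theorem pull_eventuallyEq (B : BundleWithConnection (E := E) U) (j : J) {H : N → M} {z₀ : N}
    (hH : ContMDiffAt 𝓘(ℝ, N) 𝓘(ℝ, E) ∞ H z₀) :
    B.pull j H =ᶠ[𝓝 z₀] fun z => (B.pull j (extChartAt 𝓘(ℝ, E) (H z₀)).symm
      ((extChartAt 𝓘(ℝ, E) (H z₀) ∘ H) z)).comp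
        (fderiv ℝ (extChartAt 𝓘(ℝ, E) (H z₀) ∘ H) z) := by
  set φ := extChartAt 𝓘(ℝ, E) (H z₀) with hφ
  have hsm := contDiffAt_extChartAt_comp hH
  have h1 : ∀ᶠ z in 𝓝 z₀, H z ∈ φ.source :=
    hH.continuousAt.eventually (extChartAt_source_mem_nhds (I := 𝓘(ℝ, E)) (H z₀))
  have h2 : ∀ᶠ z in 𝓝 z₀, ContDiffAt ℝ 1 (φ ∘ H) z :=
    (hsm.of_le (by simp)).eventually (by simp)
  filter_upwards [h1.eventually_nhds, h2] with z hz hz2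
  have h3 : H =ᶠ[𝓝 z] φ.symm ∘ (φ ∘ H) := by
    filter_upwards [hz] with x hx
    exact (φ.left_inv hx).symm
  rw [B.pull_congr j h3]
  refine B.pull_comp j ?_ (hz2.differentiableAt (by simp))
  have h4 : (φ ∘ H) z ∈ φ.target := φ.map_source hz.self_of_nhds
  exact ((contMDiffOn_extChartAt_symm (n := ∞) (H z₀)).contMDiffAt
    ((isOpen_extChartAt_target (H z₀)).mem_nhds h4)).mdifferentiableAt (by simp)

theorem contDiffAt_pull (B : BundleWithConnection (E := E) U) (j : J) {H : N → M} {z₀ : N}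
    (hH : ContMDiffAt 𝓘(ℝ, N) 𝓘(ℝ, E) ∞ H z₀) (h : H z₀ ∈ U j) :
    ContDiffAt ℝ ∞ (B.pull j H) z₀ := by
  have hsm := contDiffAt_extChartAt_comp hH
  refine ContDiffAt.congr_of_eventuallyEq ?_ (B.pull_eventuallyEq j hH)
  exact ((B.contDiffAt_pull_extChartAt_symm j h).comp z₀ hsm).clm_comp
    (hsm.fderiv_right (m := ∞) (by simp))

/-- The pullback of a `1`-form along a map of rank at most one is closed. -/
theorem fderiv_pull_symm (B : BundleWithConnection (E := E) U) (j : J) {H : N → M} {z₀ : N}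
    (hH : ContMDiffAt 𝓘(ℝ, N) 𝓘(ℝ, E) ∞ H z₀) (h : H z₀ ∈ U j)
    (hrank : ∃ e : TangentSpace 𝓘(ℝ, E) (H z₀), ∀ u : TangentSpace 𝓘(ℝ, N) z₀, ∃ c : ℝ,
      mfderiv 𝓘(ℝ, N) 𝓘(ℝ, E) H z₀ u = c • e) (u w : N) :
    fderiv ℝ (B.pull j H) z₀ u w = fderiv ℝ (B.pull j H) z₀ w u := by
  have hsm := contDiffAt_extChartAt_comp hH
  rw [(B.pull_eventuallyEq j hH).fderiv_eq]
  set φ := extChartAt 𝓘(ℝ, E) (H z₀) with hφ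
  set a := B.pull j φ.symm
  set k := φ ∘ H with hk
  have ha : HasFDerivAt a (fderiv ℝ a (k z₀)) (k z₀) :=
    ((B.contDiffAt_pull_extChartAt_symm j h).differentiableAt (by simp)).hasFDerivAt
  have hk1 := (hsm.differentiableAt (by simp)).hasFDerivAt
  have hk2 := ((hsm.fderiv_right (m := ∞) (by simp)).differentiableAt (by simp)).hasFDerivAt
  -- The derivative of `a (k z) ∘ k' z` is `a'(k' u)(k' w) + a(k''(u, w))`. The second term is
  -- symmetric, and so is the first because `k' u` and `k' w` are multiples of one vector `e`.
  have hd := (ha.comp z₀ hk1).clm_comp hk2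
  rw [HasFDerivAt.fderiv (f := fun z => (a (k z)).comp (fderiv ℝ k z)) hd]
  have hsymm : IsSymmSndFDerivAt ℝ k z₀ := (contDiffAt_infty.1 hsm 2).isSymmSndFDerivAt (by simp)
  have hcol : ∃ e : E, ∀ u : N, ∃ c : ℝ, fderiv ℝ k z₀ u = c • e := by
    obtain ⟨e, he⟩ := hrank
    have h1 : ∀ u : N, fderiv ℝ k z₀ u = mfderiv 𝓘(ℝ, E) 𝓘(ℝ, E) φ (H z₀)
        (mfderiv 𝓘(ℝ, N) 𝓘(ℝ, E) H z₀ u) := by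
      rw [← mfderiv_eq_fderiv]
      exact DFunLike.congr_fun (mfderiv_comp z₀
        ((contMDiffAt_extChartAt (n := ∞)).mdifferentiableAt (by simp))
        (hH.mdifferentiableAt (by simp)))
    refine ⟨mfderiv 𝓘(ℝ, E) 𝓘(ℝ, E) φ (H z₀) e, fun u => ?_⟩
    obtain ⟨c, hc⟩ := he u
    refine ⟨c, ?_⟩
    rw [h1]
    exact (congrArg _ hc).trans (map_smul _ _ _)
  obtain ⟨e, he⟩ := hcol
  obtain ⟨c, hc⟩ := he u
  obtain ⟨d, hd⟩ := he w
  simp only [add_apply, ContinuousLinearMap.comp_apply,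
    ContinuousLinearMap.compL_apply, ContinuousLinearMap.flip_apply, hc, hd, map_smul,
    smul_apply, hsymm.eq u w, smul_eq_mul]
  ring

open Classical in
/-- The transition function `g i j`, extended by `1` to `M`. -/
def gExt (B : BundleWithConnection (E := E) U) (i j : J) (y : M) : Circle :=
  if h : y ∈ U i ∧ y ∈ U j then B.g i j ⟨y, h⟩ else 1

theorem gExt_of_mem (B : BundleWithConnection (E := E) U) {i j : J} {y : M} (hi : y ∈ U i)
    (hj : y ∈ U j) : B.gExt i j y = B.g i j ⟨y, hi, hj⟩ := dif_pos ⟨hi, hj⟩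

theorem contMDiffAt_gExt (B : BundleWithConnection (E := E) U) {i j : J} {y : M} (hi : y ∈ U i)
    (hj : y ∈ U j) : ContMDiffAt 𝓘(ℝ, E) 𝓘(ℝ, ℂ) ∞ (fun y => (B.gExt i j y : ℂ)) y := by
  rw [← contMDiffAt_subtype_iff (U := U i ⊓ U j) (x := ⟨y, hi, hj⟩)]
  refine (contMDiff_circle_iff.1 (B.smooth_g i j)).contMDiffAt.congr_of_eventuallyEq
    (Eventually.of_forall fun z => ?_)
  simp only
  rw [B.gExt_of_mem z.2.1 z.2.2]

/-- The connection identity cleared of its denominator and moved from the intersection to `M`; this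
is where `dIncl_surjective` is needed. -/
theorem mfderiv_gExt (B : BundleWithConnection (E := E) U) {i j : J} {y : M} (hi : y ∈ U i)
    (hj : y ∈ U j) (v : TangentSpace 𝓘(ℝ, E) y) :
    (mfderiv 𝓘(ℝ, E) 𝓘(ℝ, ℂ) (fun y => (B.gExt i j y : ℂ)) y v : ℂ) =
      Complex.I * (B.gExt i j y : ℂ) * ((B.form j y v - B.form i y v : ℝ) : ℂ) := by
  set y' : (U i ⊓ U j : Opens M) := ⟨y, hi, hj⟩ with hy'
  obtain ⟨u, rfl⟩ := dIncl_surjective (E := E) y' v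
  have h1 := B.connection i j y' u
  have h2 : (mfderiv 𝓘(ℝ, E) 𝓘(ℝ, ℂ) (fun z => (B.g i j z : ℂ)) y' u : ℂ) =
      mfderiv 𝓘(ℝ, E) 𝓘(ℝ, ℂ) (fun y => (B.gExt i j y : ℂ)) y (dIncl y' u) := by
    have h3 : (fun z => (B.g i j z : ℂ)) =
        (fun y => (B.gExt i j y : ℂ)) ∘ (fun z : (U i ⊓ U j : Opens M) => (z : M)) := by
      funext z
      simp only [Function.comp_apply]
      rw [B.gExt_of_mem z.2.1 z.2.2]
    rw [h3]
    exact DFunLike.congr_fun (mfderiv_comp y'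
      ((B.contMDiffAt_gExt hi hj).mdifferentiableAt (by simp))
      ((contMDiff_subtype_val (n := ∞)).contMDiffAt.mdifferentiableAt (by simp))) u
  replace h1 := h1.trans (congrArg (fun w => (B.g i j y' : ℂ)⁻¹ * w) h2)
  simp only [hy', ← B.gExt_of_mem hi hj] at h1
  rw [B.form_of_mem hi, B.form_of_mem hj]
  have h4 : (B.gExt i j y : ℂ) ≠ 0 := Circle.coe_ne_zero _
  rw [mul_right_comm]
  refine Eq.trans ?_ (congrArg (· * (B.gExt i j y : ℂ)) h1.symm)
  rw [mul_comm]
  exact (mul_inv_cancel_left₀ h4 _).symm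

theorem hasFDerivAt_gExt_comp (B : BundleWithConnection (E := E) U) {i j : J} {H : N → M} {z : N}
    (hH : MDifferentiableAt 𝓘(ℝ, N) 𝓘(ℝ, E) H z) (hi : H z ∈ U i) (hj : H z ∈ U j) :
    HasFDerivAt (fun z => (B.gExt i j (H z) : ℂ))
      ((Complex.I * (B.gExt i j (H z) : ℂ)) •
        Complex.ofRealCLM.comp (B.pull j H z - B.pull i H z)) z := by
  have h1 := (B.contMDiffAt_gExt hi hj).mdifferentiableAt (by simp)
  have h2 : DifferentiableAt ℝ (fun z => (B.gExt i j (H z) : ℂ)) z :=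
    mdifferentiableAt_iff_differentiableAt.1 (h1.comp z hH)
  convert h2.hasFDerivAt using 1
  ext u
  rw [← mfderiv_eq_fderiv]
  refine Eq.trans ?_ (DFunLike.congr_fun (mfderiv_comp z h1 hH) u).symm
  exact (B.mfderiv_gExt hi hj _).symm

end BundleWithConnection
end Pull

/-! ### Parallel sections along maps of rank at most one -/

section Parallel

open Filter Topology

variable {E : Type*} [NormedAddCommGroup E] [NormedSpace ℝ E]
  {M : Type*} [TopologicalSpace M] [ChartedSpace E M] [IsManifold 𝓘(ℝ, E) ∞ M]
  {J : Type*} {U : J → Opens M}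
  {N : Type*} [NormedAddCommGroup N] [NormedSpace ℝ N]

namespace BundleWithConnection

/-- `σ` is a parallel section, over `D`, of the pullback of the bundle along `H`. -/
structure IsParallel (B : BundleWithConnection (E := E) U) (H : N → M) (D : Set N)
    (σ : J → N → Circle) : Prop where
  trans : ∀ z ∈ D, ∀ j k, H z ∈ U j → H z ∈ U k → σ k z = σ j z * B.gExt j k (H z)
  deriv : ∀ z ∈ D, ∀ j, H z ∈ U j → HasFDerivAt (fun z => (σ j z : ℂ))
    ((Complex.I * (σ j z : ℂ)) • Complex.ofRealCLM.comp (B.pull j H z)) z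

theorem IsParallel.mono {B : BundleWithConnection (E := E) U} {H : N → M} {D D' : Set N}
    {σ : J → N → Circle} (h : B.IsParallel H D σ) (hD : D' ⊆ D) : B.IsParallel H D' σ :=
  ⟨fun z hz => h.trans z (hD hz), fun z hz => h.deriv z (hD hz)⟩

theorem gExt_mul (B : BundleWithConnection (E := E) U) {i j k : J} {y : M} (hi : y ∈ U i)
    (hj : y ∈ U j) (hk : y ∈ U k) : B.gExt i j y * B.gExt j k y = B.gExt i k y := by
  rw [B.gExt_of_mem hi hj, B.gExt_of_mem hj hk, B.gExt_of_mem hi hk,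
    B.cocycle i j k y hi hj hk]

/-- Local existence of parallel sections along maps of rank at most one. -/
theorem exists_isParallel_local (B : BundleWithConnection (E := E) U)
    (hU : ∀ y : M, ∃ i, y ∈ U i) {H : N → M} {z₀ : N}
    (hH : ∀ᶠ z in 𝓝 z₀, ContMDiffAt 𝓘(ℝ, N) 𝓘(ℝ, E) ∞ H z)
    (hrank : ∀ z, ∃ e : TangentSpace 𝓘(ℝ, E) (H z), ∀ u : TangentSpace 𝓘(ℝ, N) z, ∃ c : ℝ,
      mfderiv 𝓘(ℝ, N) 𝓘(ℝ, E) H z u = c • e) :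
    ∃ ε > 0, ∃ σ, B.IsParallel H (Metric.ball z₀ ε) σ := by
  obtain ⟨j, hj⟩ := hU (H z₀)
  obtain ⟨ε, hε, hball⟩ := Metric.eventually_nhds_iff_ball.1
    (hH.and (hH.self_of_nhds.continuousAt.eventually ((U j).isOpen.mem_nhds hj)))
  replace hH := fun z hz => (hball z hz).1
  have hmem : ∀ z ∈ Metric.ball z₀ ε, H z ∈ U j := fun z hz => (hball z hz).2
  -- Poincaré lemma on a ball mapped into a single `U j`: the closed form `H^*(A j)` has a primitive
  -- `f`. In frame `j` the section is `exp (i f)`; the other frames are reached through `gExt j k`.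
  obtain ⟨f, hf⟩ := Convex.exists_forall_hasFDerivAt_of_fderiv_symmetric (𝕜 := ℝ)
    (convex_ball z₀ ε) Metric.isOpen_ball
    (fun z hz => ((B.contDiffAt_pull j (hH z hz) (hmem z hz)).differentiableAt
      (by simp)).differentiableWithinAt)
    (fun z hz u w => B.fderiv_pull_symm j (hH z hz) (hmem z hz) (hrank z) u w)
  refine ⟨ε, hε, fun k z => Circle.exp (f z) * B.gExt j k (H z), ⟨?_, ?_⟩⟩
  · intro z hz k l hk hl
    rw [mul_assoc, B.gExt_mul (hmem z hz) hk hl]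
  · intro z hz k hk
    have h1 : HasFDerivAt (fun z => (Circle.exp (f z) : ℂ))
        ((Complex.I * (Circle.exp (f z) : ℂ)) • Complex.ofRealCLM.comp (B.pull j H z)) z := by
      have h2 : HasFDerivAt (fun z => (f z : ℂ)) (Complex.ofRealCLM.comp (B.pull j H z)) z :=
        Complex.ofRealCLM.hasFDerivAt.comp z (hf z hz)
      simp only [Circle.coe_exp]
      have h3 := (h2.mul_const Complex.I).cexp
      refine h3.congr_fderiv ?_
      ext u
      simp
      ring
    have h2 := B.hasFDerivAt_gExt_comp ((hH z hz).mdifferentiableAt (by simp)) (hmem z hz) hk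
    have h3 := h1.mul h2
    simp only [Circle.coe_mul]
    refine HasFDerivAt.congr_fderiv h3 ?_
    ext u
    simp
    ring

/-- Parallel sections over open sets with non-empty and preconnected intersection can be glued. -/
theorem IsParallel.union {B : BundleWithConnection (E := E) U}
    (hU : ∀ y : M, ∃ i, y ∈ U i) {H : N → M} (hH : Continuous H) {D₁ D₂ : Set N}
    (hD₁ : IsOpen D₁) (hD₂ : IsOpen D₂) (hc : IsPreconnected (D₁ ∩ D₂))
    (hne : (D₁ ∩ D₂).Nonempty) {σ₁ σ₂ : J → N → Circle} (h₁ : B.IsParallel H D₁ σ₁)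
    (h₂ : B.IsParallel H D₂ σ₂) : ∃ σ, B.IsParallel H (D₁ ∪ D₂) σ := by
  classical
  choose l hl using fun z => hU (H z)
  -- Both sections change frame by the same factor, so their ratio does not depend on the frame `l
  -- z` chosen to form it. Read in one fixed frame near a point, both have the same logarithmic
  -- derivative; hence the ratio is locally constant, and constant on the connected overlap.
  set ρ : N → Circle := fun z => σ₁ (l z) z / σ₂ (l z) z with hρ
  have hρ' : ∀ z ∈ D₁ ∩ D₂, ∀ j, H z ∈ U j → σ₁ j z = ρ z * σ₂ j z := by
    intro z hz j hj
    rw [h₁.trans z hz.1 (l z) j (hl z) hj, h₂.trans z hz.2 (l z) j (hl z) hj, hρ]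
    simp [div_mul_eq_mul_div, mul_div_assoc, mul_left_comm]
  have hder : ∀ z ∈ D₁ ∩ D₂, HasFDerivAt (fun z => (ρ z : ℂ)) (0 : N →L[ℝ] ℂ) z := by
    intro z hz
    have hj := hl z
    set j := l z
    have hd₁ := h₁.deriv z hz.1 j hj
    have hd₂ := h₂.deriv z hz.2 j hj
    have hne2 : (σ₂ j z : ℂ) ≠ 0 := Circle.coe_ne_zero _
    have hd₂' := (hasDerivAt_inv hne2).hasFDerivAt.restrictScalars ℝ |>.comp z hd₂
    have h3 := hd₁.mul hd₂'
    have h4 : HasFDerivAt (fun z => (σ₁ j z : ℂ) * (σ₂ j z : ℂ)⁻¹) (0 : N →L[ℝ] ℂ) z := by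
      refine HasFDerivAt.congr_fderiv h3 ?_
      ext u
      simp
      field_simp
      ring
    refine h4.congr_of_eventuallyEq ?_
    filter_upwards [(hD₁.inter hD₂).mem_nhds hz,
      ((U j).isOpen.preimage hH).mem_nhds hj] with x hx hxj
    rw [hρ' x hx j hxj]
    simp
  obtain ⟨z₀, hz₀⟩ := hne
  have hconst : ∀ z ∈ D₁ ∩ D₂, ρ z = ρ z₀ := fun z hz => Circle.ext
    ((hD₁.inter hD₂).is_const_of_fderiv_eq_zero (𝕜 := ℝ) (f := fun z => (ρ z : ℂ)) hc
      (fun x hx => (hder x hx).differentiableAt.differentiableWithinAt)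
      (fun x hx => (hder x hx).fderiv) hz hz₀)
  set σ : J → N → Circle := fun j z => if z ∈ D₁ then σ₁ j z else ρ z₀ * σ₂ j z with hσ
  have e₁ : ∀ z ∈ D₁, ∀ j, σ j z = σ₁ j z := fun z hz j => if_pos hz
  have e₂ : ∀ z ∈ D₂, ∀ j, H z ∈ U j → σ j z = ρ z₀ * σ₂ j z := by
    intro z hz j hj
    by_cases h : z ∈ D₁
    · rw [e₁ z h, hρ' z ⟨h, hz⟩ j hj, hconst z ⟨h, hz⟩]
    · exact if_neg h
  refine ⟨σ, ⟨?_, ?_⟩⟩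
  · rintro z (hz | hz) j k hj hk
    · rw [e₁ z hz, e₁ z hz, h₁.trans z hz j k hj hk]
    · rw [e₂ z hz j hj, e₂ z hz k hk, h₂.trans z hz j k hj hk, mul_assoc]
  · rintro z (hz | hz) j hj
    · rw [e₁ z hz]
      refine (h₁.deriv z hz j hj).congr_of_eventuallyEq ?_
      filter_upwards [hD₁.mem_nhds hz] with x hx
      rw [e₁ x hx]
    · rw [e₂ z hz j hj]
      have h3 := (h₂.deriv z hz j hj).const_mul (ρ z₀ : ℂ)
      have h4 : HasFDerivAt (fun z => (ρ z₀ : ℂ) * (σ₂ j z : ℂ))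
          ((Complex.I * ((ρ z₀ * σ₂ j z : Circle) : ℂ)) •
            Complex.ofRealCLM.comp (B.pull j H z)) z := by
        refine h3.congr_fderiv ?_
        ext u
        simp
        ring
      refine h4.congr_of_eventuallyEq ?_
      filter_upwards [hD₂.mem_nhds hz, ((U j).isOpen.preimage hH).mem_nhds hj] with x hx hxj
      rw [e₂ x hx j hxj, Circle.coe_mul]

/-- Existence of parallel sections, near a rectangle, along maps of rank at most one. -/
theorem exists_isParallel (B : BundleWithConnection (E := E) U)
    (hU : ∀ y : M, ∃ i, y ∈ U i) {H : ℝ × ℝ → M} (hH : ContMDiff 𝓘(ℝ, ℝ × ℝ) 𝓘(ℝ, E) ∞ H)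
    (hrank : ∀ z, ∃ e : TangentSpace 𝓘(ℝ, E) (H z), ∀ u : TangentSpace 𝓘(ℝ, ℝ × ℝ) z, ∃ c : ℝ,
      mfderiv 𝓘(ℝ, ℝ × ℝ) 𝓘(ℝ, E) H z u = c • e) {a b c d : ℝ} (hab : a ≤ b) (hcd : c ≤ d) :
    ∃ D σ, IsOpen D ∧ Icc a b ×ˢ Icc c d ⊆ D ∧ B.IsParallel H D σ := by
  have hrect : ∀ p q r s : ℝ, IsOpen (Ioo p q ×ˢ Ioo r s) := fun p q r s =>
    isOpen_Ioo.prod isOpen_Ioo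
  have hpre : ∀ p q r s p' q' r' s' : ℝ,
      IsPreconnected (Ioo p q ×ˢ Ioo r s ∩ Ioo p' q' ×ˢ Ioo r' s') := fun p q r s p' q' r' s' =>
    (((convex_Ioo p q).prod (convex_Ioo r s)).inter
      ((convex_Ioo p' q').prod (convex_Ioo r' s'))).isPreconnected
  -- Local sections are first glued horizontally into a strip about height `t`, then strips are
  -- glued vertically. Each gluing shrinks the other direction to the smaller margin; overlaps of
  -- open rectangles are convex, hence connected.
  have hstrip : ∀ t ∈ Icc c d, ∃ ε > 0, ∃ η > 0, ∃ σ,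
      B.IsParallel H (Ioo (a - ε) (b + ε) ×ˢ Ioo (t - η) (t + η)) σ := by
    intro t _
    refine exists_interval_of_glue (Q := fun p q => ∃ η > 0, ∃ σ,
      B.IsParallel H (Ioo p q ×ˢ Ioo (t - η) (t + η)) σ) ?_ ?_ hab ?_
    · rintro p q p' q' hp hq ⟨η, hη, σ, hσ⟩
      exact ⟨η, hη, σ, hσ.mono (prod_mono (Ioo_subset_Ioo hp hq) subset_rfl)⟩
    · rintro p p' q q' h1 h2 h3 ⟨η, hη, σ, hσ⟩ ⟨η', hη', σ', hσ'⟩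
      have hm : 0 < min η η' := lt_min hη hη'
      obtain ⟨τ, hτ⟩ := (hσ.mono (D' := Ioo p q ×ˢ Ioo (t - min η η') (t + min η η'))
        (prod_mono subset_rfl (Ioo_subset_Ioo (by linarith [min_le_left η η'])
          (by linarith [min_le_left η η'])))).union hU hH.continuous (hrect _ _ _ _)
        (hrect _ _ _ _) (hpre _ _ _ _ _ _ _ _) ⟨((p' + q) / 2, t),
          ⟨⟨by simp only; linarith, by simp only; linarith⟩, by simp only; linarith,
            by simp only; linarith⟩, ⟨by simp only; linarith, by simp only; linarith⟩,
            by simp only; linarith, by simp only; linarith⟩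
        (hσ'.mono (D' := Ioo p' q' ×ˢ Ioo (t - min η η') (t + min η η'))
        (prod_mono subset_rfl (Ioo_subset_Ioo (by linarith [min_le_right η η'])
          (by linarith [min_le_right η η']))))
      refine ⟨_, hm, τ, hτ.mono ?_⟩
      rw [← union_prod]
      refine prod_mono (fun x hx => ?_) subset_rfl
      by_cases hxq : x < q
      · exact Or.inl ⟨hx.1, hxq⟩
      · exact Or.inr ⟨by linarith, hx.2⟩
    · intro x _
      obtain ⟨ε, hε, σ, hσ⟩ := B.exists_isParallel_local hU
        (z₀ := (x, t)) (Eventually.of_forall hH) hrank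
      refine ⟨ε, hε, ε, hε, σ, hσ.mono ?_⟩
      rw [← ball_prod_same, Real.ball_eq_Ioo, Real.ball_eq_Ioo]
  obtain ⟨η, hη, ε, hε, σ, hσ⟩ := exists_interval_of_glue (Q := fun r s => ∃ ε > 0, ∃ σ,
    B.IsParallel H (Ioo (a - ε) (b + ε) ×ˢ Ioo r s) σ) (a := c) (b := d) (by
      rintro p q p' q' hp hq ⟨η, hη, σ, hσ⟩
      exact ⟨η, hη, σ, hσ.mono (prod_mono subset_rfl (Ioo_subset_Ioo hp hq))⟩) (by
      rintro p p' q q' h1 h2 h3 ⟨η, hη, σ, hσ⟩ ⟨η', hη', σ', hσ'⟩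
      have hm : 0 < min η η' := lt_min hη hη'
      obtain ⟨τ, hτ⟩ := (hσ.mono (D' := Ioo (a - min η η') (b + min η η') ×ˢ Ioo p q)
        (prod_mono (Ioo_subset_Ioo (by linarith [min_le_left η η'])
          (by linarith [min_le_left η η'])) subset_rfl)).union hU hH.continuous (hrect _ _ _ _)
        (hrect _ _ _ _) (hpre _ _ _ _ _ _ _ _) ⟨(a, (p' + q) / 2),
          ⟨⟨by simp only; linarith, by simp only; linarith⟩, ⟨by simp only; linarith,
            by simp only; linarith⟩⟩, ⟨⟨by simp only; linarith, by simp only; linarith⟩,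
            ⟨by simp only; linarith, by simp only; linarith⟩⟩⟩
        (hσ'.mono (D' := Ioo (a - min η η') (b + min η η') ×ˢ Ioo p' q')
        (prod_mono (Ioo_subset_Ioo (by linarith [min_le_right η η'])
          (by linarith [min_le_right η η'])) subset_rfl))
      refine ⟨_, hm, τ, hτ.mono ?_⟩
      rw [← prod_union]
      refine prod_mono subset_rfl (fun x hx => ?_)
      by_cases hxq : x < q
      · exact Or.inl ⟨hx.1, hxq⟩
      · exact Or.inr ⟨by linarith, hx.2⟩) hcd (by
      intro t ht
      obtain ⟨ε, hε, η, hη, σ, hσ⟩ := hstrip t ht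
      exact ⟨η, hη, ε, hε, σ, hσ⟩)
  refine ⟨_, σ, hrect _ _ _ _, prod_mono ?_ ?_, hσ⟩
  · exact Icc_subset_Ioo (by linarith) (by linarith)
  · exact Icc_subset_Ioo (by linarith) (by linarith)

end BundleWithConnection
end Parallel

/-! ### Transport as a quotient of values of a parallel section -/

section Transport

open Filter Topology

theorem isEmbedding_circle_coe : IsEmbedding (fun z : Circle => (z : ℂ)) :=
  IsEmbedding.subtypeVal

/-- The product of `f` with the exponential of `-i ∫ w` has zero derivative inside and is continuous
up to the ends. Nothing is asked of the derivative at the ends, where the parameter changes used for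
thin invariance fail to be differentiable. -/
theorem circle_exp_integral_eq {f : ℝ → Circle} {w : ℝ → ℝ} {c d : ℝ} (hcd : c ≤ d)
    (hf : ContinuousOn f (Icc c d)) (hw : ContinuousOn w (Icc c d))
    (hd : ∀ s ∈ Ioo c d, HasDerivAt (fun s => (f s : ℂ)) (Complex.I * f s * w s) s) :
    Circle.exp (∫ s in c..d, w s) = (f c)⁻¹ * f d := by
  set W : ℝ → ℝ := fun s => ∫ r in c..s, w r with hW
  have hwi : IntervalIntegrable w MeasureTheory.volume c d :=
    ContinuousOn.intervalIntegrable (by rwa [uIcc_of_le hcd])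
  have hWc : ContinuousOn W (Icc c d) := by
    rw [← uIcc_of_le hcd]
    exact intervalIntegral.continuousOn_primitive_interval' hwi left_mem_uIcc
  have hWd : ∀ s ∈ Ioo c d, HasDerivAt W (w s) s := by
    intro s hs
    have hcs : ContinuousAt w s := hw.continuousAt (Icc_mem_nhds hs.1 hs.2)
    refine intervalIntegral.integral_hasDerivAt_right ?_ ?_ hcs
    · exact hwi.mono_set (by
        rw [uIcc_of_le hcd, uIcc_of_le hs.1.le]
        exact Icc_subset_Icc le_rfl hs.2.le)
    · exact ContinuousOn.stronglyMeasurableAtFilter isOpen_Ioo (hw.mono Ioo_subset_Icc_self) s hs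
  set h : ℝ → ℂ := fun s => (f s : ℂ) * Complex.exp (-(Complex.I * W s)) with hh
  have hhc : ContinuousOn h (Icc c d) := by
    refine (isEmbedding_circle_coe.continuous.comp_continuousOn hf).mul
      (Complex.continuous_exp.comp_continuousOn ?_)
    exact (continuousOn_const.mul (Complex.continuous_ofReal.comp_continuousOn hWc)).neg
  have hhd : ∀ s ∈ Ioo c d, HasDerivAt h 0 s := by
    intro s hs
    have h1 := ((hWd s hs).ofReal_comp.const_mul Complex.I).neg.cexp
    have h2 := (hd s hs).mul h1
    refine HasDerivAt.congr_deriv h2 ?_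
    ring
  have h3 := intervalIntegral.integral_eq_sub_of_hasDerivAt_of_le hcd hhc hhd
    intervalIntegrable_const
  rw [intervalIntegral.integral_zero, eq_comm, sub_eq_zero] at h3
  have h4 : W c = 0 := intervalIntegral.integral_same
  simp only [hh, h4, Complex.ofReal_zero, mul_zero, neg_zero, Complex.exp_zero, mul_one] at h3
  rw [eq_inv_mul_iff_mul_eq]
  ext
  rw [Circle.coe_mul, Circle.coe_exp, ← h3, mul_assoc, ← Complex.exp_add, mul_comm (W d : ℂ)]
  simp

/-- Here `u α` and `v α` are to be the values of a parallel section at the left and right ends of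
the interval `α`, in its own frame. The first product comes from the integrals, the second from the
transition functions at the inner points. -/
theorem prod_telescope {G : Type*} [CommGroup G] {n : ℕ} (u v : Fin (n + 1) → G) :
    (∏ α, (u α)⁻¹ * v α) * ∏ α : Fin n, (v α.castSucc)⁻¹ * u α.succ =
      (u 0)⁻¹ * v (Fin.last n) := by
  simp only [Finset.prod_mul_distrib, Finset.prod_inv_distrib]
  rw [Fin.prod_univ_succ u, Fin.prod_univ_castSucc v]
  group
  simp [mul_comm, mul_left_comm]

variable {E : Type*} [NormedAddCommGroup E] [NormedSpace ℝ E]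
  {M : Type*} [TopologicalSpace M] [ChartedSpace E M]
  {J : Type*} {U : J → Opens M}

theorem IsPathObject.lt {n : ℕ} {x : Fin (n + 2) → ℝ} {i : Fin (n + 1) → J}
    {p : ℝ → M} (h : IsPathObject (E := E) U n x i p) : x 0 < x (Fin.last (n + 1)) :=
  h.strictMono Fin.last_pos

theorem PathObject.a_lt_b (P : PathObject (E := E) U) : P.a < P.b := P.isPathObject.lt

variable [IsManifold 𝓘(ℝ, E) ∞ M]
  {N : Type*} [NormedAddCommGroup N] [NormedSpace ℝ N]

namespace BundleWithConnection

theorem lineIntegral_eq (B : BundleWithConnection (E := E) U) (j : J) (p : ℝ → M) (c d : ℝ) :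
    B.lineIntegral j p c d = ∫ s in c..d, B.pull j p s 1 := by
  refine intervalIntegral.integral_congr fun s _ => ?_
  simp only [pull, form]
  split_ifs
  · rfl
  · rfl

/-- The parallel transport along a path is the ratio of the boundary values of a parallel
section. -/
theorem transport_eq (B : BundleWithConnection (E := E) U) (P : PathObject (E := E) U)
    {H : N → M} {D : Set N} {σ : J → N → Circle} (hσ : B.IsParallel H D σ) {γ : ℝ → N}
    (hγc : ContinuousOn γ (Icc P.a P.b)) (hγd : ∀ s ∈ Ioo P.a P.b, DifferentiableAt ℝ γ s)
    (hγD : ∀ s ∈ Icc P.a P.b, γ s ∈ D)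
    (hH : ∀ s ∈ Ioo P.a P.b, MDifferentiableAt 𝓘(ℝ, N) 𝓘(ℝ, E) H (γ s))
    (hp : ∀ s ∈ Icc P.a P.b, P.p s = H (γ s)) :
    B.transport P = (σ P.iFirst (γ P.a))⁻¹ * σ P.iLast (γ P.b) := by
  have hsub : ∀ α : Fin (P.n + 1), Icc (P.x α.castSucc) (P.x α.succ) ⊆ Icc P.a P.b :=
    fun α => Icc_subset_Icc (P.a_le_x _) (P.x_le_b _)
  have hlt : ∀ α : Fin (P.n + 1), P.x α.castSucc < P.x α.succ :=
    fun α => P.isPathObject.strictMono Fin.castSucc_lt_succ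
  have hint : ∀ α : Fin (P.n + 1),
      Circle.exp (B.lineIntegral (P.i α) P.p (P.x α.castSucc) (P.x α.succ)) =
        (σ (P.i α) (γ (P.x α.castSucc)))⁻¹ * σ (P.i α) (γ (P.x α.succ)) := by
    intro α
    have hmem := P.isPathObject.mem α
    rw [B.lineIntegral_eq]
    refine circle_exp_integral_eq (f := fun s => σ (P.i α) (γ s)) (hlt α).le ?_ ?_ ?_
    · intro s hs
      have h1 := hσ.deriv (γ s) (hγD s (hsub α hs)) (P.i α)
        (hp s (hsub α hs) ▸ hmem s hs)
      have h2 : ContinuousAt (σ (P.i α)) (γ s) :=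
        isEmbedding_circle_coe.isInducing.continuousAt_iff.2 h1.continuousAt
      exact h2.comp_continuousWithinAt ((hγc.mono (hsub α)) s hs)
    · intro s hs
      have h1 := (B.contDiffAt_pull (P.i α) (P.isPathObject.smooth s) (hmem s hs)).continuousAt
      exact (h1.clm_apply continuousAt_const).continuousWithinAt
    · intro s hs
      have hs' : s ∈ Icc (P.x α.castSucc) (P.x α.succ) := Ioo_subset_Icc_self hs
      have hs2 : s ∈ Ioo P.a P.b :=
        ⟨(P.a_le_x _).trans_lt hs.1, hs.2.trans_le (P.x_le_b _)⟩
      have h1 := hσ.deriv (γ s) (hγD s (hsub α hs')) (P.i α)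
        (hp s (hsub α hs') ▸ hmem s hs')
      have h2 := h1.comp_hasDerivAt s (hγd s hs2).hasDerivAt
      have h3 : P.p =ᶠ[𝓝 s] H ∘ γ := by
        filter_upwards [Icc_mem_nhds hs2.1 hs2.2] with r hr using hp r hr
      rw [B.pull_congr (P.i α) h3, B.pull_comp (P.i α) (hH s hs2) (hγd s hs2)]
      exact h2
  have hg : ∀ α : Fin P.n, B.g (P.i α.castSucc) (P.i α.succ) ⟨P.p (P.x α.succ.castSucc),
      P.isPathObject.mem α.castSucc _ ⟨(hlt α.castSucc).le, le_rfl⟩,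
      P.isPathObject.mem α.succ _ ⟨le_rfl, (hlt α.succ).le⟩⟩ =
      (σ (P.i α.castSucc) (γ (P.x α.castSucc.succ)))⁻¹ *
        σ (P.i α.succ) (γ (P.x α.succ.castSucc)) := by
    intro α
    have h1 := P.isPathObject.mem α.castSucc (P.x α.succ.castSucc) ⟨(hlt α.castSucc).le, le_rfl⟩
    have h2 := P.isPathObject.mem α.succ _ ⟨le_rfl, (hlt α.succ).le⟩
    have hm : P.x α.succ.castSucc ∈ Icc P.a P.b := ⟨P.a_le_x _, P.x_le_b _⟩
    rw [← B.gExt_of_mem h1 h2, hp _ hm, eq_inv_mul_iff_mul_eq]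
    rw [hp _ hm] at h1 h2
    exact (hσ.trans _ (hγD _ hm) _ _ h1 h2).symm
  rw [transport, Finset.prod_congr rfl fun α _ => hint α, Finset.prod_congr rfl fun α _ => hg α]
  exact prod_telescope (fun α => σ (P.i α) (γ (P.x α.castSucc)))
    (fun α => σ (P.i α) (γ (P.x α.succ)))

end BundleWithConnection
end Transport

/-! ### The TQFT of a bundle and its thin invariance -/

section ToTQFT

open Filter Topology

variable {E : Type*} [NormedAddCommGroup E] [NormedSpace ℝ E]
  {M : Type*} [TopologicalSpace M] [ChartedSpace E M]
  {J : Type*} {U : J → Opens M}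

theorem IsOrientedDiffeo.map_left {f : ℝ → ℝ} {a b a' b' : ℝ} (h : IsOrientedDiffeo f a b a' b')
    (hab : a ≤ b) (hab' : a' ≤ b') : f a = a' := by
  obtain ⟨k, hk, hinv, -⟩ := h.exists_inverse
  have h1 := hk ⟨le_rfl, hab'⟩
  have h2 := h.strictMono.monotoneOn ⟨le_rfl, hab⟩ h1 h1.1
  rw [hinv.2 ⟨le_rfl, hab'⟩] at h2
  exact le_antisymm h2 (h.mapsTo ⟨le_rfl, hab⟩).1

theorem IsOrientedDiffeo.map_right {f : ℝ → ℝ} {a b a' b' : ℝ} (h : IsOrientedDiffeo f a b a' b')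
    (hab : a ≤ b) (hab' : a' ≤ b') : f b = b' := by
  obtain ⟨k, hk, hinv, -⟩ := h.exists_inverse
  have h1 := hk ⟨hab', le_rfl⟩
  have h2 := h.strictMono.monotoneOn h1 ⟨hab, le_rfl⟩ h1.2
  rw [hinv.2 ⟨hab', le_rfl⟩] at h2
  exact le_antisymm (h.mapsTo ⟨hab, le_rfl⟩).2 h2

theorem mdifferentiable_path {n : ℕ} {x : Fin (n + 2) → ℝ} {i : Fin (n + 1) → J} {p : ℝ → M}
    (h : IsPathObject (E := E) U n x i p) : MDifferentiable 𝓘(ℝ, ℝ) 𝓘(ℝ, E) p :=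
  h.smooth.mdifferentiable (by simp)

theorem exists_mfderiv_eq_smul (p : ℝ → M) (z : ℝ) :
    ∃ e : TangentSpace 𝓘(ℝ, E) (p z), ∀ u : TangentSpace 𝓘(ℝ, ℝ) z, ∃ c : ℝ,
      mfderiv 𝓘(ℝ, ℝ) 𝓘(ℝ, E) p z u = c • e := by
  refine ⟨mfderiv 𝓘(ℝ, ℝ) 𝓘(ℝ, E) p z (1 : ℝ), fun (u : ℝ) => ⟨u, ?_⟩⟩
  have h := map_smul (mfderiv 𝓘(ℝ, ℝ) 𝓘(ℝ, E) p z : ℝ →L[ℝ] E) u (1 : ℝ)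
  rw [smul_eq_mul, mul_one] at h
  exact h

variable [IsManifold 𝓘(ℝ, E) ∞ M]

namespace BundleWithConnection

theorem IsParallel.comp {B : BundleWithConnection (E := E) U} {N N' : Type*}
    [NormedAddCommGroup N] [NormedSpace ℝ N] [NormedAddCommGroup N'] [NormedSpace ℝ N']
    {H : N → M} {D : Set N} {σ : J → N → Circle} (hσ : B.IsParallel H D σ) {k : N' → N}
    (hk : Differentiable ℝ k) (hH : MDifferentiable 𝓘(ℝ, N) 𝓘(ℝ, E) H) :
    B.IsParallel (H ∘ k) (k ⁻¹' D) (fun j z => σ j (k z)) := by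
  refine ⟨fun z hz j l hj hl => hσ.trans _ hz j l hj hl, fun z hz j hj => ?_⟩
  rw [B.pull_comp j (hH _) (hk z)]
  exact (hσ.deriv _ hz j hj).comp z (hk z).hasFDerivAt

theorem pull_const (B : BundleWithConnection (E := E) U) (j : J) {N : Type*}
    [NormedAddCommGroup N] [NormedSpace ℝ N] (y : M) (z : N) :
    B.pull j (fun _ => y) z = 0 := by
  rw [pull, mfderiv_const]
  exact ContinuousLinearMap.comp_zero _

/-- The path is viewed as a map on the plane that ignores the second coordinate; the section over
`[a, b] × {0}` is restricted back to the line. -/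
theorem exists_isParallel_path (B : BundleWithConnection (E := E) U)
    (hU : ∀ y : M, ∃ i, y ∈ U i) {p : ℝ → M} (hp : ContMDiff 𝓘(ℝ, ℝ) 𝓘(ℝ, E) ∞ p) {a b : ℝ}
    (hab : a ≤ b) : ∃ D σ, Icc a b ⊆ D ∧ B.IsParallel p D σ := by
  have hfst : ContMDiff 𝓘(ℝ, ℝ × ℝ) 𝓘(ℝ, ℝ) ∞ (Prod.fst : ℝ × ℝ → ℝ) := contDiff_fst.contMDiff
  have hH : ContMDiff 𝓘(ℝ, ℝ × ℝ) 𝓘(ℝ, E) ∞ (p ∘ Prod.fst : ℝ × ℝ → M) := hp.comp hfst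
  obtain ⟨D, σ, -, hD, hσ⟩ := B.exists_isParallel hU hH (fun z => by
    obtain ⟨e, he⟩ := exists_mfderiv_eq_smul (E := E) p z.1
    refine ⟨e, fun u => ?_⟩
    obtain ⟨c, hc⟩ := he (mfderiv 𝓘(ℝ, ℝ × ℝ) 𝓘(ℝ, ℝ) Prod.fst z u)
    refine ⟨c, Eq.trans ?_ hc⟩
    exact DFunLike.congr_fun (mfderiv_comp (I' := 𝓘(ℝ, ℝ)) z (hp.mdifferentiable (by simp) z.1)
      (hfst.mdifferentiable (by simp) z)) u) hab (le_refl (0 : ℝ))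
  exact ⟨_, _, fun s hs => hD ⟨hs, le_rfl, le_rfl⟩, hσ.comp (k := fun s : ℝ => (s, (0 : ℝ)))
    (by fun_prop) (hH.mdifferentiable (by simp))⟩

/-- One parallel section along `p'` computes both transports, with `f` as the parameter for `p`.
Only the frames at the two ends differ. -/
theorem transport_of_iso (B : BundleWithConnection (E := E) U) (hU : ∀ y : M, ∃ i, y ∈ U i)
    (P P' : PathObject (E := E) U) {f : ℝ → ℝ} (hf : IsOrientedDiffeo f P.a P.b P'.a P'.b)
    (hp : ∀ s ∈ Icc P.a P.b, P.p s = P'.p (f s)) (ha : P.p P.a ∈ U P'.iFirst)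
    (hb : P.p P.b ∈ U P'.iLast) :
    B.transport P' = (B.gExt P.iFirst P'.iFirst (P.p P.a))⁻¹ * B.transport P *
      B.gExt P.iLast P'.iLast (P.p P.b) := by
  obtain ⟨D, σ, hD, hσ⟩ := B.exists_isParallel_path hU P'.isPathObject.smooth P'.a_lt_b.le
  have hm := mdifferentiable_path P'.isPathObject
  have hfa := hf.map_left P.a_lt_b.le P'.a_lt_b.le
  have hfb := hf.map_right P.a_lt_b.le P'.a_lt_b.le
  rw [B.transport_eq P' hσ (γ := id) continuousOn_id (fun s _ => differentiableAt_id)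
    (fun s hs => hD hs) (fun s _ => hm s) (fun s _ => rfl),
    B.transport_eq P hσ (γ := f) hf.smooth.continuousOn
    (fun s hs => (hf.smooth.contDiffAt (Icc_mem_nhds hs.1 hs.2)).differentiableAt (by simp))
    (fun s hs => hD (hf.mapsTo hs)) (fun s _ => hm _) hp, hfa, hfb]
  have ea := hp P.a ⟨le_rfl, P.a_lt_b.le⟩
  have eb := hp P.b ⟨P.a_lt_b.le, le_rfl⟩
  rw [hfa] at ea
  rw [hfb] at eb
  have h1 := hσ.trans P'.a (hD ⟨le_rfl, P'.a_lt_b.le⟩) P.iFirst P'.iFirst (ea ▸ P.mem_first)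
    (ea ▸ ha)
  have h2 := hσ.trans P'.b (hD ⟨P'.a_lt_b.le, le_rfl⟩) P.iLast P'.iLast (eb ▸ P.mem_last)
    (eb ▸ hb)
  rw [id, id, h1, h2, ea, eb, mul_inv]
  simp only [mul_assoc, mul_left_comm]

theorem transport_glue (B : BundleWithConnection (E := E) U) (hU : ∀ y : M, ∃ i, y ∈ U i)
    (P P' : PathObject (E := E) U) (hb : P.b = P'.a) (hp : P.p P.b = P'.p P'.a) :
    B.transport (P.glue P' hb hp) =
      B.transport P * B.gExt P.iLast P'.iFirst (P.p P.b) * B.transport P' := by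
  set Q := P.glue P' hb hp with hQ
  have hQa : Q.a = P.a := by
    change PathObject.glueX P P' 0 = P.x 0
    simp [PathObject.glueX]
  have hQb : Q.b = P'.b := by
    change PathObject.glueX P P' (Fin.last _) = P'.b
    rw [PathObject.glueX_of_ge hb _ (by simp; omega), PathObject.b]
    congr 1
    ext
    simp
    omega
  have hQf : Q.iFirst = P.iFirst := by
    change PathObject.glueI P P' 0 = P.i 0
    simp [PathObject.glueI]
  have hQl : Q.iLast = P'.iLast := by
    change PathObject.glueI P P' (Fin.last _) = P'.i (Fin.last _)
    rw [PathObject.glueI, dif_neg (by simp)]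
    congr 1
    ext
    simp
  have hpP : ∀ s ∈ Icc P.a P.b, P.p s = Q.p s := fun s hs => (if_pos hs.2).symm
  have hpP' : ∀ s ∈ Icc P'.a P'.b, P'.p s = Q.p s := by
    intro s hs
    change _ = PathObject.glueP P P' s
    unfold PathObject.glueP
    split_ifs with h
    · have : s = P'.a := le_antisymm (h.trans hb.le) hs.1
      rw [this, ← hb, hp, hb]
    · rfl
  obtain ⟨D, σ, hD, hσ⟩ := B.exists_isParallel_path hU Q.isPathObject.smooth Q.a_lt_b.le
  have hm := mdifferentiable_path Q.isPathObject
  have hab := P.a_lt_b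
  have hab' := P'.a_lt_b
  rw [hQa, hQb] at hD
  rw [B.transport_eq Q hσ (γ := id) continuousOn_id (fun s _ => differentiableAt_id)
    (fun s hs => hD (by rwa [hQa, hQb] at hs)) (fun s _ => hm s) (fun s _ => rfl),
    B.transport_eq P hσ (γ := id) continuousOn_id (fun s _ => differentiableAt_id)
    (fun s hs => hD ⟨hs.1, hs.2.trans (by linarith)⟩) (fun s _ => hm s) hpP,
    B.transport_eq P' hσ (γ := id) continuousOn_id (fun s _ => differentiableAt_id)
    (fun s hs => hD ⟨le_trans (by linarith) hs.1, hs.2⟩) (fun s _ => hm s) hpP',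
    hQa, hQb, hQf, hQl]
  have e1 := hpP P.b ⟨hab.le, le_rfl⟩
  have h1 := hσ.trans P.b (hD ⟨hab.le, by linarith⟩) P.iLast P'.iFirst (e1 ▸ P.mem_last)
    (e1 ▸ hp ▸ P'.mem_first)
  simp only [id]
  rw [← hb, h1, e1]
  simp [mul_assoc]

/-- The TQFT given by the parallel transport of a bundle with connection. -/
def toTQFT (B : BundleWithConnection (E := E) U) (hU : ∀ y : M, ∃ i, y ∈ U i) :
    EmbeddedTQFT (E := E) U where
  Z' s := match s.sign with
    | .pos => B.gExt s.i s.j s.y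
    | .neg => (B.gExt s.i s.j s.y)⁻¹
  Z := B.transport
  map_comp σ y i j k hi hj hk := by
    cases σ
    · exact B.gExt_mul hi hj hk
    · simp only [← mul_inv]
      rw [B.gExt_mul hi hj hk]
  map_iso P P' f hf hp ha hb := B.transport_of_iso hU P P' hf hp ha hb
  map_glue P P' hb hp := B.transport_glue hU P P' hb hp

theorem toTQFT_isThinInvariant (B : BundleWithConnection (E := E) U)
    (hU : ∀ y : M, ∃ i, y ∈ U i) : (B.toTQFT hU).IsThinInvariant := by
  intro P P' ha hb hf hl ⟨H, hH, hp, hends, hrank⟩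
  change B.transport P = B.transport P'
  have hab := P.a_lt_b
  set Q : Set (ℝ × ℝ) := Icc P.a P.b ×ˢ Icc 0 1 with hQ
  -- `H` is smooth only on the closed rectangle, whereas the existence of parallel sections is known
  -- for maps on the plane. The cosines fold the plane smoothly onto the rectangle, with `[0, π] ×
  -- [0, π]` covering it once; by the chain rule the rank stays at most one.
  set κ : ℝ × ℝ → ℝ × ℝ := fun z =>
    (P.a + (P.b - P.a) * ((1 - Real.cos z.1) / 2), (1 - Real.cos z.2) / 2) with hκ
  have hκs : ContDiff ℝ ∞ κ := by
    refine ContDiff.prodMk ?_ ?_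
    · exact contDiff_const.add (contDiff_const.mul
        ((contDiff_const.sub (Real.contDiff_cos.comp contDiff_fst)).div_const _))
    · exact (contDiff_const.sub (Real.contDiff_cos.comp contDiff_snd)).div_const _
  have hκQ : ∀ z, κ z ∈ Q := by
    intro z
    have h1 := Real.cos_le_one z.1
    have h2 := Real.neg_one_le_cos z.1
    have h3 := Real.cos_le_one z.2
    have h4 := Real.neg_one_le_cos z.2
    refine ⟨⟨?_, ?_⟩, ?_, ?_⟩ <;> simp only [hκ]
    · nlinarith
    · nlinarith
    · linarith
    · linarith
  have hH' : ContMDiff 𝓘(ℝ, ℝ × ℝ) 𝓘(ℝ, E) ∞ (H ∘ κ) :=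
    hH.comp_contMDiff hκs.contMDiff hκQ
  have hmH' := hH'.mdifferentiable (by simp)
  obtain ⟨D, σ, -, hD, hσ⟩ := B.exists_isParallel hU hH' (fun z => by
    have h1 := hrank (κ z) (hκQ z)
    have h2 := HasMFDerivWithinAt.comp (s := univ) z
      ((hH.mdifferentiableOn (by simp) _ (hκQ z)).hasMFDerivWithinAt)
      ((hκs.contMDiff.mdifferentiable (by simp) z).hasMFDerivAt.hasMFDerivWithinAt)
      (fun z _ => hκQ z)
    have h3 := (hasMFDerivWithinAt_univ.1 h2).mfderiv
    have : FiniteDimensional ℝ (TangentSpace 𝓘(ℝ, ℝ × ℝ) (κ z)) :=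
      inferInstanceAs (FiniteDimensional ℝ (ℝ × ℝ))
    obtain ⟨e, he⟩ := finrank_le_one_iff.1 h1
    refine ⟨e.1, fun u => ?_⟩
    obtain ⟨c, hc⟩ := he ⟨_, LinearMap.mem_range_self _
      (mfderiv 𝓘(ℝ, ℝ × ℝ) 𝓘(ℝ, ℝ × ℝ) κ z u)⟩
    exact ⟨c, (DFunLike.congr_fun h3 u).trans (congrArg Subtype.val hc).symm⟩) Real.pi_pos.le Real.pi_pos.le
  -- The inverse of the folding. It is not differentiable at `P.a` and `P.b`, so it matters that
  -- `transport_eq` asks for differentiability only in between.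
  set γ : ℝ → ℝ := fun s => Real.arccos (1 - 2 * ((s - P.a) / (P.b - P.a))) with hγ
  have hγc : Continuous γ := by
    refine Real.continuous_arccos.comp ?_
    fun_prop
  have hrange : ∀ s ∈ Icc P.a P.b, (s - P.a) / (P.b - P.a) ∈ Icc (0 : ℝ) 1 := by
    intro s hs
    exact ⟨div_nonneg (by linarith [hs.1]) (by linarith),
      (div_le_one (by linarith)).2 (by linarith [hs.2])⟩
  have hγd : ∀ s ∈ Ioo P.a P.b, DifferentiableAt ℝ γ s := by
    intro s hs
    have h0 : 0 < (s - P.a) / (P.b - P.a) := div_pos (by linarith [hs.1]) (by linarith)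
    have h1 : (s - P.a) / (P.b - P.a) < 1 := (div_lt_one (by linarith)).2 (by linarith [hs.2])
    refine (Real.differentiableAt_arccos.2 ⟨?_, ?_⟩).comp s (by fun_prop)
    · linarith
    · linarith
  have hκγ : ∀ s ∈ Icc P.a P.b, ∀ t, κ (γ s, t) = (s, (1 - Real.cos t) / 2) := by
    intro s hs t
    have h1 := hrange s hs
    simp only [hκ, hγ, Prod.mk.injEq, and_true]
    rw [Real.cos_arccos (by linarith [h1.2]) (by linarith [h1.1])]
    have h2 : P.b - P.a ≠ 0 := by linarith
    field_simp
    ring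
  have hγa : γ P.a = 0 := by simp [hγ]
  have hγb : γ P.b = Real.pi := by
    simp only [hγ]
    rw [div_self (by linarith)]
    norm_num
  have hγI : ∀ s, γ s ∈ Icc 0 Real.pi := fun s => ⟨Real.arccos_nonneg _, Real.arccos_le_pi _⟩
  have hpi : (0 : ℝ) ∈ Icc 0 Real.pi := ⟨le_rfl, Real.pi_pos.le⟩
  have hpi' : Real.pi ∈ Icc 0 Real.pi := ⟨Real.pi_pos.le, le_rfl⟩
  have t0 := B.transport_eq P hσ (γ := fun s => (γ s, 0)) (by fun_prop)
    (fun s hs => (hγd s hs).prodMk (by fun_prop)) (fun s _ => hD ⟨hγI s, hpi⟩)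
    (fun s _ => hmH' _) (fun s hs => by
      simp only [Function.comp_apply, hκγ s hs 0]
      rw [← (hp s hs).1]
      simp)
  have t1 := B.transport_eq P' hσ (γ := fun s => (γ s, Real.pi)) (by fun_prop)
    (fun s hs => (hγd s (by rwa [ha, hb])).prodMk (by fun_prop))
    (fun s _ => hD ⟨hγI s, hpi'⟩)
    (fun s _ => hmH' _) (fun s hs => by
      rw [← ha, ← hb] at hs
      simp only [Function.comp_apply, hκγ s hs]
      rw [← (hp s hs).2]
      norm_num)
  -- On the sides where the homotopy rests at an end point the pulled-back form vanishes, so the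
  -- section is constant there.
  have hside : ∀ s ∈ Icc (0 : ℝ) Real.pi, ∀ j, (∀ t, H (κ (s, t)) ∈ U j) →
      (∀ t, H (κ (s, t)) = H (κ (s, 0))) → σ j (s, Real.pi) = σ j (s, 0) := by
    intro s hs j hj hc
    have hd : ∀ t ∈ Icc (0 : ℝ) Real.pi, HasDerivAt (fun t => (σ j (s, t) : ℂ)) 0 t := by
      intro t ht
      have hk : HasDerivAt (fun t : ℝ => (s, t)) ((0 : ℝ), (1 : ℝ)) t :=
        (hasDerivAt_const t s).prodMk (hasDerivAt_id t)
      have h1 := (hσ.deriv (s, t) (hD ⟨hs, ht⟩) j (hj t)).comp_hasDerivAt t hk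
      have h2 := B.pull_comp j (hmH' (s, t)) hk.differentiableAt
      have h3 : (H ∘ κ) ∘ (fun t : ℝ => (s, t)) = fun _ => H (κ (s, 0)) := funext hc
      rw [h3, B.pull_const] at h2
      have h4 := DFunLike.congr_fun h2 1
      simp only [ContinuousLinearMap.comp_apply, fderiv_eq_smul_deriv, hk.deriv, one_smul,
        zero_apply] at h4
      refine HasDerivAt.congr_deriv h1 ?_
      simp [← h4]
    refine Circle.ext (constant_of_has_deriv_right_zero (f := fun t => (σ j (s, t) : ℂ))
      (fun t ht => (hd t ht).continuousAt.continuousWithinAt)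
      (fun t ht => (hd t (Ico_subset_Icc_self ht)).hasDerivWithinAt) Real.pi hpi')
  have hEa : ∀ t, H (κ (0, t)) = P.p P.a := by
    intro t
    have h1 := hκγ P.a ⟨le_rfl, hab.le⟩ t
    rw [hγa] at h1
    rw [h1]
    exact (hends _ (by have := (hκQ (0, t)).2; rwa [h1] at this)).1
  have hEb : ∀ t, H (κ (Real.pi, t)) = P.p P.b := by
    intro t
    have h1 := hκγ P.b ⟨hab.le, le_rfl⟩ t
    rw [hγb] at h1
    rw [h1]
    exact (hends _ (by have := (hκQ (Real.pi, t)).2; rwa [h1] at this)).2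
  rw [t0, t1, ← ha, ← hb, ← hf, ← hl, hγa, hγb,
    hside 0 hpi P.iFirst (fun t => hEa t ▸ P.mem_first) (fun t => (hEa t).trans (hEa 0).symm),
    hside _ hpi' P.iLast (fun t => hEb t ▸ P.mem_last) (fun t => (hEb t).trans (hEb 0).symm)]

end BundleWithConnection
end ToTQFT

/-! ### Smooth dependence of the transport on parameters -/

section ToTQFTSmooth

open Filter Topology

theorem contDiffAt_prod_complex {X ι : Type*} [NormedAddCommGroup X] [NormedSpace ℝ X]
    [Fintype ι] {f : ι → X → ℂ} {u : X} (h : ∀ a, ContDiffAt ℝ ∞ (f a) u) :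
    ContDiffAt ℝ ∞ (fun u => ∏ a, f a u) u :=
  contDiffAt_prod fun a _ => h a

variable {E : Type*} [NormedAddCommGroup E] [NormedSpace ℝ E]
  {M : Type*} [TopologicalSpace M] [ChartedSpace E M]
  {J : Type*} {U : J → Opens M} [IsManifold 𝓘(ℝ, E) ∞ M]

namespace BundleWithConnection

theorem coe_transport (B : BundleWithConnection (E := E) U) (P : PathObject (E := E) U) :
    (B.transport P : ℂ) =
      (∏ α : Fin (P.n + 1), Complex.exp ((B.lineIntegral (P.i α) P.p (P.x α.castSucc)
        (P.x α.succ) : ℂ) * Complex.I)) *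
      ∏ α : Fin P.n, (B.gExt (P.i α.castSucc) (P.i α.succ) (P.p (P.x α.succ.castSucc)) : ℂ) := by
  rw [transport, Circle.coe_mul]
  refine congrArg₂ _ ?_ ?_
  · refine (map_prod Circle.coeHom _ _).trans (Finset.prod_congr rfl fun α _ => ?_)
    exact Circle.coe_exp _
  · refine (map_prod Circle.coeHom _ _).trans (Finset.prod_congr rfl fun α _ => ?_)
    refine congrArg _ (B.gExt_of_mem (P.isPathObject.mem α.castSucc _ ⟨?_, le_rfl⟩)
      (P.isPathObject.mem α.succ _ ⟨le_rfl, ?_⟩)).symm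
    · exact (P.isPathObject.strictMono (Fin.castSucc_lt_succ (i := α.castSucc))).le
    · exact (P.isPathObject.strictMono (Fin.castSucc_lt_succ (i := α.succ))).le

/-- The substitution `s = c u + (d u - c u) * t` replaces the moving limits by `0` and `1`, after
which the integrand alone depends on `u`. -/
theorem contDiffAt_lineIntegral (B : BundleWithConnection (E := E) U) {X : Type}
    [NormedAddCommGroup X] [NormedSpace ℝ X] {p : X × ℝ → M} {c d : X → ℝ} {u₀ : X} {j : J}
    (hc : ContDiffAt ℝ ∞ c u₀) (hd : ContDiffAt ℝ ∞ d u₀) (hcd : c u₀ ≤ d u₀)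
    (hp : ∀ᶠ u in 𝓝 u₀, ∀ s, ContMDiffAt 𝓘(ℝ, X × ℝ) 𝓘(ℝ, E) ∞ p (u, s))
    (hmem : ∀ s ∈ Icc (c u₀) (d u₀), p (u₀, s) ∈ U j) :
    ContDiffAt ℝ ∞ (fun u => B.lineIntegral j (fun s => p (u, s)) (c u) (d u)) u₀ := by
  have h1 : (fun u => B.lineIntegral j (fun s => p (u, s)) (c u) (d u)) =ᶠ[𝓝 u₀]
      fun u => (d u - c u) * ∫ t in (0 : ℝ)..1,
        B.pull j p (u, c u + (d u - c u) * t) ((0 : X), (1 : ℝ)) := by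
    filter_upwards [hp] with u hu
    rw [B.lineIntegral_eq]
    have h2 : ∀ s, B.pull j (fun s => p (u, s)) s 1 = B.pull j p (u, s) ((0 : X), (1 : ℝ)) := by
      intro s
      have hk : HasDerivAt (fun s : ℝ => (u, s)) ((0 : X), (1 : ℝ)) s :=
        (hasDerivAt_const s u).prodMk (hasDerivAt_id s)
      have h3 := DFunLike.congr_fun
        (B.pull_comp j ((hu s).mdifferentiableAt (by simp)) hk.differentiableAt) 1
      simp only [ContinuousLinearMap.comp_apply, fderiv_eq_smul_deriv, hk.deriv, one_smul] at h3
      exact h3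
    simp only [h2]
    have h4 := intervalIntegral.mul_integral_comp_add_mul (a := 0) (b := 1)
      (f := fun s => B.pull j p (u, s) ((0 : X), (1 : ℝ))) (c := d u - c u) (d := c u)
    rw [h4]
    simp
  refine ContDiffAt.congr_of_eventuallyEq ((hd.sub hc).mul ?_) h1
  refine contDiffAt_intervalIntegral (f := fun u t =>
    B.pull j p (u, c u + (d u - c u) * t) ((0 : X), (1 : ℝ))) fun t ht => ?_
  rw [uIcc_of_le zero_le_one] at ht
  have hm : p (u₀, c u₀ + (d u₀ - c u₀) * t) ∈ U j := by
    refine hmem _ ⟨?_, ?_⟩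
    · nlinarith [ht.1]
    · nlinarith [ht.2]
  have h5 := B.contDiffAt_pull j (hp.self_of_nhds (c u₀ + (d u₀ - c u₀) * t)) hm
  have hc' : ContDiffAt ℝ ∞ (fun z : X × ℝ => c z.1) (u₀, t) :=
    ContDiffAt.comp (f := Prod.fst) (u₀, t) hc contDiffAt_fst
  have hd' : ContDiffAt ℝ ∞ (fun z : X × ℝ => d z.1) (u₀, t) :=
    ContDiffAt.comp (f := Prod.fst) (u₀, t) hd contDiffAt_fst
  have h6 : ContDiffAt ℝ ∞ (fun z : X × ℝ => (z.1, c z.1 + (d z.1 - c z.1) * z.2)) (u₀, t) :=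
    contDiffAt_fst.prodMk (hc'.add ((hd'.sub hc').mul contDiffAt_snd))
  exact (ContDiffAt.comp (u₀, t) h5 h6).clm_apply contDiffAt_const

theorem toTQFT_isSmooth (B : BundleWithConnection (E := E) U)
    (hU : ∀ y : M, ∃ i, y ∈ U i) : (B.toTQFT hU).IsSmooth := by
  intro k W n i x p h hx hp
  rw [contMDiff_circle_iff]
  intro u₀
  -- Composition with the retraction spreads the family over the whole Euclidean space, so that
  -- ordinary differentiability at `u₀` can be used.
  set r := W.retract u₀ with hr
  have hrW : ∀ u : W, r u = u := fun u => W.retract_of_mem u₀ u.2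
  have hrs : ∀ u ∈ W, ContMDiffAt 𝓘(ℝ, EuclideanSpace ℝ (Fin k)) 𝓘(ℝ, EuclideanSpace ℝ (Fin k)) ∞
    r u := fun u hu => W.contMDiffAt_retract u₀ hu
  set f : EuclideanSpace ℝ (Fin k) → ℂ :=
    fun u => (B.transport ⟨n, x (r u), i, p (r u), h (r u)⟩ : ℂ) with hf
  suffices hs : ContDiffAt ℝ ∞ f (u₀ : EuclideanSpace ℝ (Fin k)) by
    have h1 := contMDiffAt_subtype_iff.2 hs.contMDiffAt
    refine h1.congr_of_eventuallyEq (Eventually.of_forall fun u => ?_)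
    simp only [hf, hrW]
    rfl
  have hx' : ∀ α, ContDiffAt ℝ ∞ (fun u => x (r u) α) (u₀ : EuclideanSpace ℝ (Fin k)) := fun α =>
    contMDiffAt_iff_contDiffAt.1 (ContMDiffAt.comp (u₀ : EuclideanSpace ℝ (Fin k))
      (g := fun u => x u α) (hx α).contMDiffAt (hrs _ u₀.2))
  set q : EuclideanSpace ℝ (Fin k) × ℝ → M := fun z => p (r z.1) z.2 with hq
  have hq' : ∀ u ∈ W, ∀ s,
      ContMDiffAt 𝓘(ℝ, EuclideanSpace ℝ (Fin k) × ℝ) 𝓘(ℝ, E) ∞ q (u, s) := by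
    intro u hu s
    have h1 : ContMDiffAt 𝓘(ℝ, EuclideanSpace ℝ (Fin k) × ℝ) 𝓘(ℝ, EuclideanSpace ℝ (Fin k)) ∞
        (fun z : EuclideanSpace ℝ (Fin k) × ℝ => r z.1) (u, s) :=
      ContMDiffAt.comp (u, s) (hrs u hu) contDiffAt_fst.contMDiffAt
    have h2 : ContMDiffAt 𝓘(ℝ, EuclideanSpace ℝ (Fin k) × ℝ) 𝓘(ℝ, ℝ) ∞
        (fun z : EuclideanSpace ℝ (Fin k) × ℝ => z.2) (u, s) := contDiffAt_snd.contMDiffAt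
    exact ContMDiffAt.comp (u, s) (g := fun z : W × ℝ => p z.1 z.2) hp.contMDiffAt (h1.prodMk h2)
  have hmono := (h u₀).strictMono
  have hru : r u₀ = u₀ := hrW u₀
  simp only [hf, coe_transport]
  refine ContDiffAt.mul ?_ ?_
  · refine contDiffAt_prod_complex fun α => ?_
    have h1 := B.contDiffAt_lineIntegral (p := q) (j := i α) (hx' α.castSucc) (hx' α.succ)
      (by simp only [hru]; exact (hmono Fin.castSucc_lt_succ).le)
      (by filter_upwards [W.isOpen.mem_nhds u₀.2] with u hu using hq' u hu) (by
        simp only [hru, hq]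
        exact (h u₀).mem α)
    exact ((Complex.ofRealCLM.contDiff.contDiffAt.comp _ h1).mul contDiffAt_const).cexp
  · refine contDiffAt_prod_complex fun α => ?_
    have hm1 := (h u₀).mem α.castSucc (x u₀ α.succ.castSucc)
      ⟨(hmono Fin.castSucc_lt_succ).le, le_rfl⟩
    have hm2 := (h u₀).mem α.succ _ ⟨le_rfl, (hmono Fin.castSucc_lt_succ).le⟩
    have h1 : ContMDiffAt 𝓘(ℝ, EuclideanSpace ℝ (Fin k)) 𝓘(ℝ, E) ∞
        (fun u => q (u, x (r u) α.succ.castSucc)) (u₀ : EuclideanSpace ℝ (Fin k)) :=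
      ContMDiffAt.comp (u₀ : EuclideanSpace ℝ (Fin k)) (hq' u₀ u₀.2 _)
        (contDiffAt_id.prodMk (hx' α.succ.castSucc)).contMDiffAt
    refine contMDiffAt_iff_contDiffAt.1 (ContMDiffAt.comp (u₀ : EuclideanSpace ℝ (Fin k))
      (g := fun y => (B.gExt (i α.castSucc) (i α.succ) y : ℂ)) (B.contMDiffAt_gExt ?_ ?_) h1)
    · simpa only [hq, hru] using hm1
    · simpa only [hq, hru] using hm2

end BundleWithConnection
end ToTQFTSmooth

/-! ### Reparametrization and thin homotopies along one curve -/

section Reparametrization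

open Filter Topology

variable {E : Type*} [NormedAddCommGroup E] [NormedSpace ℝ E]
  {M : Type*} [TopologicalSpace M] [ChartedSpace E M]
  {J : Type*} {U : J → Opens M}

/-- A smooth map onto `[0, 1]` which is `0` to the left of `1 / 3` and `1` to the right of
`2 / 3`. -/
def step (s : ℝ) : ℝ := Real.smoothTransition (3 * s - 1)

theorem contDiff_step : ContDiff ℝ ∞ step :=
  Real.smoothTransition.contDiff.comp ((contDiff_const.mul contDiff_id).sub contDiff_const)

theorem step_mem (s : ℝ) : step s ∈ Icc (0 : ℝ) 1 :=
  ⟨Real.smoothTransition.nonneg _, Real.smoothTransition.le_one _⟩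

theorem step_eq_zero {s : ℝ} (h : s ≤ 1 / 3) : step s = 0 :=
  Real.smoothTransition.zero_of_nonpos (by linarith)

theorem step_eq_one {s : ℝ} (h : 2 / 3 ≤ s) : step s = 1 :=
  Real.smoothTransition.one_of_one_le (by linarith)

theorem isOrientedDiffeo_affine {m : ℝ} (hm : 0 < m) (e a b : ℝ) :
    IsOrientedDiffeo (fun s => m * s + e) a b (m * a + e) (m * b + e) := by
  refine ⟨fun s hs => ⟨?_, ?_⟩, by fun_prop, fun s _ t _ h => ?_, fun s => (s - e) / m, ?_, ?_, ?_⟩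
  · have := mul_le_mul_of_nonneg_left hs.1 hm.le
    linarith
  · have := mul_le_mul_of_nonneg_left hs.2 hm.le
    linarith
  · have := mul_lt_mul_of_pos_left h hm
    linarith
  · rintro s ⟨h1, h2⟩
    rw [mem_Icc, le_div_iff₀ hm, div_le_iff₀ hm]
    constructor <;> linarith
  · refine ⟨fun s _ => ?_, fun s _ => ?_⟩
    · simp only
      field_simp
      ring
    · simp only
      field_simp
      ring
  · fun_prop

/-- The object obtained from `(p, T)` by an affine change of the parameter. -/
def PathObject.rescale (P : PathObject (E := E) U) {m : ℝ} (hm : 0 < m) (e : ℝ) :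
    PathObject (E := E) U where
  n := P.n
  x := fun k => m * P.x k + e
  i := P.i
  p := fun s => P.p ((s - e) / m)
  isPathObject := by
    have hdiv : ∀ s, m * ((s - e) / m) + e = s := by
      intro s
      field_simp
      ring
    have hdiv' : ∀ s, (m * s + e - e) / m = s := by
      intro s
      field_simp
      ring
    refine ⟨fun k l h => ?_, ?_, ?_, ?_, ?_⟩
    · have := mul_lt_mul_of_pos_left (P.isPathObject.strictMono h) hm
      linarith
    · have h1 : ContDiff ℝ ∞ (fun s : ℝ => (s - e) / m) := by fun_prop
      exact P.isPathObject.smooth.comp h1.contMDiff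
    · obtain ⟨ε, hε, h⟩ := P.isPathObject.const_left
      refine ⟨m * ε, by positivity, fun s hs => ?_⟩
      simp only [hdiv']
      refine h _ ?_
      rw [div_lt_iff₀ hm]
      linarith
    · obtain ⟨ε, hε, h⟩ := P.isPathObject.const_right
      refine ⟨m * ε, by positivity, fun s hs => ?_⟩
      simp only [hdiv']
      refine h _ ?_
      rw [gt_iff_lt, lt_div_iff₀ hm]
      linarith
    · intro α s hs
      refine P.isPathObject.mem α _ ⟨?_, ?_⟩
      · rw [le_div_iff₀ hm]
        linarith [hs.1]
      · rw [div_le_iff₀ hm]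
        linarith [hs.2]

/-- Two reparametrizations of a path with the same end points are thin homotopic. -/
theorem thinHomotopic_of_curve {a b : ℝ} (hab : a < b) {S : Set ℝ} (hS : Convex ℝ S) {c : ℝ → M}
    (hc : ∀ t ∈ S, ContMDiffAt 𝓘(ℝ, ℝ) 𝓘(ℝ, E) ∞ c t) {k k' : ℝ → ℝ} (hk : ContDiff ℝ ∞ k)
    (hk' : ContDiff ℝ ∞ k') (hkS : ∀ s ∈ Icc a b, k s ∈ S) (hkS' : ∀ s ∈ Icc a b, k' s ∈ S)
    (ha : k a = k' a) (hb : k b = k' b) {p p' : ℝ → M} (hp : ∀ s ∈ Icc a b, p s = c (k s))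
    (hp' : ∀ s ∈ Icc a b, p' s = c (k' s)) : ThinHomotopic (E := E) a b p p' := by
  -- The homotopy interpolates between the parameters, not between the points. It stays on the curve
  -- `c`, so its derivative factors through the line.
  set κ : ℝ × ℝ → ℝ := fun z => (1 - z.2) * k z.1 + z.2 * k' z.1 with hκ
  have hκs : ContDiff ℝ ∞ κ :=
    ((contDiff_const.sub contDiff_snd).mul (hk.comp contDiff_fst)).add
      (contDiff_snd.mul (hk'.comp contDiff_fst))
  have hκS : ∀ z ∈ Icc a b ×ˢ Icc (0 : ℝ) 1, κ z ∈ S := fun z hz =>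
    hS (hkS _ hz.1) (hkS' _ hz.1) (by linarith [hz.2.2]) hz.2.1 (by ring)
  have hsm : ∀ z ∈ Icc a b ×ˢ Icc (0 : ℝ) 1,
      ContMDiffAt 𝓘(ℝ, ℝ × ℝ) 𝓘(ℝ, E) ∞ (c ∘ κ) z := fun z hz =>
    (hc _ (hκS z hz)).comp z hκs.contMDiff.contMDiffAt
  have hla : a ∈ Icc a b := ⟨le_rfl, hab.le⟩
  have hlb : b ∈ Icc a b := ⟨hab.le, le_rfl⟩
  refine ⟨c ∘ κ, fun z hz => (hsm z hz).contMDiffWithinAt, fun s hs => ?_, fun t _ => ?_,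
    fun z hz => ?_⟩
  · simp [hκ, hp s hs, hp' s hs]
  · simp only [Function.comp_apply, hκ, ← ha, ← hb, hp a hla, hp b hlb]
    constructor <;> congr 1 <;> ring
  · have hu : UniqueMDiffWithinAt 𝓘(ℝ, ℝ × ℝ) (Icc a b ×ˢ Icc (0 : ℝ) 1) z :=
      ((uniqueDiffOn_Icc hab).prod (uniqueDiffOn_Icc zero_lt_one) z hz).uniqueMDiffWithinAt
    rw [mfderivWithin_eq_mfderiv hu ((hsm z hz).mdifferentiableAt (by simp))]
    have h1 := mfderiv_comp z ((hc _ (hκS z hz)).mdifferentiableAt (by simp))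
      ((hκs.contMDiff (n := ∞)).mdifferentiable (by simp) z)
    have : FiniteDimensional ℝ (TangentSpace 𝓘(ℝ, ℝ) (κ z)) :=
      inferInstanceAs (FiniteDimensional ℝ ℝ)
    have h2 : Module.finrank ℝ (mfderiv 𝓘(ℝ, ℝ) 𝓘(ℝ, E) c (κ z)).range ≤ 1 :=
      (LinearMap.finrank_range_le _).trans (Module.finrank_self ℝ).le
    refine (Submodule.finrank_mono ?_).trans h2
    rintro _ ⟨u, rfl⟩
    exact ⟨mfderiv 𝓘(ℝ, ℝ × ℝ) 𝓘(ℝ, ℝ) κ z u, (DFunLike.congr_fun h1 u).symm⟩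

namespace EmbeddedTQFT

variable (F : EmbeddedTQFT (E := E) U)

theorem Z'_self (σ : PointSign) (y : M) {i j : J} (h : i = j) (hi : y ∈ U i) (hj : y ∈ U j) :
    F.Z' ⟨σ, y, i, j, hi, hj⟩ = 1 := by
  subst h
  simpa using F.map_comp σ y i i i hi hi hi

theorem Z_rescale (P : PathObject (E := E) U) {m : ℝ} (hm : 0 < m) (e : ℝ) :
    F.Z (P.rescale hm e) = F.Z P := by
  have hp : ∀ s, P.p s = (P.rescale hm e).p (m * s + e) := by
    intro s
    change _ = P.p _
    congr 1
    field_simp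
    ring
  have := F.map_iso P (P.rescale hm e) (fun s => m * s + e)
    (isOrientedDiffeo_affine hm e P.a P.b) (fun s _ => hp s) P.mem_first P.mem_last
  have h1 := F.Z'_self .neg (P.p P.a) (i := P.iFirst) (j := (P.rescale hm e).iFirst) rfl
    P.mem_first P.mem_first
  have h2 := F.Z'_self .pos (P.p P.b) (i := P.iLast) (j := (P.rescale hm e).iLast) rfl
    P.mem_last P.mem_last
  rw [h1, h2, one_mul, mul_one] at this
  exact this

variable {F}

/-- For a thin invariant TQFT, the value on a path does not depend on its parametrization, nor on
the inner points and labels of the partition. -/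
theorem IsThinInvariant.Z_eq_of_curve (hT : F.IsThinInvariant) (P P' : PathObject (E := E) U)
    (hf : P.iFirst = P'.iFirst) (hl : P.iLast = P'.iLast) {S : Set ℝ} (hS : Convex ℝ S)
    {c : ℝ → M} (hc : ∀ t ∈ S, ContMDiffAt 𝓘(ℝ, ℝ) 𝓘(ℝ, E) ∞ c t) {k k' : ℝ → ℝ}
    (hk : ContDiff ℝ ∞ k) (hk' : ContDiff ℝ ∞ k') (hkS : ∀ s ∈ Icc P.a P.b, k s ∈ S)
    (hkS' : ∀ s ∈ Icc P'.a P'.b, k' s ∈ S) (ha : k P.a = k' P'.a) (hb : k P.b = k' P'.b)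
    (hp : ∀ s ∈ Icc P.a P.b, P.p s = c (k s)) (hp' : ∀ s ∈ Icc P'.a P'.b, P'.p s = c (k' s)) :
    F.Z P = F.Z P' := by
  have h1 := P.a_lt_b
  have h2 := P'.a_lt_b
  -- Thin homotopies require a common domain; the affine map with slope `m` carries the domain of
  -- `P` to that of `P'` without changing `Z`.
  set m := (P'.b - P'.a) / (P.b - P.a) with hm'
  have hm : 0 < m := div_pos (by linarith) (by linarith)
  set e := P'.a - m * P.a with he
  have ea : (P.rescale hm e).a = P'.a := by
    change m * P.a + e = _
    rw [he]
    ring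
  have eb : (P.rescale hm e).b = P'.b := by
    change m * P.b + e = _
    have : P.b - P.a ≠ 0 := by linarith
    rw [he, hm']
    field_simp
    ring
  have hinv : ∀ s ∈ Icc P'.a P'.b, (s - e) / m ∈ Icc P.a P.b := by
    intro s hs
    rw [← ea, ← eb] at hs
    have h3 : m * P.a + e ≤ s := hs.1
    have h4 : s ≤ m * P.b + e := hs.2
    rw [mem_Icc, le_div_iff₀ hm, div_le_iff₀ hm]
    constructor <;> linarith
  have ka : (P'.a - e) / m = P.a := by
    rw [← ea]
    change (m * P.a + e - e) / m = _
    field_simp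
    ring
  have kb : (P'.b - e) / m = P.b := by
    rw [← eb]
    change (m * P.b + e - e) / m = _
    field_simp
    ring
  rw [← F.Z_rescale P hm e]
  refine hT _ _ ea eb hf hl ?_
  rw [ea, eb]
  refine thinHomotopic_of_curve h2 hS hc (k := fun s => k ((s - e) / m)) (k' := k')
    (hk.comp (by fun_prop)) hk' (fun s hs => hkS _ (hinv s hs)) hkS' ?_ ?_
    (fun s hs => hp _ (hinv s hs)) hp'
  · simp only [ka, ha]
  · simp only [kb, hb]

end EmbeddedTQFT
end Reparametrization

/-! ### Values on segments of a curve -/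

section Segments

open Filter Topology

variable {E : Type*} [NormedAddCommGroup E] [NormedSpace ℝ E]
  {M : Type*} [TopologicalSpace M] [ChartedSpace E M]
  {J : Type*} {U : J → Opens M}

theorem isPathObject_comp_step {n : ℕ} {x : Fin (n + 2) → ℝ} {i : Fin (n + 1) → J}
    (hx : StrictMono x) (h0 : x 0 = 0) (h1 : x (Fin.last (n + 1)) = 1) {c : ℝ → M}
    (hc : ∀ t ∈ Icc (0 : ℝ) 1, ContMDiffAt 𝓘(ℝ, ℝ) 𝓘(ℝ, E) ∞ c t)
    (hm : ∀ t ∈ Icc (0 : ℝ) 1, ∀ α, c t ∈ U (i α)) :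
    IsPathObject (E := E) U n x i (fun s => c (step s)) := by
  refine ⟨hx, fun s => ?_, ⟨1 / 3, by norm_num, fun s hs => ?_⟩, ⟨1 / 3, by norm_num,
    fun s hs => ?_⟩, fun α s _ => hm _ (step_mem s) α⟩
  · exact ContMDiffAt.comp s (hc _ (step_mem s)) contDiff_step.contMDiff.contMDiffAt
  · rw [h0] at hs ⊢
    rw [step_eq_zero (by linarith), step_eq_zero (by norm_num)]
  · rw [h1] at hs ⊢
    rw [step_eq_one (by linarith), step_eq_one (by norm_num)]

theorem strictMono_zero_one : StrictMono (![0, 1] : Fin 2 → ℝ) := by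
  rw [Fin.strictMono_iff_lt_succ]
  intro k
  fin_cases k
  simp

namespace EmbeddedTQFT

variable (F : EmbeddedTQFT (E := E) U)

open Classical in
/-- The value of `Z` on the object with the given path and labelled partition, if it exists. -/
def val (n : ℕ) (x : Fin (n + 2) → ℝ) (i : Fin (n + 1) → J) (p : ℝ → M) : Circle :=
  if h : IsPathObject (E := E) U n x i p then F.Z ⟨n, x, i, p, h⟩ else 1

theorem val_eq {n : ℕ} {x : Fin (n + 2) → ℝ} {i : Fin (n + 1) → J} {p : ℝ → M}
    (h : IsPathObject (E := E) U n x i p) : F.val n x i p = F.Z ⟨n, x, i, p, h⟩ := dif_pos h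

/-- The value on the path `c` from `c 0` to `c 1`, reparametrized to be constant near the end
points, and labelled by `j`. -/
def seg (j : J) (c : ℝ → M) : Circle := F.val 0 ![0, 1] (fun _ => j) (fun s => c (step s))

theorem seg_eq {j : J} {c : ℝ → M} (hc : ∀ t ∈ Icc (0 : ℝ) 1, ContMDiffAt 𝓘(ℝ, ℝ) 𝓘(ℝ, E) ∞ c t)
    (hm : ∀ t ∈ Icc (0 : ℝ) 1, c t ∈ U j) :
    F.seg j c = F.Z ⟨0, ![0, 1], fun _ => j, fun s => c (step s),
      isPathObject_comp_step strictMono_zero_one rfl rfl hc fun t ht _ => hm t ht⟩ :=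
  F.val_eq _

theorem seg_congr (j : J) {c c' : ℝ → M} (h : ∀ t ∈ Icc (0 : ℝ) 1, c t = c' t) :
    F.seg j c = F.seg j c' := by
  have : (fun s => c (step s)) = fun s => c' (step s) := funext fun s => h _ (step_mem s)
  rw [seg, seg, this]

variable {F}

/-- Smoothness of a TQFT is stated over open subsets of coordinate spaces. Since `val` is total, it
is enough that the data form an object near `u₀`, and `X` may be any finite-dimensional space. -/
theorem IsSmooth.contDiffAt_val (hF : F.IsSmooth) {X : Type*} [NormedAddCommGroup X]
    [NormedSpace ℝ X] [FiniteDimensional ℝ X] {n : ℕ} {x : Fin (n + 2) → ℝ}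
    {i : Fin (n + 1) → J} {p : X → ℝ → M} {u₀ : X}
    (hp : ∀ᶠ u in 𝓝 u₀, IsPathObject (E := E) U n x i (p u) ∧
      ∀ s, ContMDiffAt 𝓘(ℝ, X × ℝ) 𝓘(ℝ, E) ∞ (fun z : X × ℝ => p z.1 z.2) (u, s)) :
    ContDiffAt ℝ ∞ (fun u => (F.val n x i (p u) : ℂ)) u₀ := by
  obtain ⟨Ω, hΩ, hΩo, hu₀⟩ := eventually_nhds_iff.1 hp
  set e : EuclideanSpace ℝ (Fin (Module.finrank ℝ X)) ≃L[ℝ] X :=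
    (toEuclidean (E := X)).symm with he
  set W : Opens (EuclideanSpace ℝ (Fin (Module.finrank ℝ X))) :=
    ⟨e ⁻¹' Ω, hΩo.preimage e.continuous⟩ with hW
  have hWm : ∀ u : W, e u ∈ Ω := fun u => u.2
  have h1 := hF _ W n i (fun _ => x) (fun u => p (e u)) (fun u => (hΩ _ (hWm u)).1)
    (fun α => contMDiff_const) (by
      rintro ⟨u, s⟩
      have h2 : ContMDiff (𝓘(ℝ, EuclideanSpace ℝ (Fin (Module.finrank ℝ X))).prod 𝓘(ℝ, ℝ))
          𝓘(ℝ, X × ℝ) ∞ (fun z : W × ℝ => ((e z.1 : X), z.2)) := by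
        refine ContMDiff.prodMk_space ?_ contMDiff_snd
        exact e.contDiff.contMDiff.comp (contMDiff_subtype_val.comp contMDiff_fst)
      exact ContMDiffAt.comp (u, s) (g := fun z : X × ℝ => p z.1 z.2)
        ((hΩ _ (hWm u)).2 s) h2.contMDiffAt)
  rw [contMDiff_circle_iff] at h1
  have hmem : e.symm u₀ ∈ W := by
    change e (e.symm u₀) ∈ Ω
    rwa [e.apply_symm_apply]
  have h3 : ContMDiffAt 𝓘(ℝ, EuclideanSpace ℝ (Fin (Module.finrank ℝ X))) 𝓘(ℝ, ℂ) ∞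
      (fun u => (F.val n x i (p (e u)) : ℂ)) (e.symm u₀) := by
    rw [← contMDiffAt_subtype_iff (U := W) (x := ⟨_, hmem⟩)]
    refine (h1 ⟨_, hmem⟩).congr_of_eventuallyEq (Eventually.of_forall fun u => ?_)
    simp only
    rw [F.val_eq (hΩ _ (hWm u)).1]
  have h4 := (contMDiffAt_iff_contDiffAt.1 h3).comp u₀ e.symm.contDiff.contDiffAt
  refine h4.congr_of_eventuallyEq (Eventually.of_forall fun u => ?_)
  simp

/-- `step` takes values in `[0, 1]`, so by compactness conditions along this one interval persist
for nearby parameters. -/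
theorem IsSmooth.contDiffAt_val_comp_step (hF : F.IsSmooth) {X : Type*} [NormedAddCommGroup X]
    [NormedSpace ℝ X] [FiniteDimensional ℝ X] {n : ℕ} {x : Fin (n + 2) → ℝ}
    {i : Fin (n + 1) → J} (hx : StrictMono x) (h0 : x 0 = 0) (h1 : x (Fin.last (n + 1)) = 1)
    {c : X → ℝ → M} {u₀ : X}
    (hc : ∀ t ∈ Icc (0 : ℝ) 1, ∀ᶠ z in 𝓝 (u₀, t),
      ContMDiffAt 𝓘(ℝ, X × ℝ) 𝓘(ℝ, E) ∞ (fun z : X × ℝ => c z.1 z.2) z)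
    (hm : ∀ t ∈ Icc (0 : ℝ) 1, ∀ α, c u₀ t ∈ U (i α)) :
    ContDiffAt ℝ ∞ (fun u => (F.val n x i (fun s => c u (step s)) : ℂ)) u₀ := by
  refine hF.contDiffAt_val ?_
  have h2 : ∀ᶠ u in 𝓝 u₀, ∀ t ∈ Icc (0 : ℝ) 1,
      ContMDiffAt 𝓘(ℝ, X × ℝ) 𝓘(ℝ, E) ∞ (fun z : X × ℝ => c z.1 z.2) (u, t) ∧
        ∀ α, c u t ∈ U (i α) := by
    refine isCompact_Icc.eventually_forall_of_forall_eventually fun t ht => ?_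
    have h3 : ∀ᶠ z in 𝓝 (u₀, t), ∀ α, c z.1 z.2 ∈ U (i α) :=
      eventually_all.2 fun α => (hc t ht).self_of_nhds.continuousAt.eventually
        ((U (i α)).isOpen.mem_nhds (hm t ht α))
    exact (hc t ht).and h3
  filter_upwards [h2] with u hu
  refine ⟨isPathObject_comp_step hx h0 h1 (fun t ht => ?_) fun t ht => (hu t ht).2, fun s => ?_⟩
  · have h4 : ContDiff ℝ ∞ (fun t : ℝ => (u, t)) := by fun_prop
    exact ContMDiffAt.comp t (g := fun z : X × ℝ => c z.1 z.2) (hu t ht).1 h4.contMDiff.contMDiffAt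
  · have h4 : ContDiff ℝ ∞ (fun z : X × ℝ => (z.1, step z.2)) :=
      contDiff_fst.prodMk (contDiff_step.comp contDiff_snd)
    exact ContMDiffAt.comp (u, s) (g := fun z : X × ℝ => c z.1 z.2) (hu _ (step_mem s)).1
      h4.contMDiff.contMDiffAt

theorem IsSmooth.contDiffAt_seg (hF : F.IsSmooth) {X : Type*} [NormedAddCommGroup X]
    [NormedSpace ℝ X] [FiniteDimensional ℝ X] {j : J} {c : X → ℝ → M} {u₀ : X}
    (hc : ∀ t ∈ Icc (0 : ℝ) 1, ∀ᶠ z in 𝓝 (u₀, t),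
      ContMDiffAt 𝓘(ℝ, X × ℝ) 𝓘(ℝ, E) ∞ (fun z : X × ℝ => c z.1 z.2) z)
    (hm : ∀ t ∈ Icc (0 : ℝ) 1, c u₀ t ∈ U j) :
    ContDiffAt ℝ ∞ (fun u => (F.seg j (c u) : ℂ)) u₀ :=
  hF.contDiffAt_val_comp_step strictMono_zero_one rfl rfl hc fun t ht _ => hm t ht

theorem _root_.add_mul_sub_mem {S : Set ℝ} (hS : Convex ℝ S) {x y t : ℝ} (hx : x ∈ S)
    (hy : y ∈ S) (ht : t ∈ Icc (0 : ℝ) 1) : x + (y - x) * t ∈ S := by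
  have := hS hx hy (a := 1 - t) (b := t) (by linarith [ht.2]) ht.1 (by ring)
  convert this using 1
  simp
  ring

theorem _root_.contMDiffAt_comp_affine {c : ℝ → M} {x y t : ℝ}
    (hc : ContMDiffAt 𝓘(ℝ, ℝ) 𝓘(ℝ, E) ∞ c (x + (y - x) * t)) :
    ContMDiffAt 𝓘(ℝ, ℝ) 𝓘(ℝ, E) ∞ (fun r => c (x + (y - x) * r)) t := by
  have h : ContDiff ℝ ∞ (fun r : ℝ => x + (y - x) * r) := by fun_prop
  exact ContMDiffAt.comp t (g := c) hc h.contMDiff.contMDiffAt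

/-- The value on an object whose path runs along a curve in `U j`. -/
theorem IsThinInvariant.Z_eq_seg (hT : F.IsThinInvariant) (P : PathObject (E := E) U)
    {j : J} (hf : P.iFirst = j) (hl : P.iLast = j) {S : Set ℝ} (hS : Convex ℝ S)
    {c : ℝ → M} (hc : ∀ t ∈ S, ContMDiffAt 𝓘(ℝ, ℝ) 𝓘(ℝ, E) ∞ c t) (hm : ∀ t ∈ S, c t ∈ U j)
    {k : ℝ → ℝ} (hk : ContDiff ℝ ∞ k) (hkS : ∀ s ∈ Icc P.a P.b, k s ∈ S)
    (hp : ∀ s ∈ Icc P.a P.b, P.p s = c (k s)) :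
    F.Z P = F.seg j (fun r => c (k P.a + (k P.b - k P.a) * r)) := by
  have hka := hkS P.a ⟨le_rfl, P.a_lt_b.le⟩
  have hkb := hkS P.b ⟨P.a_lt_b.le, le_rfl⟩
  rw [F.seg_eq (fun t ht => contMDiffAt_comp_affine (hc _ (add_mul_sub_mem hS hka hkb ht)))
    (fun t ht => hm _ (add_mul_sub_mem hS hka hkb ht))]
  refine hT.Z_eq_of_curve P _ hf hl hS hc hk
    (k' := fun s => k P.a + (k P.b - k P.a) * step s)
    (contDiff_const.add (contDiff_const.mul contDiff_step)) hkS
    (fun s _ => add_mul_sub_mem hS hka hkb (step_mem s)) ?_ ?_ hp (fun s _ => rfl)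
  · change _ = k P.a + (k P.b - k P.a) * step 0
    rw [step_eq_zero (by norm_num)]
    ring
  · change _ = k P.a + (k P.b - k P.a) * step 1
    rw [step_eq_one (by norm_num)]
    ring

/-- The gluing law with equal labels, followed by a thin homotopy from the glued path to one
segment. The order of `x`, `y`, `z` is arbitrary, so backtracking cancels. -/
theorem IsThinInvariant.seg_mul_seg (hT : F.IsThinInvariant) {j : J} {S : Set ℝ}
    (hS : Convex ℝ S) {c : ℝ → M} (hc : ∀ t ∈ S, ContMDiffAt 𝓘(ℝ, ℝ) 𝓘(ℝ, E) ∞ c t)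
    (hm : ∀ t ∈ S, c t ∈ U j) {x y z : ℝ} (hx : x ∈ S) (hy : y ∈ S) (hz : z ∈ S) :
    F.seg j (fun r => c (x + (y - x) * r)) * F.seg j (fun r => c (y + (z - y) * r)) =
      F.seg j (fun r => c (x + (z - x) * r)) := by
  have hxy : ∀ t ∈ Icc (0 : ℝ) 1, x + (y - x) * t ∈ S := fun t ht => add_mul_sub_mem hS hx hy ht
  have hyz : ∀ t ∈ Icc (0 : ℝ) 1, y + (z - y) * t ∈ S := fun t ht => add_mul_sub_mem hS hy hz ht
  have s0 : step 0 = 0 := step_eq_zero (by norm_num)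
  have s1 : step 1 = 1 := step_eq_one (by norm_num)
  rw [F.seg_eq (fun t ht => contMDiffAt_comp_affine (hc _ (hxy t ht))) (fun t ht => hm _ (hxy t ht)),
    F.seg_eq (fun t ht => contMDiffAt_comp_affine (hc _ (hyz t ht))) (fun t ht => hm _ (hyz t ht))]
  set P : PathObject (E := E) U := ⟨0, ![0, 1], fun _ => j, fun s => c (x + (y - x) * step s), _⟩
    with hP
  set P₀ : PathObject (E := E) U := ⟨0, ![0, 1], fun _ => j, fun s => c (y + (z - y) * step s), _⟩
    with hP₀
  set P' := P₀.rescale one_pos 1 with hP'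
  have ha : P.a = 0 := rfl
  have hb : P.b = 1 := rfl
  have ha' : P'.a = 1 := by
    change (1 : ℝ) * 0 + 1 = 1
    norm_num
  have hb' : P'.b = 2 := by
    change (1 : ℝ) * 1 + 1 = 2
    norm_num
  have hp : ∀ s, P.p s = c (x + (y - x) * step s) := fun s => rfl
  have hp' : ∀ s, P'.p s = c (y + (z - y) * step (s - 1)) := by
    intro s
    change c (y + (z - y) * step ((s - 1) / 1)) = _
    rw [div_one]
  have hbb : P.b = P'.a := by rw [hb, ha']
  have hpp : P.p P.b = P'.p P'.a := by
    rw [hb, ha', hp, hp', s1, sub_self, s0]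
    congr 1
    ring
  have h1 := F.map_glue P P' hbb hpp
  rw [F.Z'_self .pos (P.p P.b) (i := P.iLast) (j := P'.iFirst) rfl _ _, mul_one,
    F.Z_rescale P₀ one_pos 1] at h1
  rw [← h1]
  set Q := P.glue P' hbb hpp with hQ
  have hQa : Q.a = 0 := by
    change PathObject.glueX P P' 0 = 0
    simp [PathObject.glueX]
    rfl
  have hQb : Q.b = 2 := by
    rw [← hb']
    change PathObject.glueX P P' (Fin.last _) = P'.b
    rw [PathObject.glueX_of_ge hbb _ (by simp; omega), PathObject.b]
    congr 1
  have hQf : Q.iFirst = j := by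
    change PathObject.glueI P P' 0 = j
    simp [PathObject.glueI]
    rfl
  have hQl : Q.iLast = j := by
    change PathObject.glueI P P' (Fin.last _) = j
    rw [PathObject.glueI, dif_neg (by simp)]
    rfl
  -- Before `1` the second step has not begun and after `1` the first is over, so a single smooth
  -- function parametrizes the glued path.
  set k : ℝ → ℝ := fun s => x + (y - x) * step s + (z - y) * step (s - 1) with hk
  have hks : ContDiff ℝ ∞ k := (contDiff_const.add (contDiff_const.mul contDiff_step)).add
    (contDiff_const.mul (contDiff_step.comp (contDiff_id.sub contDiff_const)))
  have hk1 : ∀ s ≤ 1, k s = x + (y - x) * step s := by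
    intro s hs
    simp only [hk]
    rw [step_eq_zero (s := s - 1) (by linarith)]
    ring
  have hk2 : ∀ s, 1 ≤ s → k s = y + (z - y) * step (s - 1) := by
    intro s hs
    simp only [hk]
    rw [step_eq_one (s := s) (by linarith)]
    ring
  rw [hT.Z_eq_seg Q hQf hQl hS hc hm hks (fun s _ => ?_) (fun s _ => ?_), hQa, hQb]
  · have e0 : k 0 = x := by
      rw [hk1 0 (by norm_num), s0]
      ring
    have e2 : k 2 = z := by
      rw [hk2 2 (by norm_num), step_eq_one (by norm_num)]
      ring
    rw [e0, e2]
  · rcases le_total s 1 with h | h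
    · rw [hk1 s h]
      exact hxy _ (step_mem s)
    · rw [hk2 s h]
      exact hyz _ (step_mem _)
  · change (if s ≤ P.b then P.p s else P'.p s) = _
    rw [hb]
    split_ifs with h
    · rw [hk1 s h]
    · rw [hk2 s (not_le.1 h).le, hp']

/-- A constant path glued to itself gives an idempotent of the group `Circle`. -/
theorem IsThinInvariant.seg_const (hT : F.IsThinInvariant) {j : J} {y : M} (hy : y ∈ U j) :
    F.seg j (fun _ => y) = 1 := by
  have := hT.seg_mul_seg (j := j) convex_univ (c := fun _ => y) (fun t _ => contMDiffAt_const)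
    (fun t _ => hy) (x := 0) (y := 0) (z := 0) trivial trivial trivial
  simpa using this

end EmbeddedTQFT
end Segments

/-! ### The infinitesimal form of a TQFT -/

section Derivative

open Filter Topology

/-- The real part is at most `1` on the circle, so it has a maximum at `t` and its derivative
vanishes there. -/
theorem HasDerivAt.eq_I_mul_im_of_circle {f : ℝ → Circle} {d : ℂ} {t : ℝ}
    (h : HasDerivAt (fun t => (f t : ℂ)) d t) (h1 : f t = 1) : d = Complex.I * (d.im : ℂ) := by
  have h2 : HasDerivAt (fun t => (f t : ℂ).re) d.re t :=
    Complex.reCLM.hasFDerivAt.comp_hasDerivAt t h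
  have h3 : IsLocalMax (fun t => (f t : ℂ).re) t := by
    refine Eventually.of_forall fun s => ?_
    simp only [h1, Circle.coe_one, Complex.one_re]
    exact (Complex.re_le_norm _).trans_eq (Circle.norm_coe _)
  have h4 := h3.hasDerivAt_eq_zero h2
  apply Complex.ext <;> simp [h4]

variable {E : Type*} [NormedAddCommGroup E] [NormedSpace ℝ E]
  {M : Type*} [TopologicalSpace M] [ChartedSpace E M]
  {J : Type*} {U : J → Opens M}

theorem mfderiv_curve_eq {c : ℝ → M} {t : ℝ} (hc : MDifferentiableAt 𝓘(ℝ, ℝ) 𝓘(ℝ, E) c t) :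
    (mfderiv 𝓘(ℝ, ℝ) 𝓘(ℝ, E) c t (1 : ℝ) : E) = deriv (extChartAt 𝓘(ℝ, E) (c t) ∘ c) t := by
  have h : ∀ (f : ℝ → E) (L : ℝ →L[ℝ] E), HasFDerivWithinAt f L (range id) t → L 1 = deriv f t := by
    intro f L h
    rw [range_id, hasFDerivWithinAt_univ] at h
    exact h.hasDerivAt.deriv.symm
  exact h _ _ hc.hasMFDerivAt.2

namespace EmbeddedTQFT

/-- The value on straight segments in a chart. -/
def segChart (F : EmbeddedTQFT (E := E) U) (j : J) (y₀ : M) (x w : E) : Circle :=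
  F.seg j (fun r => (extChartAt 𝓘(ℝ, E) y₀).symm (x + r • w))

/-- The derivative of the values on short paths starting at `y`. -/
def dform (F : EmbeddedTQFT (E := E) U) (j : J) (y : M) : TangentSpace 𝓘(ℝ, E) y →L[ℝ] ℝ :=
  Complex.imCLM.comp
    (fderiv ℝ (fun w : E => (F.segChart j y (extChartAt 𝓘(ℝ, E) y y) w : ℂ)) 0)

variable {F : EmbeddedTQFT (E := E) U}

variable [IsManifold 𝓘(ℝ, E) ∞ M]

theorem IsSmooth.contDiffAt_segChart [FiniteDimensional ℝ E] (hF : F.IsSmooth) {j : J} {y₀ : M}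
    {x : E} (hx : x ∈ (extChartAt 𝓘(ℝ, E) y₀).target)
    (hj : (extChartAt 𝓘(ℝ, E) y₀).symm x ∈ U j) :
    ContDiffAt ℝ ∞ (fun z : E × E => (F.segChart j y₀ z.1 z.2 : ℂ)) (x, 0) := by
  refine hF.contDiffAt_seg (c := fun (z : E × E) r => (extChartAt 𝓘(ℝ, E) y₀).symm (z.1 + r • z.2))
    (fun t _ => ?_) (fun t _ => by simpa using hj)
  have h1 : ContDiff ℝ ∞ (fun z : (E × E) × ℝ => z.1.1 + z.2 • z.1.2) := by fun_prop
  have h2 : ∀ᶠ z in 𝓝 ((x, (0 : E)), t), z.1.1 + z.2 • z.1.2 ∈ (extChartAt 𝓘(ℝ, E) y₀).target :=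
    h1.continuous.continuousAt.eventually
      ((isOpen_extChartAt_target (I := 𝓘(ℝ, E)) y₀).mem_nhds (by simpa using hx))
  filter_upwards [h2] with z hz
  exact ContMDiffAt.comp (I' := 𝓘(ℝ, E)) z ((contMDiffOn_extChartAt_symm y₀).contMDiffAt
    ((isOpen_extChartAt_target y₀).mem_nhds hz)) h1.contMDiff.contMDiffAt

/-- The derivative sees only the velocity of the curve and is linear in it: to first order the curve
may be replaced by a straight segment in the chart. -/
theorem hasDerivAt_seg_chart [FiniteDimensional ℝ E] (hF : F.IsSmooth) (hT : F.IsThinInvariant)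
    {j : J} {y₀ : M} {c : ℝ → M}
    (hc : ∀ᶠ t in 𝓝 0, ContMDiffAt 𝓘(ℝ, ℝ) 𝓘(ℝ, E) ∞ c t) (hj : c 0 ∈ U j)
    (hs : c 0 ∈ (extChartAt 𝓘(ℝ, E) y₀).source) :
    HasDerivAt (fun t => (F.seg j (fun r => c (t * r)) : ℂ))
      (fderiv ℝ (fun w => (F.segChart j y₀ (extChartAt 𝓘(ℝ, E) y₀ (c 0)) w : ℂ)) 0
        (deriv (extChartAt 𝓘(ℝ, E) y₀ ∘ c) 0)) 0 := by
  set φ := extChartAt 𝓘(ℝ, E) y₀ with hφ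
  set k := φ ∘ c with hk
  have hsrc : ∀ᶠ t in 𝓝 0, c t ∈ φ.source :=
    hc.self_of_nhds.continuousAt.eventually ((isOpen_extChartAt_source y₀).mem_nhds hs)
  obtain ⟨δ, hδ, hball⟩ := Metric.eventually_nhds_iff_ball.1 (hc.and hsrc)
  have hI : ∀ t ∈ Ioo (-δ) δ, ContMDiffAt 𝓘(ℝ, ℝ) 𝓘(ℝ, E) ∞ c t ∧ c t ∈ φ.source := by
    intro t ht
    refine hball t ?_
    rw [Real.ball_eq_Ioo]
    simpa using ht
  have hks : ∀ t ∈ Ioo (-δ) δ, ContDiffAt ℝ ∞ k t := by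
    intro t ht
    have h1 : c t ∈ (chartAt E y₀).source := by
      simpa [hφ] using (hI t ht).2
    exact contMDiffAt_iff_contDiffAt.1
      (ContMDiffAt.comp (I' := 𝓘(ℝ, E)) t (contMDiffAt_extChartAt' h1) (hI t ht).1)
  obtain ⟨w, hw0, hw⟩ := exists_contDiffAt_eq_add_smul hks
  have h0 : (0 : ℝ) ∈ Ioo (-δ) δ := ⟨by linarith, hδ⟩
  have hk0 : k 0 ∈ φ.target := φ.map_source hs
  have hψ0 : φ.symm (k 0) = c 0 := φ.left_inv hs
  -- Hadamard's lemma writes the curve in the chart as `k 0 + t • w t`; the two occurrences of `t`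
  -- become independent variables. On the diagonal `G` is the function to be differentiated, on the
  -- first axis it runs over straight segments with direction `w 0 = deriv k 0`, and on the second
  -- it is `1`.
  set G : ℝ × ℝ → ℂ := fun z => (F.seg j (fun r => φ.symm (k 0 + (z.1 * r) • w (z.2 * r))) : ℂ)
    with hG
  have hGs : ContDiffAt ℝ ∞ G (0, 0) := by
    refine hF.contDiffAt_seg
      (c := fun (z : ℝ × ℝ) r => φ.symm (k 0 + (z.1 * r) • w (z.2 * r))) (fun t _ => ?_)
      (fun t _ => by simpa [hψ0] using hj)
    have h1 : ∀ᶠ z : (ℝ × ℝ) × ℝ in 𝓝 ((0, 0), t), z.1.2 * z.2 ∈ Ioo (-δ) δ := by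
      have : ContinuousAt (fun z : (ℝ × ℝ) × ℝ => z.1.2 * z.2) ((0, 0), t) := by fun_prop
      exact this.eventually (isOpen_Ioo.mem_nhds (by simpa using hδ))
    have h2 : ∀ z : (ℝ × ℝ) × ℝ, z.1.2 * z.2 ∈ Ioo (-δ) δ →
        ContDiffAt ℝ ∞ (fun z : (ℝ × ℝ) × ℝ => k 0 + (z.1.1 * z.2) • w (z.1.2 * z.2)) z := by
      intro z hz
      have h3 : ContDiffAt ℝ ∞ (fun z : (ℝ × ℝ) × ℝ => z.1.2 * z.2) z := by fun_prop
      have h4 : ContDiffAt ℝ ∞ (fun z : (ℝ × ℝ) × ℝ => w (z.1.2 * z.2)) z :=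
        ContDiffAt.comp z (hw _ hz).1 h3
      have h5 : ContDiffAt ℝ ∞ (fun z : (ℝ × ℝ) × ℝ => z.1.1 * z.2) z := by fun_prop
      exact contDiffAt_const.add (h5.smul h4)
    have h6 : ∀ᶠ z : (ℝ × ℝ) × ℝ in 𝓝 ((0, 0), t),
        k 0 + (z.1.1 * z.2) • w (z.1.2 * z.2) ∈ φ.target :=
      (h2 _ h1.self_of_nhds).continuousAt.eventually
        ((isOpen_extChartAt_target (I := 𝓘(ℝ, E)) y₀).mem_nhds (by
          simpa only [mul_zero, zero_mul, zero_smul, add_zero] using hk0))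
    filter_upwards [h1, h6] with z hz hz'
    exact ContMDiffAt.comp (I' := 𝓘(ℝ, E)) z ((contMDiffOn_extChartAt_symm y₀).contMDiffAt
      ((isOpen_extChartAt_target y₀).mem_nhds hz')) (h2 z hz).contMDiffAt
  have hL := (hGs.differentiableAt (by simp)).hasFDerivAt
  set L := fderiv ℝ G (0, 0)
  have hf : HasFDerivAt (fun w => (F.segChart j y₀ (k 0) w : ℂ))
      (fderiv ℝ (fun w => (F.segChart j y₀ (k 0) w : ℂ)) 0) 0 := by
    have h1 : ContDiffAt ℝ ∞ (fun w : E => (k 0, w)) 0 := by fun_prop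
    have h2 : ContDiffAt ℝ ∞ (fun w => (F.segChart j y₀ (k 0) w : ℂ)) 0 :=
      ContDiffAt.comp (g := fun z : E × E => (F.segChart j y₀ z.1 z.2 : ℂ)) (0 : E)
        (hF.contDiffAt_segChart hk0 (by rwa [hψ0])) h1
    exact (h2.differentiableAt (by simp)).hasFDerivAt
  have e2 : L (0, 1) = 0 := by
    have h1 : HasDerivAt (fun t : ℝ => ((0 : ℝ), t)) ((0 : ℝ), (1 : ℝ)) 0 :=
      (hasDerivAt_const _ _).prodMk (hasDerivAt_id _)
    have h2 := HasFDerivAt.comp_hasDerivAt (0 : ℝ) hL h1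
    have h3 : G ∘ (fun t : ℝ => ((0 : ℝ), t)) = fun _ => 1 := by
      funext t
      simp only [hG, Function.comp_apply, zero_mul, zero_smul, add_zero, hψ0, hT.seg_const hj,
        Circle.coe_one]
    rw [h3] at h2
    exact h2.unique (hasDerivAt_const _ _)
  have e1 : L (1, 0) = fderiv ℝ (fun w => (F.segChart j y₀ (k 0) w : ℂ)) 0 (deriv k 0) := by
    have h1 : HasDerivAt (fun t : ℝ => (t, (0 : ℝ))) ((1 : ℝ), (0 : ℝ)) 0 :=
      (hasDerivAt_id _).prodMk (hasDerivAt_const _ _)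
    have h2 := HasFDerivAt.comp_hasDerivAt (0 : ℝ) (f := fun t : ℝ => (t, (0 : ℝ))) hL h1
    have h3 : HasDerivAt (fun t : ℝ => t • w 0) (w 0) 0 := by
      simpa using (hasDerivAt_id (0 : ℝ)).smul_const (w 0)
    have h4 := HasFDerivAt.comp_hasDerivAt (0 : ℝ) (l := fun w => (F.segChart j y₀ (k 0) w : ℂ))
      (f := fun t : ℝ => t • w 0) (by simpa only [zero_smul] using hf) h3
    rw [← hw0]
    refine h2.unique (h4.congr_of_eventuallyEq (Eventually.of_forall fun t => ?_))
    simp only [hG, Function.comp_apply, segChart, zero_mul, smul_smul, mul_comm t]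
    rfl
  have h1 : HasDerivAt (fun t : ℝ => (t, t)) ((1 : ℝ), (1 : ℝ)) 0 :=
    (hasDerivAt_id _).prodMk (hasDerivAt_id _)
  have h2 := HasFDerivAt.comp_hasDerivAt (0 : ℝ) (f := fun t : ℝ => (t, t)) hL h1
  have h3 : ((1 : ℝ), (1 : ℝ)) = (1, 0) + (0, 1) := by simp
  rw [h3, map_add, e1, e2, add_zero] at h2
  refine h2.congr_of_eventuallyEq ?_
  filter_upwards [isOpen_Ioo.mem_nhds h0] with t ht
  simp only [hG, Function.comp_apply]
  congr 1
  refine F.seg_congr j fun r hr => ?_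
  have h5 : t * r ∈ Ioo (-δ) δ := by
    have := add_mul_sub_mem (convex_Ioo (-δ) δ) h0 ht hr
    simpa using this
  rw [← (hw _ h5).2]
  exact (φ.left_inv (hI _ h5).2).symm

/-- The derivative is imaginary because the value at `0` is `1`, so taking the imaginary part in
`dform` loses nothing; the chart at `c 0` identifies the two notions of velocity. -/
theorem hasDerivAt_seg [FiniteDimensional ℝ E] (hF : F.IsSmooth) (hT : F.IsThinInvariant)
    {j : J} {c : ℝ → M} (hc : ∀ᶠ t in 𝓝 0, ContMDiffAt 𝓘(ℝ, ℝ) 𝓘(ℝ, E) ∞ c t)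
    (hj : c 0 ∈ U j) :
    HasDerivAt (fun t => (F.seg j (fun r => c (t * r)) : ℂ))
      (Complex.I * (F.dform j (c 0) (mfderiv 𝓘(ℝ, ℝ) 𝓘(ℝ, E) c 0 (1 : ℝ)) : ℝ)) 0 := by
  have h1 := hasDerivAt_seg_chart hF hT hc hj (mem_extChartAt_source (I := 𝓘(ℝ, E)) (c 0))
  refine h1.congr_deriv ?_
  have h2 := h1.eq_I_mul_im_of_circle (by simpa using hT.seg_const hj)
  refine h2.trans (congrArg (fun r : ℝ => Complex.I * (r : ℂ)) ?_)
  have h3 := mfderiv_curve_eq (hc.self_of_nhds.mdifferentiableAt (by simp))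
  exact congrArg (fun v : E => (fderiv ℝ (fun w : E =>
    (F.segChart j (c 0) (extChartAt 𝓘(ℝ, E) (c 0) (c 0)) w : ℂ)) 0 v).im) h3.symm

end EmbeddedTQFT
end Derivative

/-! ### Change of labels and transition functions -/

section Labels

open Filter Topology

variable {E : Type*} [NormedAddCommGroup E] [NormedSpace ℝ E]
  {M : Type*} [TopologicalSpace M] [ChartedSpace E M]
  {J : Type*} {U : J → Opens M}

theorem isOrientedDiffeo_id (a b : ℝ) : IsOrientedDiffeo (fun s => s) a b a b := by
  simpa using isOrientedDiffeo_affine one_pos 0 a b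

theorem contMDiffAt_of_chart {G : Type*} [NormedAddCommGroup G] [NormedSpace ℝ G] {f : M → G}
    {y : M} (h : ContDiffAt ℝ ∞ (f ∘ (extChartAt 𝓘(ℝ, E) y).symm) (extChartAt 𝓘(ℝ, E) y y)) :
    ContMDiffAt 𝓘(ℝ, E) 𝓘(ℝ, G) ∞ f y := by
  refine (ContMDiffAt.comp (I' := 𝓘(ℝ, E)) y h.contMDiffAt
    (contMDiffAt_extChartAt (I := 𝓘(ℝ, E)) (n := ∞) (x := y))).congr_of_eventuallyEq ?_
  filter_upwards [extChartAt_source_mem_nhds (I := 𝓘(ℝ, E)) y] with z hz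
  simp only [Function.comp_apply]
  rw [(extChartAt 𝓘(ℝ, E) y).left_inv hz]

namespace EmbeddedTQFT

variable {F : EmbeddedTQFT (E := E) U}

/-- The identity relabels a constant path from `i` to `j`. Since `Z` is `1` for both labels, the end
factors must cancel. -/
theorem IsThinInvariant.Z'_neg (hT : F.IsThinInvariant) {y : M} {i j : J} (hi : y ∈ U i)
    (hj : y ∈ U j) : F.Z' ⟨.neg, y, i, j, hi, hj⟩ = (F.Z' ⟨.pos, y, i, j, hi, hj⟩)⁻¹ := by
  have h1 := hT.seg_const hi
  have h2 := hT.seg_const hj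
  rw [F.seg_eq (fun _ _ => contMDiffAt_const) (fun _ _ => hi)] at h1
  rw [F.seg_eq (fun _ _ => contMDiffAt_const) (fun _ _ => hj)] at h2
  have h3 := F.map_iso
    ⟨0, ![0, 1], fun _ => i, fun _ => y, isPathObject_comp_step strictMono_zero_one rfl rfl
      (fun _ _ => contMDiffAt_const) fun _ _ _ => hi⟩
    ⟨0, ![0, 1], fun _ => j, fun _ => y, isPathObject_comp_step strictMono_zero_one rfl rfl
      (fun _ _ => contMDiffAt_const) fun _ _ _ => hj⟩
    (fun s => s) (isOrientedDiffeo_id _ _) (fun _ _ => rfl) hj hj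
  rw [h1, h2, mul_one] at h3
  exact eq_inv_of_mul_eq_one_left h3.symm

/-- Gluing a constant path labelled `i` to one labelled `j` leaves only the factor `Z'`; the result
is thin homotopic to `constPath`. -/
theorem IsThinInvariant.Z_constPath (hT : F.IsThinInvariant) {y : M} {i j : J} (hi : y ∈ U i)
    (hj : y ∈ U j) : F.Z (constPath U i j y hi hj) = F.Z' ⟨.pos, y, i, j, hi, hj⟩ := by
  have h1 := hT.seg_const hi
  have h2 := hT.seg_const hj
  rw [F.seg_eq (fun _ _ => contMDiffAt_const) (fun _ _ => hi)] at h1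
  rw [F.seg_eq (fun _ _ => contMDiffAt_const) (fun _ _ => hj)] at h2
  set P : PathObject (E := E) U := ⟨0, ![0, 1], fun _ => i, fun _ => y,
    isPathObject_comp_step strictMono_zero_one rfl rfl
      (fun _ _ => contMDiffAt_const) fun _ _ _ => hi⟩
  set P₀ : PathObject (E := E) U := ⟨0, ![0, 1], fun _ => j, fun _ => y,
    isPathObject_comp_step strictMono_zero_one rfl rfl
      (fun _ _ => contMDiffAt_const) fun _ _ _ => hj⟩
  set P' := P₀.rescale one_pos 1 with hP'
  have hb : P.b = P'.a := by
    change (1 : ℝ) = 1 * 0 + 1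
    norm_num
  have h3 := F.map_glue P P' hb rfl
  rw [F.Z_rescale, h1, h2, one_mul, mul_one] at h3
  refine Eq.trans ?_ h3
  have hf : (P.glue P' hb rfl).iFirst = i := by
    change PathObject.glueI P P' 0 = i
    simp [PathObject.glueI]
    rfl
  have hl : (P.glue P' hb rfl).iLast = j := by
    change PathObject.glueI P P' (Fin.last _) = j
    rw [PathObject.glueI, dif_neg (by simp)]
    rfl
  refine hT.Z_eq_of_curve _ _ hf.symm hl.symm convex_univ (c := fun _ => y)
    (fun _ _ => contMDiffAt_const) (k := fun _ => 0) (k' := fun _ => 0) contDiff_const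
    contDiff_const (fun _ _ => trivial) (fun _ _ => trivial) rfl rfl (fun _ _ => rfl)
    (fun s _ => ?_)
  change PathObject.glueP P P' s = y
  unfold PathObject.glueP
  split_ifs
  · rfl
  · rfl

/-- The isomorphism axiom for the identity map, with `Z'` expressed by constant paths. Its
derivative will be the connection identity. -/
theorem IsThinInvariant.seg_change_label (hT : F.IsThinInvariant) {j k : J} {c : ℝ → M}
    (hc : ∀ t ∈ Icc (0 : ℝ) 1, ContMDiffAt 𝓘(ℝ, ℝ) 𝓘(ℝ, E) ∞ c t)
    (hj : ∀ t ∈ Icc (0 : ℝ) 1, c t ∈ U j) (hk : ∀ t ∈ Icc (0 : ℝ) 1, c t ∈ U k) :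
    F.seg k c = (F.Z (constPath U j k (c 0) (hj 0 ⟨le_rfl, zero_le_one⟩)
      (hk 0 ⟨le_rfl, zero_le_one⟩)))⁻¹ * F.seg j c * F.Z (constPath U j k (c 1)
        (hj 1 ⟨zero_le_one, le_rfl⟩) (hk 1 ⟨zero_le_one, le_rfl⟩)) := by
  rw [hT.Z_constPath, hT.Z_constPath, ← hT.Z'_neg, F.seg_eq hc hj, F.seg_eq hc hk]
  have s0 : step 0 = 0 := step_eq_zero (by norm_num)
  have s1 : step 1 = 1 := step_eq_one (by norm_num)
  have h0 : c 0 = c (step 0) := by rw [s0]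
  have h1 : c 1 = c (step 1) := by rw [s1]
  simp only [h0, h1]
  exact F.map_iso
    ⟨0, ![0, 1], fun _ => j, fun s => c (step s), isPathObject_comp_step strictMono_zero_one rfl rfl
      hc fun t ht _ => hj t ht⟩
    ⟨0, ![0, 1], fun _ => k, fun s => c (step s), isPathObject_comp_step strictMono_zero_one rfl rfl
      hc fun t ht _ => hk t ht⟩
    (fun s => s) (isOrientedDiffeo_id _ _) (fun _ _ => rfl) _ _

/-- The transition function, extended to all of `M`. -/
def transition (F : EmbeddedTQFT (E := E) U) (i j : J) (y : M) : Circle :=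
  F.val 1 ![0, 1 / 2, 1] ![i, j] (fun _ => y)

theorem transition_eq (F : EmbeddedTQFT (E := E) U) {i j : J} {y : M} (hi : y ∈ U i)
    (hj : y ∈ U j) : F.transition i j y = F.Z (constPath U i j y hi hj) :=
  F.val_eq (constPath U i j y hi hj).isPathObject

variable [IsManifold 𝓘(ℝ, E) ∞ M]

theorem IsSmooth.contMDiffAt_transition [FiniteDimensional ℝ E] (hF : F.IsSmooth) {i j : J}
    {y : M} (hi : y ∈ U i) (hj : y ∈ U j) :
    ContMDiffAt 𝓘(ℝ, E) 𝓘(ℝ, ℂ) ∞ (fun y => (F.transition i j y : ℂ)) y := by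
  refine contMDiffAt_of_chart ?_
  have hy : (extChartAt 𝓘(ℝ, E) y).symm (extChartAt 𝓘(ℝ, E) y y) = y := extChartAt_to_inv y
  refine hF.contDiffAt_val_comp_step (n := 1) (x := ![0, 1 / 2, 1])
    (i := ![i, j]) (c := fun u _ => (extChartAt 𝓘(ℝ, E) y).symm u)
    (constPath (E := E) U i j y hi hj).isPathObject.strictMono rfl rfl (fun t _ => ?_) (fun t _ α => ?_)
  · have h1 : ∀ᶠ z in 𝓝 (extChartAt 𝓘(ℝ, E) y y, t), z.1 ∈ (extChartAt 𝓘(ℝ, E) y).target :=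
      continuous_fst.continuousAt.eventually
        (extChartAt_target_mem_nhds (I := 𝓘(ℝ, E)) y)
    filter_upwards [h1] with z hz
    exact ContMDiffAt.comp (I' := 𝓘(ℝ, E)) z ((contMDiffOn_extChartAt_symm y).contMDiffAt
      ((isOpen_extChartAt_target y).mem_nhds hz)) contDiff_fst.contMDiff.contMDiffAt
  · simp only [hy]
    exact (constPath (E := E) U i j y hi hj).isPathObject.mem α _ (left_mem_Icc.2
      ((constPath (E := E) U i j y hi hj).isPathObject.strictMono Fin.castSucc_lt_succ).le)

theorem _root_.exists_curve (y : M) (v : E) :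
    ∃ c : ℝ → M, (∀ᶠ t in 𝓝 (0 : ℝ), ContMDiffAt 𝓘(ℝ, ℝ) 𝓘(ℝ, E) ∞ c t) ∧ c 0 = y ∧
      (mfderiv 𝓘(ℝ, ℝ) 𝓘(ℝ, E) c 0 (1 : ℝ) : E) = v := by
  set φ := extChartAt 𝓘(ℝ, E) y with hφ
  set a : ℝ → E := fun t => φ y + t • v with ha
  have ha0 : a 0 = φ y := by
    simp only [ha]
    rw [zero_smul, add_zero]
  have had : ContDiff ℝ ∞ a := by fun_prop
  have ha1 : HasDerivAt a v 0 := by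
    have := ((hasDerivAt_id (0 : ℝ)).smul_const v).const_add (φ y)
    rwa [one_smul] at this
  have h1 : ∀ᶠ t in 𝓝 (0 : ℝ), a t ∈ φ.target :=
    had.continuous.continuousAt.eventually ((isOpen_extChartAt_target y).mem_nhds
      (by rw [ha0]; exact mem_extChartAt_target y))
  have hc0 : (φ.symm ∘ a) 0 = y := by
    rw [Function.comp_apply, ha0]
    exact extChartAt_to_inv y
  have hcs : ∀ᶠ t in 𝓝 (0 : ℝ), ContMDiffAt 𝓘(ℝ, ℝ) 𝓘(ℝ, E) ∞ (φ.symm ∘ a) t := by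
    filter_upwards [h1] with t ht
    exact ContMDiffAt.comp (I' := 𝓘(ℝ, E)) t ((contMDiffOn_extChartAt_symm y).contMDiffAt
      ((isOpen_extChartAt_target y).mem_nhds ht)) had.contMDiff.contMDiffAt
  refine ⟨φ.symm ∘ a, hcs, hc0, ?_⟩
  rw [mfderiv_curve_eq (hcs.self_of_nhds.mdifferentiableAt (by simp)), hc0]
  have h4 : (φ ∘ (φ.symm ∘ a)) =ᶠ[𝓝 0] a := by
    filter_upwards [h1] with t ht using φ.right_inv ht
  exact h4.deriv_eq.trans ha1.deriv

/-- `dform` at `y` is defined in the chart at `y`, which varies with `y`. Evaluating the same curve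
in the fixed chart at `y₀` gives an expression suited to proving smoothness in `y`. -/
theorem dform_comp_mfderiv_symm [FiniteDimensional ℝ E] (hF : F.IsSmooth)
    (hT : F.IsThinInvariant) {j : J} {y₀ y : M} (hj : y ∈ U j)
    (hs : y ∈ (extChartAt 𝓘(ℝ, E) y₀).source) (v : E) :
    F.dform j y (mfderiv 𝓘(ℝ, E) 𝓘(ℝ, E) (extChartAt 𝓘(ℝ, E) y₀).symm
      (extChartAt 𝓘(ℝ, E) y₀ y) v : E) =
      (fderiv ℝ (fun w => (F.segChart j y₀ (extChartAt 𝓘(ℝ, E) y₀ y) w : ℂ)) 0 v).im := by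
  set φ := extChartAt 𝓘(ℝ, E) y₀ with hφ
  have h0 : φ.symm (φ y) = y := φ.left_inv hs
  set a : ℝ → E := fun t => φ y + t • v with ha
  have ha0 : a 0 = φ y := by simp [ha]
  have had : ContDiff ℝ ∞ a := by fun_prop
  have ha1 : HasDerivAt a v 0 := by
    have := ((hasDerivAt_id (0 : ℝ)).smul_const v).const_add (φ y)
    rwa [one_smul] at this
  set c : ℝ → M := φ.symm ∘ a with hc
  have hc0 : c 0 = y := by rw [hc, Function.comp_apply, ha0, h0]
  have h1 : ∀ᶠ t in 𝓝 (0 : ℝ), a t ∈ φ.target :=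
    had.continuous.continuousAt.eventually ((isOpen_extChartAt_target y₀).mem_nhds
      (by rw [ha0]; exact φ.map_source hs))
  have hψ : ∀ x ∈ φ.target, ContMDiffAt 𝓘(ℝ, E) 𝓘(ℝ, E) ∞ φ.symm x := fun x hx =>
    (contMDiffOn_extChartAt_symm y₀).contMDiffAt ((isOpen_extChartAt_target y₀).mem_nhds hx)
  have hcs : ∀ᶠ t in 𝓝 (0 : ℝ), ContMDiffAt 𝓘(ℝ, ℝ) 𝓘(ℝ, E) ∞ c t := by
    filter_upwards [h1] with t ht
    exact ContMDiffAt.comp (I' := 𝓘(ℝ, E)) t (hψ _ ht) had.contMDiff.contMDiffAt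
  have h2 := hasDerivAt_seg hF hT hcs (hc0 ▸ hj)
  have h3 := hasDerivAt_seg_chart hF hT hcs (hc0 ▸ hj) (y₀ := y₀) (hc0 ▸ hs)
  have h4 : (φ ∘ c) =ᶠ[𝓝 0] a := by
    filter_upwards [h1] with t ht using φ.right_inv ht
  rw [h4.deriv_eq, ha1.deriv] at h3
  have h5 := congrArg Complex.im (h2.unique h3)
  have h6 : (mfderiv 𝓘(ℝ, ℝ) 𝓘(ℝ, E) c 0 (1 : ℝ) : E) =
      mfderiv 𝓘(ℝ, E) 𝓘(ℝ, E) φ.symm (a 0) v := by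
    have h7 := mfderiv_comp (I' := 𝓘(ℝ, E)) (0 : ℝ)
      ((hψ (a 0) h1.self_of_nhds).mdifferentiableAt (by simp))
      (had.contMDiff.mdifferentiable (by simp) 0)
    refine (DFunLike.congr_fun h7 (1 : ℝ)).trans ?_
    have h8 : (mfderiv 𝓘(ℝ, ℝ) 𝓘(ℝ, E) a 0 (1 : ℝ) : E) = v := by
      rw [mfderiv_eq_fderiv]
      exact ha1.deriv
    exact congrArg (fun w : E => (mfderiv 𝓘(ℝ, E) 𝓘(ℝ, E) φ.symm (a 0) w : E)) h8
  have h9 : ∀ (z : M) (x : E), z = y → x = φ y → ∀ u : E,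
      u = mfderiv 𝓘(ℝ, E) 𝓘(ℝ, E) φ.symm x v →
      F.dform j z u = F.dform j y (mfderiv 𝓘(ℝ, E) 𝓘(ℝ, E) φ.symm (φ y) v : E) := by
    rintro _ _ rfl rfl _ rfl
    rfl
  rw [← h9 _ _ hc0 ha0 _ h6, ← hc0]
  rw [Complex.I_mul_im, Complex.ofReal_re] at h5
  exact h5

end EmbeddedTQFT
end Labels

/-! ### The bundle with connection of a TQFT -/

section ToBundle

open Filter Topology

variable {E : Type*} [NormedAddCommGroup E] [NormedSpace ℝ E] [FiniteDimensional ℝ E]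
  {M : Type*} [TopologicalSpace M] [ChartedSpace E M] [IsManifold 𝓘(ℝ, E) ∞ M]
  {J : Type*} {U : J → Opens M}

namespace EmbeddedTQFT

variable {F : EmbeddedTQFT (E := E) U}

/-- In the trivialization at `y₀` the form is a partial derivative, at `w = 0`, of the jointly
smooth function `segChart`. -/
theorem contMDiff_dform (hF : F.IsSmooth) (hT : F.IsThinInvariant) (j : J) :
    ContMDiff 𝓘(ℝ, E) (𝓘(ℝ, E).prod 𝓘(ℝ, E →L[ℝ] ℝ)) ∞
      (fun y : U j => Bundle.TotalSpace.mk' (E →L[ℝ] ℝ)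
        (E := fun b : M => TangentSpace 𝓘(ℝ, E) b →L[ℝ] ℝ) (y : M) (F.dform j y)) := by
  intro y₀
  refine (contMDiffAt_hom_bundle _).2 ⟨contMDiff_subtype_val.contMDiffAt, ?_⟩
  set φ := extChartAt 𝓘(ℝ, E) (y₀ : M) with hφ
  set a : E → (E →L[ℝ] ℝ) := fun x => Complex.imCLM.comp
    (fderiv ℝ (fun w => (F.segChart j (y₀ : M) x w : ℂ)) 0) with ha
  have hψ0 : φ.symm (φ y₀) = y₀ := extChartAt_to_inv (I := 𝓘(ℝ, E)) (y₀ : M)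
  have h1 : ContDiffAt ℝ ∞ a (φ y₀) := by
    refine contDiffAt_const.clm_comp (ContDiffAt.fderiv
      (f := fun (x w : E) => (F.segChart j (y₀ : M) x w : ℂ)) (g := fun _ => (0 : E)) (n := ∞)
      (m := ∞) ?_ contDiffAt_const (by simp))
    exact hF.contDiffAt_segChart (mem_extChartAt_target (I := 𝓘(ℝ, E)) (y₀ : M))
      (by rw [hψ0]; exact y₀.2)
  have h2 : ContMDiffAt 𝓘(ℝ, E) 𝓘(ℝ, E →L[ℝ] ℝ) ∞ (a ∘ φ) (y₀ : M) :=
    ContMDiffAt.comp (I' := 𝓘(ℝ, E)) (y₀ : M) h1.contMDiffAt contMDiffAt_extChartAt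
  have h3 := (contMDiffAt_subtype_iff (U := U j)).2 h2
  refine h3.congr_of_eventuallyEq ?_
  have h4 : ∀ᶠ y : U j in 𝓝 y₀, (y : M) ∈ (chartAt E (y₀ : M)).source :=
    continuous_subtype_val.continuousAt.eventually
      ((chartAt E (y₀ : M)).open_source.mem_nhds (mem_chart_source E (y₀ : M)))
  filter_upwards [h4] with y hy
  have hs : (y : M) ∈ φ.source := by simpa [hφ] using hy
  ext v
  simp only [ContinuousLinearMap.inCoordinates, ContinuousLinearMap.comp_apply]
  rw [TangentBundle.symmL_trivializationAt hy]
  refine (DFunLike.congr_fun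
    (Bundle.Trivial.continuousLinearMapAt_trivialization ℝ M ℝ (y : M)) _).trans ?_
  rw [modelWithCornersSelf_coe, range_id, mfderivWithin_univ]
  exact dform_comp_mfderiv_symm hF hT y.2 hs v

/-- Along a curve with velocity `v`, the rule for changing labels expresses the value in frame `k`
by that in frame `j` and the transition functions at the two ends. Differentiating at `0`, where
both values are `1`, gives the identity. -/
theorem connection_dform (hF : F.IsSmooth) (hT : F.IsThinInvariant) {j k : J} {y : M}
    (hj : y ∈ U j) (hk : y ∈ U k) (v : TangentSpace 𝓘(ℝ, E) y) :
    (mfderiv 𝓘(ℝ, E) 𝓘(ℝ, ℂ) (fun y => (F.transition j k y : ℂ)) y v : ℂ) =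
      (F.transition j k y : ℂ) * (Complex.I * ((F.dform k y v - F.dform j y v : ℝ) : ℂ)) := by
  obtain ⟨c, hc, rfl, hv⟩ := exists_curve (E := E) y v
  have hg := (hF.contMDiffAt_transition hj hk).mdifferentiableAt (by simp)
  have h1 : HasDerivAt (fun t => (F.transition j k (c t) : ℂ))
      (mfderiv 𝓘(ℝ, E) 𝓘(ℝ, ℂ) (fun y => (F.transition j k y : ℂ)) (c 0) v : ℂ) 0 := by
    have hc0 : MDifferentiableAt 𝓘(ℝ, ℝ) 𝓘(ℝ, E) c 0 :=
      hc.self_of_nhds.mdifferentiableAt (by simp)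
    have h2 : DifferentiableAt ℝ (fun t => (F.transition j k (c t) : ℂ)) 0 :=
      mdifferentiableAt_iff_differentiableAt.1 (hg.comp (0 : ℝ) hc0)
    refine h2.hasDerivAt.congr_deriv ?_
    rw [← fderiv_apply_one_eq_deriv, ← mfderiv_eq_fderiv]
    refine (DFunLike.congr_fun (mfderiv_comp (0 : ℝ) hg hc0) (1 : ℝ)).trans ?_
    exact congrArg (fun w : E => (mfderiv 𝓘(ℝ, E) 𝓘(ℝ, ℂ)
      (fun y => (F.transition j k y : ℂ)) (c 0) w : ℂ)) hv
  have h3 := hasDerivAt_seg hF hT hc hj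
  have h4 := hasDerivAt_seg hF hT hc hk
  have hv' : ∀ i, F.dform i (c 0) (mfderiv 𝓘(ℝ, ℝ) 𝓘(ℝ, E) c 0 (1 : ℝ)) = F.dform i (c 0) v :=
    fun i => congrArg (fun w : E => F.dform i (c 0) w) hv
  rw [hv'] at h3 h4
  have h5 := (h3.const_mul (F.transition j k (c 0) : ℂ)⁻¹).mul h1
  have hm : ∀ᶠ t in 𝓝 (0 : ℝ), c t ∈ U j ∧ c t ∈ U k :=
    hc.self_of_nhds.continuousAt.eventually 
      (inter_mem ((U j).isOpen.mem_nhds hj) ((U k).isOpen.mem_nhds hk))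
  obtain ⟨δ, hδ, hball⟩ := Metric.eventually_nhds_iff_ball.1 (hc.and hm)
  have hI : ∀ t ∈ Ioo (-δ) δ, ∀ r ∈ Icc (0 : ℝ) 1, ContMDiffAt 𝓘(ℝ, ℝ) 𝓘(ℝ, E) ∞ c (t * r) ∧
      c (t * r) ∈ U j ∧ c (t * r) ∈ U k := by
    intro t ht r hr
    refine hball _ ?_
    rw [Real.ball_eq_Ioo]
    have := add_mul_sub_mem (convex_Ioo (-δ) δ) (x := 0) ⟨by linarith, hδ⟩ ht hr
    simpa [mul_comm] using this
  have h6 : (fun t => (F.seg k (fun r => c (t * r)) : ℂ)) =ᶠ[𝓝 0] fun t =>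
      (F.transition j k (c 0) : ℂ)⁻¹ * (F.seg j (fun r => c (t * r)) : ℂ) *
        (F.transition j k (c t) : ℂ) := by
    filter_upwards [isOpen_Ioo.mem_nhds (⟨by linarith, hδ⟩ : (0 : ℝ) ∈ Ioo (-δ) δ)] with t ht
    have h7 := hT.seg_change_label (c := fun r => c (t * r)) (j := j) (k := k) (fun r hr => by
      have h8 : ContDiff ℝ ∞ (fun r : ℝ => t * r) := by fun_prop
      exact ContMDiffAt.comp r (g := c) (hI t ht r hr).1 h8.contMDiff.contMDiffAt)
      (fun r hr => (hI t ht r hr).2.1) (fun r hr => (hI t ht r hr).2.2)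
    rw [← F.transition_eq, ← F.transition_eq] at h7
    simp only [mul_zero, mul_one] at h7
    rw [h7]
    simp
  have h7 := h4.unique (h5.congr_of_eventuallyEq h6)
  have hne : (F.transition j k (c 0) : ℂ) ≠ 0 := Circle.coe_ne_zero _
  simp only [zero_mul, hT.seg_const hj, Circle.coe_one, mul_one] at h7
  have h8 : ∀ g a b D : ℂ, g ≠ 0 → b = g⁻¹ * a * g + g⁻¹ * D → D = g * (b - a) := by
    rintro g a _ D hg rfl
    field_simp
    ring
  rw [Complex.ofReal_sub, mul_sub Complex.I]
  exact h8 _ _ _ _ hne h7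

/-- The bundle with connection given by a smooth thin invariant TQFT. -/
def toBundle (F : EmbeddedTQFT (E := E) U) (hF : F.IsSmooth) (hT : F.IsThinInvariant) :
    BundleWithConnection (E := E) U where
  g i j y := F.transition i j y
  A j y := F.dform j y
  smooth_g i j := by
    rw [contMDiff_circle_iff]
    intro y
    exact contMDiffAt_subtype_iff.2 (hF.contMDiffAt_transition y.2.1 y.2.2)
  smooth_A := contMDiff_dform hF hT
  cocycle i j k y hi hj hk := by
    simp only
    rw [F.transition_eq hi hj, F.transition_eq hj hk, F.transition_eq hi hk, hT.Z_constPath,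
      hT.Z_constPath, hT.Z_constPath]
    exact F.map_comp _ _ _ _ _ _ _ _
  connection j k y v := by
    have h1 := (DFunLike.congr_fun (mfderiv_comp y
      ((hF.contMDiffAt_transition y.2.1 y.2.2).mdifferentiableAt (by simp))
      ((contMDiff_subtype_val (n := ∞)).contMDiffAt.mdifferentiableAt (by simp))) v).trans
      (connection_dform hF hT y.2.1 y.2.2 (dIncl y v))
    refine Eq.trans ?_ (congrArg (fun w : ℂ => (F.transition j k (y : M) : ℂ)⁻¹ * w) h1).symm
    exact (inv_mul_cancel_left₀ (Circle.coe_ne_zero _) _).symm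

end EmbeddedTQFT
end ToBundle

/-! ### Recovering a bundle from its TQFT -/

section RoundTrip

open Filter Topology

variable {E : Type*} [NormedAddCommGroup E] [NormedSpace ℝ E]
  {M : Type*} [TopologicalSpace M] [ChartedSpace E M]
  {J : Type*} {U : J → Opens M}

theorem EmbeddedTQFT.ext_of_eq {F F' : EmbeddedTQFT (E := E) U} (h' : F.Z' = F'.Z')
    (h : F.Z = F'.Z) : F = F' := by
  cases F
  cases F'
  subst h' h
  rfl

variable [IsManifold 𝓘(ℝ, E) ∞ M]

theorem BundleWithConnection.ext_of_eq {B B' : BundleWithConnection (E := E) U}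
    (hg : B.g = B'.g) (hA : B.A = B'.A) : B = B' := by
  cases B
  cases B'
  subst hg hA
  rfl

variable [FiniteDimensional ℝ E]

/-- On a short path the transport is `(σ j 0)⁻¹ * σ j t` for a parallel section, whose derivative at
`0` is `i` times `A j` on the velocity. -/
theorem BundleWithConnection.dform_toTQFT (B : BundleWithConnection (E := E) U)
    (hU : ∀ y : M, ∃ i, y ∈ U i) {j : J} {y : M} (hj : y ∈ U j) :
    (B.toTQFT hU).dform j y = B.A j ⟨y, hj⟩ := by
  ext v
  rw [← B.form_of_mem hj]
  obtain ⟨c, hc, rfl, hv⟩ := exists_curve (E := E) y v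
  have h1 := EmbeddedTQFT.hasDerivAt_seg (B.toTQFT_isSmooth hU) (B.toTQFT_isThinInvariant hU) hc hj
  obtain ⟨ε, hε, σ, hσ⟩ := B.exists_isParallel_local hU hc (exists_mfderiv_eq_smul (E := E) c)
  have h0 : (0 : ℝ) ∈ Metric.ball 0 ε := Metric.mem_ball_self hε
  have h2 := (hσ.deriv 0 h0 j hj).hasDerivAt.const_mul ((σ j 0 : ℂ)⁻¹)
  have hm : ∀ᶠ t in 𝓝 (0 : ℝ), c t ∈ U j :=
    hc.self_of_nhds.continuousAt.eventually ((U j).isOpen.mem_nhds hj)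
  obtain ⟨δ, hδ, hball⟩ := Metric.eventually_nhds_iff_ball.1 (hc.and hm)
  have hscale : ∀ ρ > 0, ∀ t ∈ Metric.ball (0 : ℝ) ρ, ∀ r ∈ Icc (0 : ℝ) 1,
      t * r ∈ Metric.ball (0 : ℝ) ρ := by
    intro ρ hρ t ht r hr
    have := add_mul_sub_mem (convex_ball (0 : ℝ) ρ) (Metric.mem_ball_self hρ) ht hr
    simpa using this
  have h3 : (fun t => ((B.toTQFT hU).seg j (fun r => c (t * r)) : ℂ)) =ᶠ[𝓝 0]
      fun t => (σ j 0 : ℂ)⁻¹ * (σ j t : ℂ) := by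
    filter_upwards [Metric.ball_mem_nhds 0 hδ, Metric.ball_mem_nhds 0 hε] with t ht ht'
    rw [EmbeddedTQFT.seg_eq _ (fun r hr => by
      have h8 : ContDiff ℝ ∞ (fun r : ℝ => t * r) := by fun_prop
      exact ContMDiffAt.comp r (g := c) (hball _ (hscale δ hδ t ht r hr)).1
        h8.contMDiff.contMDiffAt) (fun r hr => (hball _ (hscale δ hδ t ht r hr)).2)]
    have hs : ContDiff ℝ ∞ (fun s => t * step s) := contDiff_const.mul contDiff_step
    refine (congrArg (fun z : Circle => (z : ℂ)) (B.transport_eq _ hσ (γ := fun s => t * step s)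
      hs.continuous.continuousOn (fun s _ => hs.differentiable (by simp) s)
      (fun s _ => hscale ε hε t ht' _ (step_mem s))
      (fun s _ => (hball _ (hscale δ hδ t ht _ (step_mem s))).1.mdifferentiableAt (by simp))
      (fun s _ => rfl))).trans ?_
    change (((σ j (t * step 0))⁻¹ * σ j (t * step 1) : Circle) : ℂ) = _
    rw [step_eq_zero (by norm_num), step_eq_one (by norm_num)]
    simp
  have h4 := h1.unique (h2.congr_of_eventuallyEq h3)
  have hne : (σ j 0 : ℂ) ≠ 0 := Circle.coe_ne_zero _
  have h5 : ∀ (s : ℂ) (a b : ℝ), s ≠ 0 →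
      Complex.I * (a : ℂ) = s⁻¹ * ((Complex.I * s) * (b : ℂ)) → a = b := by
    intro s a b hs h
    have : Complex.I * (a : ℂ) = Complex.I * b := by
      rw [h]
      field_simp
    exact_mod_cast mul_left_cancel₀ Complex.I_ne_zero this
  have h6 := h5 _ _ _ hne h4
  rw [← congrArg (fun w : E => (B.toTQFT hU).dform j (c 0) w) hv,
    ← congrArg (fun w : E => B.form j (c 0) w) hv]
  exact h6

theorem BundleWithConnection.toBundle_toTQFT (B : BundleWithConnection (E := E) U)
    (hU : ∀ y : M, ∃ i, y ∈ U i) :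
    (B.toTQFT hU).toBundle (B.toTQFT_isSmooth hU) (B.toTQFT_isThinInvariant hU) = B := by
  refine BundleWithConnection.ext_of_eq ?_ ?_
  · funext i j y
    change (B.toTQFT hU).transition i j y = _
    rw [EmbeddedTQFT.transition_eq _ y.2.1 y.2.2, (B.toTQFT_isThinInvariant hU).Z_constPath]
    exact B.gExt_of_mem y.2.1 y.2.2
  · funext j y
    exact B.dform_toTQFT hU y.2

end RoundTrip

/-! ### A TQFT is determined by `Z'` and its infinitesimal form -/

section Uniqueness

open Filter Topology

variable {E : Type*} [NormedAddCommGroup E] [NormedSpace ℝ E]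
  {M : Type*} [TopologicalSpace M] [ChartedSpace E M]
  {J : Type*} {U : J → Opens M}

theorem eq_of_hasDerivAt_eq_mul {u u' : ℝ → Circle} {T : ℝ → ℂ} {x : ℝ} (hx : u x = u' x)
    (h : ∀ t, HasDerivAt (fun t => (u t : ℂ)) ((u t : ℂ) * T t) t)
    (h' : ∀ t, HasDerivAt (fun t => (u' t : ℂ)) ((u' t : ℂ) * T t) t) (t : ℝ) : u t = u' t := by
  have hne : ∀ t, (u' t : ℂ) ≠ 0 := fun t => Circle.coe_ne_zero _
  have h1 : ∀ t, HasDerivAt (fun t => (u t : ℂ) / (u' t : ℂ)) 0 t := by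
    intro t
    refine ((h t).div (h' t) (hne t)).congr_deriv ?_
    ring
  have h2 := is_const_of_deriv_eq_zero (fun t => (h1 t).differentiableAt)
    (fun t => (h1 t).deriv) t x
  rw [hx, div_self (hne x), div_eq_one_iff_eq (hne t)] at h2
  exact Circle.ext h2

/-- A smooth map which is the identity on the left of `l`, and constant near `m` and on the right
of `m`. -/
def cutRight (l m s : ℝ) : ℝ := m + (s - m) * (1 - step ((s - l) / (m - l)))

/-- A smooth map which is the identity on the right of `r`, and constant near `m` and on the left
of `m`. -/
def cutLeft (m r s : ℝ) : ℝ := m + (s - m) * step ((s - m) / (r - m))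

theorem contDiff_cutRight (l m : ℝ) : ContDiff ℝ ∞ (cutRight l m) :=
  contDiff_const.add ((contDiff_id.sub contDiff_const).mul
    (contDiff_const.sub (contDiff_step.comp (by fun_prop))))

theorem contDiff_cutLeft (m r : ℝ) : ContDiff ℝ ∞ (cutLeft m r) :=
  contDiff_const.add ((contDiff_id.sub contDiff_const).mul
    (contDiff_step.comp (by fun_prop)))

theorem cutRight_of_le {l m s : ℝ} (h : l < m) (hs : s ≤ l + (m - l) / 3) :
    cutRight l m s = s := by
  rw [cutRight, step_eq_zero]
  · ring
  · rw [div_le_iff₀ (by linarith)]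
    linarith

theorem cutRight_of_ge {l m s : ℝ} (h : l < m) (hs : m - (m - l) / 3 ≤ s) :
    cutRight l m s = m := by
  rw [cutRight, step_eq_one]
  · ring
  · rw [le_div_iff₀ (by linarith)]
    linarith

theorem cutRight_mem {l m s : ℝ} (hs : s ≤ m) : cutRight l m s ∈ Icc s m := by
  have h := step_mem ((s - l) / (m - l))
  constructor <;> unfold cutRight <;> nlinarith [h.1, h.2]

theorem cutLeft_of_le {m r s : ℝ} (h : m < r) (hs : s ≤ m + (r - m) / 3) :
    cutLeft m r s = m := by
  rw [cutLeft, step_eq_zero]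
  · ring
  · rw [div_le_iff₀ (by linarith)]
    linarith

theorem cutLeft_of_ge {m r s : ℝ} (h : m < r) (hs : r - (r - m) / 3 ≤ s) :
    cutLeft m r s = s := by
  rw [cutLeft, step_eq_one]
  · ring
  · rw [le_div_iff₀ (by linarith)]
    linarith

theorem cutLeft_mem {m r s : ℝ} (hs : m ≤ s) : cutLeft m r s ∈ Icc m s := by
  have h := step_mem ((s - m) / (r - m))
  constructor <;> unfold cutLeft <;> nlinarith [h.1, h.2]

theorem strictMono_pair {m r : ℝ} (h : m < r) : StrictMono (![m, r] : Fin 2 → ℝ) := by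
  rw [Fin.strictMono_iff_lt_succ]
  intro k
  fin_cases k
  simpa

section Split

variable {n : ℕ} {x : Fin (n + 3) → ℝ} {i : Fin (n + 2) → J} {p : ℝ → M}

/-- Restriction alone would not be constant near the new end point `m`, so the path is brought to
rest there. Only the last remaining interval is affected: `cutRight` is the identity up to `l`, and
between `l` and `m` it stays in that interval. -/
theorem IsPathObject.init (h : IsPathObject (E := E) U (n + 1) x i p) :
    IsPathObject (E := E) U n (fun k => x k.castSucc) (fun k => i k.castSucc)
      (fun s => p (cutRight (x (Fin.last n).castSucc.castSucc)
        (x (Fin.last (n + 1)).castSucc) s)) := by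
  set l := x (Fin.last n).castSucc.castSucc with hl
  set m := x (Fin.last (n + 1)).castSucc with hm
  have hlm : l < m := h.strictMono (by simp [Fin.lt_def])
  have h0l : x 0 ≤ l := h.strictMono.monotone (Fin.zero_le _)
  refine ⟨fun a b hab => h.strictMono (by simpa using hab), ?_, ?_, ?_, ?_⟩
  · exact h.smooth.comp (contDiff_cutRight l m).contMDiff
  · obtain ⟨ε, hε, hc⟩ := h.const_left
    refine ⟨min ε ((m - l) / 3), lt_min hε (by linarith), fun s hs => ?_⟩
    change s < x 0 + _ at hs
    have h1 := min_le_left ε ((m - l) / 3)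
    have h2 := min_le_right ε ((m - l) / 3)
    change p _ = p (cutRight l m (x 0))
    rw [cutRight_of_le hlm (by linarith), cutRight_of_le hlm (by linarith)]
    exact hc s (by linarith)
  · refine ⟨(m - l) / 3, by linarith, fun s hs => ?_⟩
    change s > m - _ at hs
    change p _ = p (cutRight l m m)
    rw [cutRight_of_ge hlm (by linarith), cutRight_of_ge hlm (by linarith)]
  · intro α s hs
    refine h.mem α.castSucc _ ?_
    change s ∈ Icc (x α.castSucc.castSucc) (x α.succ.castSucc) at hs
    rw [Fin.succ_castSucc]
    rcases eq_or_ne α (Fin.last n) with rfl | hα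
    · have h1 : s ≤ m := hs.2
      have h2 := cutRight_mem (l := l) h1
      exact ⟨hs.1.trans h2.1, h2.2⟩
    · have h1 : s ≤ l := hs.2.trans (h.strictMono.monotone (by
        have := Fin.val_lt_last hα
        simp [Fin.le_def]
        omega))
      rw [cutRight_of_le hlm (by linarith)]
      exact hs

theorem IsPathObject.final (h : IsPathObject (E := E) U (n + 1) x i p) :
    IsPathObject (E := E) U 0 ![x (Fin.last (n + 1)).castSucc, x (Fin.last (n + 2))]
      (fun _ => i (Fin.last (n + 1)))
      (fun s => p (cutLeft (x (Fin.last (n + 1)).castSucc) (x (Fin.last (n + 2))) s)) := by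
  set m := x (Fin.last (n + 1)).castSucc with hm
  set r := x (Fin.last (n + 2)) with hr
  have hmr : m < r := h.strictMono (by simp [Fin.lt_def])
  refine ⟨strictMono_pair hmr, h.smooth.comp (contDiff_cutLeft m r).contMDiff, ?_, ?_, ?_⟩
  · refine ⟨(r - m) / 3, by linarith, fun s hs => ?_⟩
    change s < m + _ at hs
    change p _ = p (cutLeft m r m)
    rw [cutLeft_of_le hmr (by linarith), cutLeft_of_le hmr (by linarith)]
  · obtain ⟨ε, hε, hc⟩ := h.const_right
    refine ⟨min ε ((r - m) / 3), lt_min hε (by linarith), fun s hs => ?_⟩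
    change s > r - _ at hs
    have h1 := min_le_left ε ((r - m) / 3)
    have h2 := min_le_right ε ((r - m) / 3)
    change p _ = p (cutLeft m r r)
    rw [cutLeft_of_ge hmr (by linarith), cutLeft_of_ge hmr (by linarith)]
    exact hc s (by change s > r - ε; linarith)
  · intro α s hs
    have hα : α = 0 := Fin.fin_one_eq_zero α
    subst hα
    change s ∈ Icc m r at hs
    have h2 := cutLeft_mem (r := r) hs.1
    exact h.mem (Fin.last (n + 1)) _ ⟨h2.1, h2.2.trans hs.2⟩

end Split

namespace EmbeddedTQFT


/-- For a thin invariant TQFT, the value on an object is determined by those on its pieces. -/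
theorem exists_Z_eq_init_mul_final {n : ℕ} {x : Fin (n + 3) → ℝ} {i : Fin (n + 2) → J}
    {p : ℝ → M} (h : IsPathObject (E := E) U (n + 1) x i p) :
    ∃ s, ∀ F : EmbeddedTQFT (E := E) U, F.IsThinInvariant → F.Z ⟨n + 1, x, i, p, h⟩ =
      F.Z ⟨n, _, _, _, h.init⟩ * F.Z' s * F.Z ⟨0, _, _, _, h.final⟩ := by
  set P₁ : PathObject (E := E) U := ⟨n, _, _, _, h.init⟩
  set P₂ : PathObject (E := E) U := ⟨0, _, _, _, h.final⟩
  set P : PathObject (E := E) U := ⟨n + 1, x, i, p, h⟩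
  set l := x (Fin.last n).castSucc.castSucc with hl
  set m := x (Fin.last (n + 1)).castSucc with hm
  set r := x (Fin.last (n + 2)) with hr
  have hlm : l < m := h.strictMono (by simp [Fin.lt_def])
  have hmr : m < r := h.strictMono (by simp [Fin.lt_def])
  have h0l : x 0 ≤ l := h.strictMono.monotone (Fin.zero_le _)
  have hb : P₁.b = P₂.a := rfl
  have hp : P₁.p P₁.b = P₂.p P₂.a := by
    change p (cutRight l m m) = p (cutLeft m r m)
    rw [cutRight_of_ge hlm (by linarith), cutLeft_of_le hmr (by linarith)]
  -- The isomorphism is chosen before `F`, so two TQFTs with the same `Z'` share the middle factor.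
  refine ⟨_, fun F hT => Eq.trans ?_ (F.map_glue P₁ P₂ hb hp)⟩
  set Q := P₁.glue P₂ hb hp with hQ
  have hQa : Q.a = x 0 := by
    change PathObject.glueX P₁ P₂ 0 = x 0
    simp [PathObject.glueX]
    rfl
  have hQb : Q.b = r := by
    change PathObject.glueX P₁ P₂ (Fin.last _) = r
    rw [PathObject.glueX_of_ge hb _ (by simp; omega)]
    have h1 : (⟨(Fin.last (P₁.n + P₂.n + 1 + 1)).val - (P₁.n + 1), by
        simp; omega⟩ : Fin (P₂.n + 2)) = Fin.last _ := by
      ext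
      simp
      omega
    rw [h1]
    rfl
  have hQf : Q.iFirst = P.iFirst := by
    change PathObject.glueI P₁ P₂ 0 = i 0
    simp [PathObject.glueI]
    rfl
  have hQl : Q.iLast = P.iLast := by
    change PathObject.glueI P₁ P₂ (Fin.last _) = i (Fin.last _)
    rw [PathObject.glueI, dif_neg (by simp)]
  -- On either side of `m` one of the two cut maps equals `m`. So their sum minus `m` is the other
  -- one, and the glued path is `p` after a single smooth change of parameter.
  refine hT.Z_eq_of_curve P Q hQf.symm hQl.symm convex_univ (c := p) (fun t _ => h.smooth t)
    (k := fun s => s) (k' := fun s => cutRight l m s + cutLeft m r s - m) contDiff_id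
    (((contDiff_cutRight l m).add (contDiff_cutLeft m r)).sub contDiff_const)
    (fun _ _ => trivial) (fun _ _ => trivial) ?_ ?_ (fun _ _ => rfl) (fun s _ => ?_)
  · rw [hQa, cutRight_of_le hlm (by linarith), cutLeft_of_le hmr (by linarith)]
    change x 0 = _
    ring
  · rw [hQb, cutRight_of_ge hlm (by linarith), cutLeft_of_ge hmr (by linarith)]
    change r = _
    ring
  · change (if s ≤ m then p (cutRight l m s) else p (cutLeft m r s)) = _
    split_ifs with hs
    · rw [cutLeft_of_le hmr (by linarith), add_sub_cancel_right]
    · rw [cutRight_of_ge hlm (by linarith), add_sub_cancel_left]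

/-- Induction on the number of intervals, splitting off the last one. -/
theorem Z_eq_of_zero {F F' : EmbeddedTQFT (E := E) U} (hT : F.IsThinInvariant)
    (hT' : F'.IsThinInvariant) (h' : F.Z' = F'.Z')
    (h : ∀ P : PathObject (E := E) U, P.n = 0 → F.Z P = F'.Z P) : F.Z = F'.Z := by
  have key : ∀ n x i p (hP : IsPathObject (E := E) U n x i p),
      F.Z ⟨n, x, i, p, hP⟩ = F'.Z ⟨n, x, i, p, hP⟩ := by
    intro n
    induction n with
    | zero => exact fun x i p hP => h _ rfl
    | succ n ih =>
      intro x i p hP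
      obtain ⟨s, hs⟩ := exists_Z_eq_init_mul_final hP
      rw [hs F hT, hs F' hT', ih, h', h ⟨0, _, _, _, hP.final⟩ rfl]
  exact funext fun P => key P.n P.x P.i P.p P.isPathObject

variable [IsManifold 𝓘(ℝ, E) ∞ M] [FiniteDimensional ℝ E]

/-- The segment from `x` to `s` is the one from `x` to `t` times the one from `t` to `s`, and the
derivative of the latter at `s = t` is known from `hasDerivAt_seg`. -/
theorem hasDerivAt_seg_of_curve {F : EmbeddedTQFT (E := E) U} (hF : F.IsSmooth)
    (hT : F.IsThinInvariant) {j : J} {c : ℝ → M} (hc : ContMDiff 𝓘(ℝ, ℝ) 𝓘(ℝ, E) ∞ c)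
    (hj : ∀ t, c t ∈ U j) (x t : ℝ) :
    HasDerivAt (fun t => (F.seg j (fun r => c (x + (t - x) * r)) : ℂ))
      ((F.seg j (fun r => c (x + (t - x) * r)) : ℂ) * (Complex.I * (F.dform j (c t)
        (mfderiv 𝓘(ℝ, ℝ) 𝓘(ℝ, E) c t (1 : ℝ)) : ℝ))) t := by
  have hsh : ContDiff ℝ ∞ (fun s : ℝ => t + s) := by fun_prop
  have hc' : ContMDiff 𝓘(ℝ, ℝ) 𝓘(ℝ, E) ∞ (c ∘ fun s => t + s) := hc.comp hsh.contMDiff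
  have h1 := hasDerivAt_seg hF hT (j := j) (c := c ∘ fun s => t + s)
    (Eventually.of_forall fun s => hc' s) (hj _)
  have h2 : (mfderiv 𝓘(ℝ, ℝ) 𝓘(ℝ, E) (c ∘ fun s => t + s) 0 (1 : ℝ) : E) =
      mfderiv 𝓘(ℝ, ℝ) 𝓘(ℝ, E) c t (1 : ℝ) := by
    rw [mfderiv_curve_eq (hc'.mdifferentiable (by simp) 0),
      mfderiv_curve_eq (hc.mdifferentiable (by simp) t)]
    simp only [Function.comp_apply, add_zero]
    have h3 := deriv_comp_const_add (extChartAt 𝓘(ℝ, E) (c t) ∘ c) t 0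
    rw [add_zero] at h3
    exact h3
  have h3 : ∀ (y y' : M) (v v' : E), y = y' → v = v' → F.dform j y v = F.dform j y' v' := by
    rintro _ _ _ _ rfl rfl
    rfl
  have e1 := h3 ((c ∘ fun s => t + s) 0) (c t) _ _ (by simp) h2
  have h4 := h1.const_mul (F.seg j (fun r => c (x + (t - x) * r)) : ℂ)
  rw [e1, ← sub_self t] at h4
  refine (HasDerivAt.comp_sub_const t t h4).congr_of_eventuallyEq (Eventually.of_forall fun s => ?_)
  simp only [Function.comp_apply]
  rw [← Circle.coe_mul, hT.seg_mul_seg convex_univ (fun t _ => hc t) (fun t _ => hj t)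
    (x := x) (y := t) (z := s) trivial trivial trivial]

theorem Z_eq_of_dform {F F' : EmbeddedTQFT (E := E) U} (hF : F.IsSmooth) (hT : F.IsThinInvariant)
    (hF' : F'.IsSmooth) (hT' : F'.IsThinInvariant) (h' : F.Z' = F'.Z')
    (h : ∀ j, ∀ y ∈ U j, F.dform j y = F'.dform j y) : F.Z = F'.Z := by
  refine Z_eq_of_zero hT hT' h' ?_
  rintro ⟨n, x, i, p, hP⟩ hn
  change n = 0 at hn
  subst hn
  set P : PathObject (E := E) U := ⟨0, x, i, p, hP⟩
  -- Outside its domain the path keeps its end values, so it remains in `U (i 0)` and the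
  -- differential equation holds on the whole line.
  have hm : ∀ t, p t ∈ U (i 0) := by
    obtain ⟨ε, hε, h1⟩ := hP.const_left
    obtain ⟨ε', hε', h2⟩ := hP.const_right
    have hlt := hP.lt
    intro t
    rcases lt_or_ge t (x 0) with ht | ht
    · rw [h1 t (by linarith)]
      exact hP.mem 0 _ ⟨le_rfl, hlt.le⟩
    · rcases le_or_gt t (x 1) with ht' | ht'
      · exact hP.mem 0 _ ⟨ht, ht'⟩
      · have h3 : x (Fin.last (0 + 1)) = x 1 := rfl
        rw [h2 t (by linarith)]
        exact hP.mem 0 _ ⟨hlt.le, le_rfl⟩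
  have hZ : ∀ G : EmbeddedTQFT (E := E) U, G.IsThinInvariant →
      G.Z P = G.seg (i 0) (fun r => p (P.a + (P.b - P.a) * r)) := fun G hG =>
    hG.Z_eq_seg P rfl rfl convex_univ (c := p) (k := fun s => s) (fun t _ => hP.smooth t)
      (fun t _ => hm t) contDiff_id (fun _ _ => trivial) (fun _ _ => rfl)
  rw [hZ F hT, hZ F' hT']
  refine eq_of_hasDerivAt_eq_mul (u := fun t => F.seg (i 0) (fun r => p (P.a + (t - P.a) * r)))
    (u' := fun t => F'.seg (i 0) (fun r => p (P.a + (t - P.a) * r))) (x := P.a) ?_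
    (fun t => hasDerivAt_seg_of_curve hF hT hP.smooth hm P.a t) (fun t => ?_) P.b
  · simp only [sub_self, zero_mul, add_zero]
    rw [hT.seg_const (hm _), hT'.seg_const (hm _)]
  · rw [h _ _ (hm t)]
    exact hasDerivAt_seg_of_curve hF' hT' hP.smooth hm P.a t

end EmbeddedTQFT
end Uniqueness

/-! ### The bijection and the formula for the connection form -/

section Correspondence

open Filter Topology

variable {E : Type*} [NormedAddCommGroup E] [NormedSpace ℝ E] [FiniteDimensional ℝ E]
  {M : Type*} [TopologicalSpace M] [ChartedSpace E M] [IsManifold 𝓘(ℝ, E) ∞ M]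
  {J : Type*} {U : J → Opens M}

namespace EmbeddedTQFT

/-- Both TQFTs have the same `Z'`, and by `dform_toTQFT` the same infinitesimal form; the uniqueness
result does the rest. -/
theorem toTQFT_toBundle {F : EmbeddedTQFT (E := E) U} (hF : F.IsSmooth) (hT : F.IsThinInvariant)
    (hU : ∀ y : M, ∃ i, y ∈ U i) : (F.toBundle hF hT).toTQFT hU = F := by
  have h1 : ((F.toBundle hF hT).toTQFT hU).Z' = F.Z' := by
    have hg : ∀ (y : M) (i j : J) (hi : y ∈ U i) (hj : y ∈ U j),
        (F.toBundle hF hT).gExt i j y = F.Z' ⟨.pos, y, i, j, hi, hj⟩ := by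
      intro y i j hi hj
      rw [BundleWithConnection.gExt_of_mem _ hi hj, ← hT.Z_constPath, ← F.transition_eq]
      rfl
    funext ⟨σ, y, i, j, hi, hj⟩
    cases σ
    · exact hg y i j hi hj
    · rw [hT.Z'_neg, ← hg y i j hi hj]
      rfl
  refine EmbeddedTQFT.ext_of_eq h1 (Z_eq_of_dform (BundleWithConnection.toTQFT_isSmooth _ hU)
    (BundleWithConnection.toTQFT_isThinInvariant _ hU) hF hT h1 fun j y hy => ?_)
  exact BundleWithConnection.dform_toTQFT _ hU hy

/-- Thin invariance makes the choice of `Q t` immaterial, so no regularity in `t` is needed. The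
value at `t = 0` is `1`, where the principal logarithm is differentiable with derivative `1`. -/
theorem hasDerivAt_log_shortPath {F : EmbeddedTQFT (E := E) U} (hF : F.IsSmooth)
    (hT : F.IsThinInvariant) {j : J} {δ : ℝ} (hδ : 0 < δ) {q : ℝ → M}
    (hq : ContMDiffOn 𝓘(ℝ, ℝ) 𝓘(ℝ, E) ∞ q (Ioo (-δ) δ)) (hqU : ∀ t ∈ Ioo (-δ) δ, q t ∈ U j)
    {Q : ℝ → PathObject (E := E) U} (hQ : ∀ t ∈ Ioo (-δ) δ, IsShortPath q δ j t (Q t)) :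
    HasDerivAt (fun t : ℝ => Complex.log ((F.Z (Q t) : Circle) : ℂ))
      (Complex.I * ((F.dform j (q 0) (mfderiv 𝓘(ℝ, ℝ) 𝓘(ℝ, E) q 0 (1 : ℝ)) : ℝ) : ℂ)) 0 := by
  have h0 : (0 : ℝ) ∈ Ioo (-δ) δ := ⟨neg_lt_zero.2 hδ, hδ⟩
  have hq' : ∀ t ∈ Ioo (-δ) δ, ContMDiffAt 𝓘(ℝ, ℝ) 𝓘(ℝ, E) ∞ q t := fun t ht =>
    hq.contMDiffAt (isOpen_Ioo.mem_nhds ht)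
  have h1 : ∀ t ∈ Ioo (-δ) δ, F.Z (Q t) = F.seg j (fun r => q (t * r)) := by
    intro t ht
    obtain ⟨hn, ha, hb, hf, τ, hτ, hτm, ⟨ε, hε, hl, hr⟩, hp⟩ := hQ t ht
    have hlast : (Q t).iLast = j := by
      rw [← hf]
      refine congrArg (Q t).i (Fin.ext ?_)
      simp [hn]
    rw [hT.Z_eq_seg (Q t) hf hlast (convex_Ioo (-δ) δ) hq' hqU hτ (fun s _ => hτm s)
      (fun s _ => hp s), ha, hb, hl 0 hε, hr 1 (by linarith)]
    simp
  have h2 := hasDerivAt_seg hF hT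
    (by filter_upwards [isOpen_Ioo.mem_nhds h0] with t ht using hq' t ht) (hqU 0 h0)
  have h3 := h2.congr_of_eventuallyEq (f₁ := fun t => (F.Z (Q t) : ℂ)) (by
    filter_upwards [isOpen_Ioo.mem_nhds h0] with t ht
    rw [h1 t ht])
  have h4 : (F.Z (Q 0) : ℂ) = 1 := by
    rw [h1 0 h0]
    simp only [zero_mul, hT.seg_const (hqU 0 h0), Circle.coe_one]
  have h5 := h3.clog_real (by rw [h4]; exact Complex.one_mem_slitPlane)
  rwa [h4, div_one] at h5

end EmbeddedTQFT

/-- Bundles with connection correspond to smooth thin invariant TQFTs. -/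
def bundleEquivTQFT (hU : ∀ y : M, ∃ i, y ∈ U i) : BundleWithConnection (E := E) U ≃
    {F : EmbeddedTQFT (E := E) U // F.IsSmooth ∧ F.IsThinInvariant} where
  toFun B := ⟨B.toTQFT hU, B.toTQFT_isSmooth hU, B.toTQFT_isThinInvariant hU⟩
  invFun F := F.1.toBundle F.2.1 F.2.2
  left_inv B := B.toBundle_toTQFT hU
  right_inv F := Subtype.ext (EmbeddedTQFT.toTQFT_toBundle F.2.1 F.2.2 hU)

end Correspondence

end

theorem mainTheorem1 {E : Type*} [NormedAddCommGroup E] [NormedSpace ℝ E] [FiniteDimensional ℝ E]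
    {M : Type*} [TopologicalSpace M] [T2Space M] [SecondCountableTopology M]
    [ChartedSpace E M] [IsManifold 𝓘(ℝ, E) ∞ M]
    {J : Type*} (U : J → Opens M) (hU : IsGoodCover U) :
    ∃ e : BundleWithConnection (E := E) U ≃
        {F : EmbeddedTQFT (E := E) U // F.IsSmooth ∧ F.IsThinInvariant},
      -- from bundles with connection to TQFTs
      (∀ (B : BundleWithConnection (E := E) U) (y : M) (i j : J) (hi : y ∈ U i) (hj : y ∈ U j),
        (e B).1.Z' ⟨.pos, y, i, j, hi, hj⟩ = B.g i j ⟨y, hi, hj⟩ ∧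
        (e B).1.Z' ⟨.neg, y, i, j, hi, hj⟩ = (B.g i j ⟨y, hi, hj⟩)⁻¹) ∧
      (∀ (B : BundleWithConnection (E := E) U) (P : PathObject (E := E) U),
        (e B).1.Z P = B.transport P) ∧
      -- from TQFTs to bundles with connection
      (∀ (F : {F : EmbeddedTQFT (E := E) U // F.IsSmooth ∧ F.IsThinInvariant})
        (y : M) (i j : J) (hi : y ∈ U i) (hj : y ∈ U j),
        (e.symm F).g i j ⟨y, hi, hj⟩ = F.1.Z (constPath U i j y hi hj)) ∧
      (∀ (F : {F : EmbeddedTQFT (E := E) U // F.IsSmooth ∧ F.IsThinInvariant})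
        (j : J) (δ : ℝ) (hδ : 0 < δ) (q : ℝ → M)
        (_ : ContMDiffOn 𝓘(ℝ, ℝ) 𝓘(ℝ, E) ∞ q (Ioo (-δ) δ))
        (hqU : ∀ t ∈ Ioo (-δ) δ, q t ∈ U j)
        (Q : ℝ → PathObject (E := E) U)
        (_ : ∀ t ∈ Ioo (-δ) δ, IsShortPath q δ j t (Q t)),
        HasDerivAt (fun t : ℝ => Complex.log ((F.1.Z (Q t) : Circle) : ℂ))
          (Complex.I * (((e.symm F).A j ⟨q 0, hqU 0 ⟨neg_lt_zero.2 hδ, hδ⟩⟩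
            (mfderiv 𝓘(ℝ, ℝ) 𝓘(ℝ, E) q 0 (1 : ℝ)) : ℝ) : ℂ)) 0) := by
  refine ⟨bundleEquivTQFT hU.covers, fun B y i j hi hj => ?_, fun B P => rfl,
    fun F y i j hi hj => F.1.transition_eq hi hj, fun F j δ hδ q hq hqU Q hQ =>
      EmbeddedTQFT.hasDerivAt_log_shortPath F.2.1 F.2.2 hδ hq hqU hQ⟩
  have h := B.gExt_of_mem hi hj
  exact ⟨h, congrArg (·⁻¹) h⟩
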